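/- Let $K$ be a field of characteristic zero. A graph consists of finite sets $H$ of half-edges and $V$ of vertices, a surjection $\varphi\colon H\to V$ (so every vertex has valence $|\varphi^{-1}(v)|\ge 1$; valence one is allowed), and a partition of $H$ into two-element sets, the edges. Graphs may be empty or disconnected and may have loops and multiple edges. A ribbon graph is a graph with a cyclic ordering of each fibre $\varphi^{-1}(v)$. An orientation is an ordering of $H$, an ordering of $V$ and a sign, modulo the relation that a transposition in either ordering changes the sign. Let $\widetilde{\mathcal G}_r$ (respectively $\widetilde{\mathcal G}$) be the $K$-vector space of formal, possibly infinite, linear combinations of isomorphism classes of oriented ribbon graphs (respectively oriented graphs), modulo the relation that reversing the orientation changes the sign. Let $d\Gamma=\sum_e d_e\Gamma$, the sum over all edges $e$ of $\Gamma$. Here $d_e\Gamma=0$ if $e$ is a loop or if both endpoints of $e$ are univalent. Otherwise let $h_1,h_2$ be the halves of $e$ and $v_1\ne v_2$ the vertices at them, and write the orientation as $h_1,h_2,p_1,\dots,p_s$ and $v_1,v_2,w_1,\dots,w_t$ with sign $+$. Then $d_e\Gamma$ is obtained by contracting $e$ to a vertex $v$, with orientation $p_1,\dots,p_s$ and $v,w_1,\dots,w_t$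 and sign $+$. In the ribbon case, if the cyclic orders at $v_1,v_2$ are $(a_1,\dots,a_i=h_1)$ and $(b_1,\dots,b_j=h_2)$, the one at $v$ is $(a_1,\dots,a_{i-1},b_1,\dots,b_{j-1})$. Then $d^2=0$ in both cases, and the following holds. (a) Let $S_r\subset\widetilde{\mathcal G}_r$ be the space of formal linear combinations of ribbon graphs without loops in which, in each connected component, every vertex is univalent with the exception of at most one vertex, which has odd valence (that is, every component is a star with an odd number of edges). Then $d$ vanishes on $S_r$, and the inclusion induces an isomorphism of $S_r$ onto the homology $\ker d/\operatorname{im} d$ of $(\widetilde{\mathcal G}_r,d)$. Each of these graphs, with any orientation, is nonzero in $\widetilde{\mathcal G}_r$. (b) Let $S\subset\widetilde{\mathcal G}$ be the space of formal linear combinations of graphs each of whose connected components is the connected graph with one edge and two vertices. Then $d$ vanishes on $S$, and the inclusion induces an isomorphism of $S$ onto the homology of $(\widetilde{\mathcal G},d)$. Each of these graphs, with any orientation, is nonzero in $\widetilde{\mathcal G}$. -/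

import Mathlib

/-! Oriented graphs and ribbon graphs, their complexes of formal linear combinations, and the
edge contraction differential. Valence-one vertices are allowed, valence-zero vertices are not. -/

namespace GraphCx

open Equiv

theorem inv_apply_self' {α : Type*} (σ : Perm α) (x : α) : σ⁻¹ (σ x) = x :=
  Equiv.symm_apply_apply σ x

theorem apply_inv_self' {α : Type*} (σ : Perm α) (x : α) : σ (σ⁻¹ x) = x :=
  Equiv.apply_symm_apply σ x

/-- A graph (`r = false`) or a ribbon graph (`r = true`) with half-edges `Fin k` and vertices
`Fin m`. A half-edge `h` is attached to the vertex `att h`, and every vertex carries at least one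
half-edge. The edges are the two-element orbits `{h, flip h}` of a fixed-point-free involution.
For a ribbon graph, `rot` sends each half-edge to the next one in the cyclic ordering of the
half-edges at its vertex: its cycles are the fibres of `att`. Half-edges and vertices
are ordered by the order of `Fin`, and so the graph is oriented (with sign `+1`). -/
@[ext]
structure Graph (r : Bool) (k m : ℕ) where
  att : Fin k → Fin m
  att_surj : Function.Surjective att
  flip : Perm (Fin k)
  flip_flip : ∀ h, flip (flip h) = h
  flip_ne : ∀ h, flip h ≠ h
  rot : r = true → Perm (Fin k)
  rot_cycle : ∀ (hr : r = true) (x y : Fin k), (rot hr).SameCycle x y ↔ att x = att y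

/-- Reorderings of `k` half-edges and `m` vertices. -/
abbrev Reord (k m : ℕ) : Type := Perm (Fin k) × Perm (Fin m)

/-- The product of the signs of the two permutations. -/
def Reord.sgn {k m : ℕ} (g : Reord k m) : ℤˣ := Perm.sign g.1 * Perm.sign g.2

theorem Reord.sgn_mul {k m : ℕ} (g g' : Reord k m) : (g * g').sgn = g.sgn * g'.sgn := by
  simp only [Reord.sgn, Prod.fst_mul, Prod.snd_mul, Perm.sign_mul]
  exact mul_mul_mul_comm _ _ _ _

variable {r : Bool} {k m : ℕ}

namespace Graph

/-- Transport of a graph along a renaming of its half-edges and vertices. -/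
def relabel (g : Reord k m) (Γ : Graph r k m) : Graph r k m where
  att x := g.2 (Γ.att (g.1⁻¹ x))
  att_surj := g.2.surjective.comp (Γ.att_surj.comp (g.1⁻¹).surjective)
  flip := g.1 * Γ.flip * g.1⁻¹
  flip_flip x := by simp [Γ.flip_flip]
  flip_ne x h := Γ.flip_ne (g.1⁻¹ x) (by
    simp only [Perm.mul_apply] at h
    exact (Perm.eq_inv_iff_eq).2 h)
  rot hr := g.1 * Γ.rot hr * g.1⁻¹
  rot_cycle hr x y := by
    rw [Perm.sameCycle_conj, Γ.rot_cycle hr]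
    exact (g.2.injective.eq_iff).symm

theorem relabel_relabel (g g' : Reord k m) (Γ : Graph r k m) :
    (Γ.relabel g').relabel g = Γ.relabel (g * g') := by
  ext <;> simp [relabel]

theorem relabel_one (Γ : Graph r k m) : Γ.relabel 1 = Γ := by
  ext <;> simp [relabel]

end Graph

section Skip

/-- Deletes `0` from the cycles of a permutation (a point mapped to `0` is now mapped to the
image of `0`) and renumbers. -/
def skipZero {n : ℕ} (σ : Perm (Fin (n + 1))) : Perm (Fin n) := (Perm.decomposeFin σ).2

theorem skipZero_succ {n : ℕ} (σ : Perm (Fin (n + 1))) (x : Fin n) :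
    (skipZero σ x).succ = if σ x.succ = 0 then σ 0 else σ x.succ := by
  obtain ⟨⟨p, e⟩, rfl⟩ := Perm.decomposeFin.symm.surjective σ
  simp only [skipZero, Equiv.apply_symm_apply, Perm.decomposeFin_symm_apply_succ,
    Perm.decomposeFin_symm_apply_zero]
  rw [swap_apply_def]
  have := Fin.succ_ne_zero (e x)
  split_ifs <;> simp_all

theorem sign_skipZero {n : ℕ} (σ : Perm (Fin (n + 1))) :
    Perm.sign σ = (if σ 0 = 0 then 1 else -1) * Perm.sign (skipZero σ) := by
  obtain ⟨⟨p, e⟩, rfl⟩ := Perm.decomposeFin.symm.surjective σ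
  simp [skipZero]

theorem skipZero_step {n : ℕ} (σ : Perm (Fin (n + 1))) (x : Fin n) :
    σ.SameCycle x.succ (skipZero σ x).succ := by
  rw [skipZero_succ]
  split_ifs with h
  · exact ⟨2, by rw [zpow_ofNat, pow_two, Perm.mul_apply, h]⟩
  · exact ⟨1, by simp⟩

theorem sameCycle_skipZero {n : ℕ} (σ : Perm (Fin (n + 1))) (x y : Fin n) :
    (skipZero σ).SameCycle x y ↔ σ.SameCycle x.succ y.succ := by
  constructor
  · intro h
    obtain ⟨N, rfl⟩ := h.exists_nat_pow_eq
    clear h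
    induction N with
    | zero => exact Perm.SameCycle.refl _ _
    | succ N ih =>
      rw [pow_succ', Perm.mul_apply]
      exact ih.trans (skipZero_step σ _)
  · intro h
    obtain ⟨N, hN⟩ := h.exists_nat_pow_eq
    clear h
    induction N using Nat.strong_induction_on generalizing x with
    | _ N ih =>
      rcases N with _ | N
      · have : x = y := Fin.succ_injective _ (by simpa using hN)
        exact this ▸ Perm.SameCycle.refl _ _
      · have hs := skipZero_succ σ x
        have hx : (skipZero σ).SameCycle x (skipZero σ x) := ⟨1, by simp⟩
        rw [pow_succ, Perm.mul_apply] at hN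
        split_ifs at hs with h0
        · rcases N with _ | N
          · simp [h0] at hN
            exact absurd hN.symm (Fin.succ_ne_zero y)
          · rw [h0, pow_succ, Perm.mul_apply, ← hs] at hN
            exact hx.trans (ih N (by omega) _ hN)
        · rw [← hs] at hN
          exact hx.trans (ih N (by omega) _ hN)

/-- Deletes `0` and `1` from the cycles of a permutation and renumbers. -/
def skipTwo {n : ℕ} (σ : Perm (Fin (n + 2))) : Perm (Fin n) := skipZero (skipZero σ)

/-- The first of `σ x, σ (σ x), σ (σ (σ x))` that is neither `0` nor `1`. -/
def firstReturn {n : ℕ} (σ : Perm (Fin (n + 2))) (x : Fin (n + 2)) : Fin (n + 2) :=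
  if σ x ≠ 0 ∧ σ x ≠ 1 then σ x
  else if σ (σ x) ≠ 0 ∧ σ (σ x) ≠ 1 then σ (σ x) else σ (σ (σ x))

theorem skipTwo_succ {n : ℕ} (σ : Perm (Fin (n + 2))) (x : Fin n) :
    (skipTwo σ x).succ.succ = firstReturn σ x.succ.succ := by
  have h1 := skipZero_succ (skipZero σ) x
  have h2 := skipZero_succ σ x.succ
  have h3 := skipZero_succ σ 0
  have e0 : σ x.succ.succ ≠ σ 0 := by
    intro h; exact Fin.succ_ne_zero _ (σ.injective h)
  have e1 : σ x.succ.succ ≠ σ 1 := by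
    intro h
    have := σ.injective h
    rw [← Fin.succ_zero_eq_one] at this
    exact Fin.succ_ne_zero _ (Fin.succ_injective _ this)
  have e2 : σ 0 ≠ σ 1 := by
    intro h; have := σ.injective h; simp at this
  rw [Fin.succ_zero_eq_one] at h3
  have key : ∀ z : Fin (n + 1), z = 0 ↔ z.succ = 1 := by
    intro z; rw [← Fin.succ_zero_eq_one, (Fin.succ_injective _).eq_iff]
  unfold skipTwo firstReturn
  rw [h1]
  by_cases a : σ x.succ.succ = 0
  · rw [if_pos a] at h2
    by_cases b : σ 0 = 1
    · have hz : (skipZero σ) x.succ = 0 := (key _).2 (h2.trans b)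
      rw [if_pos hz, h3]
      have c : σ 1 ≠ 0 := fun h => e1 (a.trans h.symm)
      simp [a, b, c]
    · have hz : (skipZero σ) x.succ ≠ 0 := fun h => b (h2 ▸ (key _).1 h)
      rw [if_neg hz, h2]
      have c : σ 0 ≠ 0 := fun h => e0 (a.trans h.symm)
      simp [a, b, c]
  · rw [if_neg a] at h2
    by_cases b : σ x.succ.succ = 1
    · have hz : (skipZero σ) x.succ = 0 := (key _).2 (h2.trans b)
      rw [if_pos hz, h3]
      have c : σ 1 ≠ 1 := fun h => e1 (b.trans h.symm)
      by_cases d : σ 1 = 0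
      · simp [b, d]
      · simp [b, c, d]
    · have hz : (skipZero σ) x.succ ≠ 0 := fun h => b (h2 ▸ (key _).1 h)
      rw [if_neg hz, h2]
      simp [a, b]

/-- `σ` maps the set `{0, 1}` to itself. -/
def Keeps01 {n : ℕ} (σ : Perm (Fin (n + 2))) : Prop :=
  (σ 0 = 0 ∧ σ 1 = 1) ∨ (σ 0 = 1 ∧ σ 1 = 0)

theorem Keeps01.iff {n : ℕ} {σ : Perm (Fin (n + 2))} (h : Keeps01 σ) (x : Fin (n + 2)) :
    (σ x ≠ 0 ∧ σ x ≠ 1) ↔ (x ≠ 0 ∧ x ≠ 1) := by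
  have h0 : σ x = σ 0 ↔ x = 0 := σ.injective.eq_iff
  have h1 : σ x = σ 1 ↔ x = 1 := σ.injective.eq_iff
  rcases h with ⟨a, b⟩ | ⟨a, b⟩ <;> rw [a] at h0 <;> rw [b] at h1 <;> tauto

theorem succ_succ_ne {n : ℕ} (x : Fin n) : x.succ.succ ≠ 0 ∧ x.succ.succ ≠ 1 := by
  refine ⟨Fin.succ_ne_zero _, ?_⟩
  rw [← Fin.succ_zero_eq_one, Ne, (Fin.succ_injective _).eq_iff]
  exact Fin.succ_ne_zero _

theorem exists_succ_succ {n : ℕ} {x : Fin (n + 2)} (h0 : x ≠ 0) (h1 : x ≠ 1) :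
    ∃ y : Fin n, y.succ.succ = x := by
  obtain ⟨z, rfl⟩ := Fin.exists_succ_eq.2 h0
  have hz : z ≠ 0 := by rintro rfl; exact h1 Fin.succ_zero_eq_one
  obtain ⟨y, rfl⟩ := Fin.exists_succ_eq.2 hz
  exact ⟨y, rfl⟩

theorem Keeps01.skipTwo_succ {n : ℕ} {σ : Perm (Fin (n + 2))} (h : Keeps01 σ) (x : Fin n) :
    (skipTwo σ x).succ.succ = σ x.succ.succ := by
  rw [GraphCx.skipTwo_succ, firstReturn, if_pos ((h.iff _).2 (succ_succ_ne x))]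

theorem skipTwo_conj {n : ℕ} {σ : Perm (Fin (n + 2))} (h : Keeps01 σ) (θ : Perm (Fin (n + 2))) :
    skipTwo (σ * θ * σ⁻¹) = skipTwo σ * skipTwo θ * (skipTwo σ)⁻¹ := by
  ext1 y
  obtain ⟨x, rfl⟩ := (skipTwo σ).surjective y
  apply Fin.succ_injective
  apply Fin.succ_injective
  rw [skipTwo_succ, Perm.mul_apply, Perm.mul_apply, inv_apply_self', h.skipTwo_succ,
    h.skipTwo_succ, skipTwo_succ]
  unfold firstReturn
  simp only [Perm.mul_apply, inv_apply_self', h.iff]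
  split_ifs <;> rfl

theorem keeps01_sign {k m : ℕ} {σ : Perm (Fin (k + 2))} {τ : Perm (Fin (m + 2))}
    (h : (σ 0 = 0 ∧ σ 1 = 1 ∧ τ 0 = 0 ∧ τ 1 = 1) ∨ (σ 0 = 1 ∧ σ 1 = 0 ∧ τ 0 = 1 ∧ τ 1 = 0)) :
    Reord.sgn (skipTwo σ, skipZero τ) = Reord.sgn (σ, τ) := by
  have a := sign_skipZero σ
  have b := sign_skipZero (skipZero σ)
  have c := sign_skipZero τ
  have d := skipZero_succ σ 0
  rw [Fin.succ_zero_eq_one] at d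
  unfold Reord.sgn skipTwo
  rcases h with ⟨h1, h2, h3, h4⟩ | ⟨h1, h2, h3, h4⟩
  · have e : skipZero σ 0 = 0 := by
      apply Fin.succ_injective
      rw [d, h2]; simp
    rw [a, b, c, h1, h3, e]; simp
  · have e : skipZero σ 0 = 0 := by
      apply Fin.succ_injective
      rw [d, h2, h1]; simp
    rw [a, b, c, h1, h3, e]; simp

end Skip

section Merge

/-- Identifies the vertices `0` and `1`: `0` and `1` go to `0`, and `j + 1` goes to `j`. -/
def merge {m : ℕ} : Fin (m + 2) → Fin (m + 1) := Fin.predAbove 0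

theorem merge_zero {m : ℕ} : merge (0 : Fin (m + 2)) = 0 := by simp [merge]

theorem merge_succ {m : ℕ} (j : Fin (m + 1)) : merge j.succ = j := by
  simp [merge]

theorem merge_one {m : ℕ} : merge (1 : Fin (m + 2)) = 0 := by
  rw [← Fin.succ_zero_eq_one, merge_succ]

theorem merge_eq_iff {m : ℕ} (v w : Fin (m + 2)) :
    merge v = merge w ↔ v = w ∨ ((v = 0 ∨ v = 1) ∧ (w = 0 ∨ w = 1)) := by
  have key : ∀ j : Fin (m + 1), j.succ = 1 ↔ j = 0 := by
    intro z; rw [← Fin.succ_zero_eq_one, (Fin.succ_injective _).eq_iff]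
  refine Fin.cases ?_ (fun v => ?_) v <;> refine Fin.cases ?_ (fun w => ?_) w
  · simp
  · simp only [merge_zero, merge_succ, key, Fin.succ_ne_zero]
    have := Fin.succ_ne_zero w
    grind
  · simp only [merge_zero, merge_succ, key, Fin.succ_ne_zero]
    have := Fin.succ_ne_zero v
    grind
  · simp only [merge_succ, key, Fin.succ_ne_zero, (Fin.succ_injective _).eq_iff]
    grind

theorem merge_perm {m : ℕ} {τ : Perm (Fin (m + 2))} (h : Keeps01 τ) (v : Fin (m + 2)) :
    skipZero τ (merge v) = merge (τ v) := by
  apply Fin.succ_injective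
  have s0 := skipZero_succ τ 0
  rw [Fin.succ_zero_eq_one] at s0
  have succ_merge : ∀ w : Fin (m + 2), w ≠ 0 → (merge w).succ = w := by
    intro w hw
    obtain ⟨z, rfl⟩ := Fin.exists_succ_eq.2 hw
    rw [merge_succ]
  by_cases hv0 : v = 0
  · subst hv0
    rw [merge_zero, s0]
    rcases h with ⟨a, b⟩ | ⟨a, b⟩ <;> simp [a, b, merge_zero, merge_one]
  by_cases hv1 : v = 1
  · subst hv1
    rw [merge_one, s0]
    rcases h with ⟨a, b⟩ | ⟨a, b⟩ <;> simp [a, b, merge_zero, merge_one]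
  · obtain ⟨z, rfl⟩ := Fin.exists_succ_eq.2 hv0
    have := ((h.iff _).2 ⟨hv0, hv1⟩).1
    rw [merge_succ, skipZero_succ, if_neg this, succ_merge _ this]

/-- Multiplying a permutation by the transposition of two points of different cycles joins
these two cycles. -/
theorem sameCycle_mul_swap {α : Type*} [Finite α] [DecidableEq α] (σ : Perm α) (a b : α)
    (hab : ¬ σ.SameCycle a b) (x y : α) :
    (σ * swap a b).SameCycle x y ↔
      σ.SameCycle x y ∨ ((σ.SameCycle x a ∨ σ.SameCycle x b) ∧
        (σ.SameCycle y a ∨ σ.SameCycle y b)) := by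
  set τ := σ * swap a b with hτ
  have τa : τ a = σ b := by simp [hτ]
  have τb : τ b = σ a := by simp [hτ]
  have τx : ∀ z, z ≠ a → z ≠ b → τ z = σ z := by
    intro z h1 h2; simp [hτ, swap_apply_of_ne_of_ne h1 h2]
  have step : ∀ z, σ.SameCycle z (σ z) := fun z => ⟨1, by simp⟩
  have tstep : ∀ z, τ.SameCycle z (τ z) := fun z => ⟨1, by simp⟩
  -- the two points become cycle mates
  have tab : τ.SameCycle b a := by
    have hex : ∃ p, 0 < p ∧ (σ ^ p) a = a :=
      ⟨orderOf σ, orderOf_pos σ, by simp [pow_orderOf_eq_one]⟩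
    classical
    have hp := Nat.find_spec hex
    have hmin := fun q => Nat.find_min hex (m := q)
    set p := Nat.find hex
    have ind : ∀ i, i + 1 ≤ p → (τ ^ (i + 1)) b = (σ ^ (i + 1)) a := by
      intro i
      induction i with
      | zero => intro _; simpa using τb
      | succ i ih =>
        intro hi
        rw [pow_succ', Perm.mul_apply, ih (by omega), pow_succ' σ (i + 1), Perm.mul_apply]
        apply τx
        · intro h
          exact hmin (i + 1) (by omega) ⟨by omega, h⟩
        · intro h
          exact hab ⟨((i + 1 : ℕ) : ℤ), by rw [zpow_natCast]; exact h⟩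
    have := ind (p - 1) (by omega)
    rw [Nat.sub_add_cancel hp.1, hp.2] at this
    exact ⟨(p : ℤ), by rw [zpow_natCast]; exact this⟩
  have back : ∀ z, τ.SameCycle z (σ z) := by
    intro z
    by_cases h1 : z = a
    · subst h1; rw [← τb]; exact tab.symm.trans (tstep b)
    by_cases h2 : z = b
    · subst h2; rw [← τa]; exact tab.trans (tstep a)
    · rw [← τx z h1 h2]; exact tstep z
  have back' : ∀ z w, σ.SameCycle z w → τ.SameCycle z w := by
    intro z w h
    obtain ⟨N, rfl⟩ := h.exists_nat_pow_eq
    clear h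
    induction N with
    | zero => exact Perm.SameCycle.refl _ _
    | succ N ih => rw [pow_succ', Perm.mul_apply]; exact ih.trans (back _)
  constructor
  · intro h
    obtain ⟨N, rfl⟩ := h.exists_nat_pow_eq
    clear h
    induction N with
    | zero => exact Or.inl (Perm.SameCycle.refl _ _)
    | succ N ih =>
      rw [pow_succ', Perm.mul_apply]
      generalize (τ ^ N) x = z at ih ⊢
      by_cases h1 : z = a
      · subst h1
        rw [τa]
        have hb := (step b).symm
        have hr := Perm.SameCycle.refl σ z
        tauto
      by_cases h2 : z = b
      · subst h2
        rw [τb]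
        have hb := (step a).symm
        have hr := Perm.SameCycle.refl σ z
        tauto
      · rw [τx z h1 h2]
        rcases ih with h | ⟨h, h'⟩
        · exact Or.inl (h.trans (step z))
        · exact Or.inr ⟨h, h'.imp ((step z).symm.trans ·) ((step z).symm.trans ·)⟩
  · rintro (h | ⟨h | h, h' | h'⟩)
    · exact back' _ _ h
    · exact (back' _ _ h).trans (back' _ _ h').symm
    · exact (back' _ _ h).trans (tab.symm.trans (back' _ _ h').symm)
    · exact (back' _ _ h).trans (tab.trans (back' _ _ h').symm)
    · exact (back' _ _ h).trans (back' _ _ h').symm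

end Merge

namespace Graph

/-- The half-edges `0, 1` form an edge, from the vertex `0` to the vertex `1`. -/
structure IsFront (Γ : Graph r (k + 2) (m + 2)) : Prop where
  flip_zero : Γ.flip 0 = 1
  att_zero : Γ.att 0 = 0
  att_one : Γ.att 1 = 1

/-- The edge `{h, flip h}` can be contracted: it is not a loop, and its endpoints are not both
univalent (otherwise the contraction would have a vertex of valence zero). -/
def Contractible (Γ : Graph r k m) (h : Fin k) : Prop :=
  Γ.att h ≠ Γ.att (Γ.flip h) ∧
    ∃ x, x ≠ h ∧ x ≠ Γ.flip h ∧ (Γ.att x = Γ.att h ∨ Γ.att x = Γ.att (Γ.flip h))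

theorem IsFront.flip_one {Γ : Graph r (k + 2) (m + 2)} (hf : Γ.IsFront) : Γ.flip 1 = 0 := by
  rw [← hf.flip_zero, Γ.flip_flip]

theorem IsFront.skip_flip {Γ : Graph r (k + 2) (m + 2)} (hf : Γ.IsFront) (x : Fin k) :
    (skipTwo Γ.flip x).succ.succ = Γ.flip x.succ.succ := by
  have : Keeps01 Γ.flip := Or.inr ⟨hf.flip_zero, hf.flip_one⟩
  exact this.skipTwo_succ x

/-- The contraction of the edge formed by the first two half-edges `h₁ = 0`, `h₂ = 1`, whose
endpoints are the first two vertices `v₁ = 0`, `v₂ = 1`. The remaining half-edges and vertices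
keep their order, and the new vertex comes first. If the cyclic orders at `v₁`, `v₂` are
`(a₁, …, aᵢ = h₁)` and `(b₁, …, bⱼ = h₂)`, then the one at the new vertex is
`(a₁, …, aᵢ₋₁, b₁, …, bⱼ₋₁)`: the product `rot * swap h₁ h₂` has the cycle
`(a₁, …, aᵢ₋₁, h₁, b₁, …, bⱼ₋₁, h₂)`, from which `h₁` and `h₂` are deleted. -/
def contract (Γ : Graph r (k + 2) (m + 2)) (hf : Γ.IsFront) (hc : Γ.Contractible 0) :
    Graph r k (m + 1) where
  att x := merge (Γ.att x.succ.succ)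
  att_surj v := by
    by_cases hv : v = 0
    · subst hv
      obtain ⟨-, x, hx0, hx1, hx⟩ := hc
      rw [hf.flip_zero] at hx1 hx
      obtain ⟨y, rfl⟩ := exists_succ_succ hx0 hx1
      refine ⟨y, ?_⟩
      rw [hf.att_zero, hf.att_one] at hx
      rcases hx with hx | hx <;> simp only [hx, merge_zero, merge_one]
    · obtain ⟨x, hx⟩ := Γ.att_surj v.succ
      have hx0 : x ≠ 0 := by
        rintro rfl
        rw [hf.att_zero] at hx
        exact Fin.succ_ne_zero _ hx.symm
      have hx1 : x ≠ 1 := by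
        rintro rfl
        rw [hf.att_one, ← Fin.succ_zero_eq_one] at hx
        exact hv (Fin.succ_injective _ hx).symm
      obtain ⟨y, rfl⟩ := exists_succ_succ hx0 hx1
      exact ⟨y, by simp only [hx, merge_succ]⟩
  flip := skipTwo Γ.flip
  flip_flip x := by
    apply Fin.succ_injective
    apply Fin.succ_injective
    rw [hf.skip_flip, hf.skip_flip, Γ.flip_flip]
  flip_ne x h := by
    apply Γ.flip_ne x.succ.succ
    rw [← hf.skip_flip, h]
  rot hr := skipTwo (Γ.rot hr * swap 0 1)
  rot_cycle hr x y := by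
    have hab : ¬ (Γ.rot hr).SameCycle 0 1 := by
      rw [Γ.rot_cycle, hf.att_zero, hf.att_one]; simp
    unfold skipTwo
    rw [sameCycle_skipZero, sameCycle_skipZero, sameCycle_mul_swap _ _ _ hab]
    simp only [Γ.rot_cycle, hf.att_zero, hf.att_one, merge_eq_iff]

/-- The reordering `g` moves the half-edge `h` and the vertex at `h` to the first place and the
other half of its edge and the vertex there to the second place. -/
structure MovesToFront (Γ : Graph r (k + 2) (m + 2)) (h : Fin (k + 2))
    (g : Reord (k + 2) (m + 2)) : Prop where
  half_one : g.1 h = 0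
  half_two : g.1 (Γ.flip h) = 1
  vert_one : g.2 (Γ.att h) = 0
  vert_two : g.2 (Γ.att (Γ.flip h)) = 1

theorem MovesToFront.isFront {Γ : Graph r (k + 2) (m + 2)} {h : Fin (k + 2)}
    {g : Reord (k + 2) (m + 2)} (hg : Γ.MovesToFront h g) : (Γ.relabel g).IsFront := by
  have e0 : g.1⁻¹ 0 = h := by rw [← hg.half_one]; simp
  have e1 : g.1⁻¹ 1 = Γ.flip h := by rw [← hg.half_two]; simp
  constructor <;> simp only [relabel, Perm.mul_apply, e0, e1]
  · exact hg.half_two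
  · exact hg.vert_one
  · exact hg.vert_two

theorem Contractible.relabel {Γ : Graph r k m} {h : Fin k} (hc : Γ.Contractible h)
    (g : Reord k m) : (Γ.relabel g).Contractible (g.1 h) := by
  obtain ⟨h1, x, hx0, hx1, hx⟩ := hc
  refine ⟨?_, g.1 x, ?_, ?_, ?_⟩ <;> simp only [Graph.relabel, Perm.mul_apply,
    inv_apply_self', ne_eq, EmbeddingLike.apply_eq_iff_eq] <;> assumption

theorem contractible_relabel_iff (Γ : Graph r k m) (h : Fin k) (g : Reord k m) :
    (Γ.relabel g).Contractible (g.1 h) ↔ Γ.Contractible h := by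
  refine ⟨fun hc => ?_, fun hc => hc.relabel g⟩
  have := hc.relabel g⁻¹
  rw [relabel_relabel, inv_mul_cancel, relabel_one] at this
  simpa using this

theorem Contractible.flip {Γ : Graph r k m} {h : Fin k} (hc : Γ.Contractible h) :
    Γ.Contractible (Γ.flip h) := by
  obtain ⟨h1, x, hx0, hx1, hx⟩ := hc
  refine ⟨?_, x, hx1, ?_, ?_⟩ <;> rw [Γ.flip_flip]
  · exact h1.symm
  · exact hx0
  · exact hx.symm

theorem MovesToFront.contractible {Γ : Graph r (k + 2) (m + 2)} {h : Fin (k + 2)}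
    {g : Reord (k + 2) (m + 2)} (hg : Γ.MovesToFront h g) (hc : Γ.Contractible h) :
    (Γ.relabel g).Contractible 0 := hg.half_one ▸ hc.relabel g

theorem exists_perm_front {n : ℕ} {a b : Fin (n + 2)} (hab : a ≠ b) :
    ∃ σ : Perm (Fin (n + 2)), σ a = 0 ∧ σ b = 1 := by
  have hb : swap a 0 b ≠ 0 := by
    intro h
    apply hab
    have : swap a 0 b = swap a 0 a := by rw [h, swap_apply_left]
    exact ((swap a 0).injective this).symm
  refine ⟨swap (swap a 0 b) 1 * swap a 0, ?_, ?_⟩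
  · rw [Perm.mul_apply, swap_apply_left, swap_apply_of_ne_of_ne hb.symm (by simp)]
  · rw [Perm.mul_apply, swap_apply_left]

theorem exists_movesToFront (Γ : Graph r (k + 2) (m + 2)) {h : Fin (k + 2)}
    (hc : Γ.Contractible h) : ∃ g, Γ.MovesToFront h g := by
  obtain ⟨σ, h1, h2⟩ := exists_perm_front (Γ.flip_ne h).symm
  obtain ⟨τ, h3, h4⟩ := exists_perm_front hc.1
  exact ⟨(σ, τ), h1, h2, h3, h4⟩

/-- Contraction of the first edge does not depend, up to the expected reordering, on how the
edge was brought to the front. -/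
theorem contract_relabel (Γ : Graph r (k + 2) (m + 2)) (hf : Γ.IsFront) (hc : Γ.Contractible 0)
    (g : Reord (k + 2) (m + 2))
    (hg : (g.1 0 = 0 ∧ g.1 1 = 1 ∧ g.2 0 = 0 ∧ g.2 1 = 1) ∨
      (g.1 0 = 1 ∧ g.1 1 = 0 ∧ g.2 0 = 1 ∧ g.2 1 = 0))
    (hf' : (Γ.relabel g).IsFront) (hc' : (Γ.relabel g).Contractible 0) :
    (Γ.relabel g).contract hf' hc' =
      (Γ.contract hf hc).relabel (skipTwo g.1, skipZero g.2) := by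
  have k1 : Keeps01 g.1 := by unfold Keeps01; tauto
  have k2 : Keeps01 g.2 := by unfold Keeps01; tauto
  have hinv : ∀ x, g.1⁻¹ x.succ.succ = ((skipTwo g.1)⁻¹ x).succ.succ := by
    intro x
    rw [Perm.inv_eq_iff_eq, ← k1.skipTwo_succ, apply_inv_self']
  have hswap : swap (0 : Fin (k + 2)) 1 = g.1 * swap 0 1 * g.1⁻¹ := by
    rw [← swap_apply_apply]
    rcases hg with ⟨a, b, -⟩ | ⟨a, b, -⟩
    · rw [a, b]
    · rw [a, b, swap_comm]
  apply Graph.ext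
  · funext x
    simp only [contract, relabel, hinv, merge_perm k2]
  · simp only [contract, relabel, skipTwo_conj k1]
  · funext hr
    simp only [contract, relabel]
    rw [← skipTwo_conj k1]
    congr 1
    have hs : g.1 * swap 0 1 = swap 0 1 * g.1 := by
      nth_rewrite 2 [hswap]
      group
    have hs' : g.1⁻¹ * swap 0 1 = swap 0 1 * g.1⁻¹ := by
      rw [inv_mul_eq_iff_eq_mul, ← mul_assoc, hs, mul_inv_cancel_right]
    rw [mul_assoc (g.1 * Γ.rot hr), hs']
    group

end Graph

section Complex

variable (K : Type*) [Field K]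

/-- The relations `relabel g Γ = sgn g • Γ`: isomorphic oriented graphs are identified, and
reversing the orientation changes the sign. -/
noncomputable def orientationRel (r : Bool) (k m : ℕ) : Submodule K (Graph r k m →₀ K) :=
  Submodule.span K {x | ∃ (g : Reord k m) (Γ : Graph r k m),
    x = Finsupp.single (Γ.relabel g) 1 - g.sgn • Finsupp.single Γ 1}

/-- Linear combinations of isomorphism classes of oriented (ribbon) graphs with `k` half-edges
and `m` vertices, modulo the relation that reversing the orientation changes the sign. -/
def Chain (r : Bool) (k m : ℕ) : Type _ := (Graph r k m →₀ K) ⧸ orientationRel K r k m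

noncomputable instance : AddCommGroup (Chain K r k m) :=
  inferInstanceAs (AddCommGroup ((Graph r k m →₀ K) ⧸ orientationRel K r k m))

noncomputable instance : Module K (Chain K r k m) :=
  inferInstanceAs (Module K ((Graph r k m →₀ K) ⧸ orientationRel K r k m))

/-- The quotient map. -/
noncomputable def Chain.mk : (Graph r k m →₀ K) →ₗ[K] Chain K r k m :=
  (orientationRel K r k m).mkQ

/-- The class of an oriented graph. -/
noncomputable def cls (Γ : Graph r k m) : Chain K r k m :=
  Chain.mk K (Finsupp.single Γ 1)

theorem cls_relabel (g : Reord k m) (Γ : Graph r k m) :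
    cls K (Γ.relabel g) = g.sgn • cls K Γ := by
  rw [cls, cls, ← sub_eq_zero]
  have h : Chain.mk K (Finsupp.single (Γ.relabel g) 1 - g.sgn • Finsupp.single Γ 1) = 0 :=
    (Submodule.Quotient.mk_eq_zero _).2 (Submodule.subset_span ⟨g, Γ, rfl⟩)
  rw [map_sub] at h
  rw [← h]
  congr 1

open Classical in
/-- The contraction `d_e Γ` of the oriented graph `Γ` along the edge `e = {h, flip h}`. The
half-edges and vertices are reordered, with the sign of the reordering, so that
the two halves of `e` and its two endpoints come first; then `e` is contracted. The choice of the
reordering is immaterial, see `edgeTerm_eq`. Loops are not contracted, and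
contracting an isolated edge gives a graph with a vertex of valence zero, which is zero. -/
noncomputable def edgeTerm (Γ : Graph r (k + 2) (m + 2)) (h : Fin (k + 2)) :
    Chain K r k (m + 1) :=
  if hc : Γ.Contractible h then
    (Γ.exists_movesToFront hc).choose.sgn •
      cls K ((Γ.relabel (Γ.exists_movesToFront hc).choose).contract
        (Γ.exists_movesToFront hc).choose_spec.isFront
        ((Γ.exists_movesToFront hc).choose_spec.contractible hc))
  else 0

theorem contract_indep (Γ : Graph r (k + 2) (m + 2)) {h h' : Fin (k + 2)}
    (hh : h' = h ∨ h' = Γ.flip h)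
    {g g' : Reord (k + 2) (m + 2)} (hg : Γ.MovesToFront h g) (hg' : Γ.MovesToFront h' g')
    (hc : (Γ.relabel g).Contractible 0) (hc' : (Γ.relabel g').Contractible 0) :
    g'.sgn • cls K ((Γ.relabel g').contract hg'.isFront hc') =
      g.sgn • cls K ((Γ.relabel g).contract hg.isFront hc) := by
  obtain ⟨u, rfl⟩ : ∃ u, g' = u * g := ⟨g' * g⁻¹, by group⟩
  have hu : (u.1 0 = 0 ∧ u.1 1 = 1 ∧ u.2 0 = 0 ∧ u.2 1 = 1) ∨
      (u.1 0 = 1 ∧ u.1 1 = 0 ∧ u.2 0 = 1 ∧ u.2 1 = 0) := by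
    obtain ⟨a1, a2, a3, a4⟩ := hg
    obtain ⟨b1, b2, b3, b4⟩ := hg'
    simp only [Prod.fst_mul, Prod.snd_mul, Perm.mul_apply] at b1 b2 b3 b4
    rcases hh with rfl | rfl
    · rw [a1] at b1; rw [a2] at b2; rw [a3] at b3; rw [a4] at b4
      exact Or.inl ⟨b1, b2, b3, b4⟩
    · rw [Γ.flip_flip] at b2 b4
      rw [a2] at b1; rw [a1] at b2; rw [a4] at b3; rw [a3] at b4
      exact Or.inr ⟨b2, b1, b4, b3⟩
  have hrel : ∀ (Δ : Graph r (k + 2) (m + 2)) (e : Δ = (Γ.relabel g).relabel u)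
      (h1 : Δ.IsFront) (h2 : Δ.Contractible 0),
      cls K (Δ.contract h1 h2) = u.sgn • cls K ((Γ.relabel g).contract hg.isFront hc) := by
    rintro Δ rfl h1 h2
    rw [Graph.contract_relabel _ hg.isFront hc u hu, cls_relabel, keeps01_sign hu]
  rw [hrel _ (Graph.relabel_relabel u g Γ).symm, Reord.sgn_mul, smul_smul, mul_right_comm,
    Int.units_mul_self, one_mul]

/-- Any reordering that brings the edge to the front computes the contraction. -/
theorem edgeTerm_eq (Γ : Graph r (k + 2) (m + 2)) {h : Fin (k + 2)} (hc : Γ.Contractible h)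
    {g : Reord (k + 2) (m + 2)} (hg : Γ.MovesToFront h g) :
    edgeTerm K Γ h =
      g.sgn • cls K ((Γ.relabel g).contract hg.isFront (hg.contractible hc)) := by
  rw [edgeTerm, dif_pos hc]
  exact contract_indep K Γ (Or.inl rfl) hg (Γ.exists_movesToFront hc).choose_spec
    (hg.contractible hc) _

theorem edgeTerm_flip (Γ : Graph r (k + 2) (m + 2)) (h : Fin (k + 2)) :
    edgeTerm K Γ (Γ.flip h) = edgeTerm K Γ h := by
  by_cases hc : Γ.Contractible h
  · rw [edgeTerm, dif_pos hc.flip, edgeTerm, dif_pos hc]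
    exact contract_indep K Γ (Or.inr rfl) (Γ.exists_movesToFront hc).choose_spec
      (Γ.exists_movesToFront hc.flip).choose_spec _ _
  · have hc' : ¬ Γ.Contractible (Γ.flip h) := fun h' => hc (by simpa [Γ.flip_flip] using h'.flip)
    rw [edgeTerm, dif_neg hc', edgeTerm, dif_neg hc]

theorem edgeTerm_relabel (Γ : Graph r (k + 2) (m + 2)) (h : Fin (k + 2))
    (g : Reord (k + 2) (m + 2)) :
    edgeTerm K (Γ.relabel g) (g.1 h) = g.sgn • edgeTerm K Γ h := by
  by_cases hc : Γ.Contractible h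
  · obtain ⟨f, hf⟩ := Γ.exists_movesToFront hc
    have hf' : (Γ.relabel g).MovesToFront (g.1 h) (f * g⁻¹) := by
      constructor <;> simp [Graph.relabel, hf.half_one, hf.half_two, hf.vert_one, hf.vert_two]
    rw [edgeTerm_eq K _ (hc.relabel g) hf', edgeTerm_eq K _ hc hf, smul_smul]
    have hs : (f * g⁻¹).sgn = g.sgn * f.sgn := by
      rw [Reord.sgn_mul, mul_comm]
      congr 1
      simp [Reord.sgn]
    rw [hs]
    congr 2
    have e : (Γ.relabel g).relabel (f * g⁻¹) = Γ.relabel f := by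
      rw [Graph.relabel_relabel, inv_mul_cancel_right]
    congr 1
  · rw [edgeTerm, dif_neg (fun h' => hc ((Γ.contractible_relabel_iff h g).1 h')), edgeTerm,
      dif_neg hc, smul_zero]

/-- `d Γ = ∑ d_e Γ`, the sum over all edges `e = {h, flip h}`; an edge is counted once, at the
smaller `h` of its two halves. -/
noncomputable def graphBoundary (Γ : Graph r (k + 2) (m + 2)) : Chain K r k (m + 1) :=
  ∑ h with h < Γ.flip h, edgeTerm K Γ h

theorem graphBoundary_relabel (Γ : Graph r (k + 2) (m + 2)) (g : Reord (k + 2) (m + 2)) :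
    graphBoundary K (Γ.relabel g) = g.sgn • graphBoundary K Γ := by
  unfold graphBoundary
  rw [Finset.smul_sum]
  have hfl : ∀ h, (Γ.relabel g).flip (g.1 h) = g.1 (Γ.flip h) := by
    intro h; simp [Graph.relabel]
  symm
  refine Finset.sum_bij
    (fun h _ => if g.1 h < g.1 (Γ.flip h) then g.1 h else g.1 (Γ.flip h)) ?_ ?_ ?_ ?_
  · intro h _
    have hne : g.1 (Γ.flip h) ≠ g.1 h := fun e => Γ.flip_ne h (g.1.injective e)
    simp only [Finset.mem_filter, Finset.mem_univ, true_and]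
    split_ifs with hlt
    · rw [hfl]; exact hlt
    · rw [hfl, Γ.flip_flip]
      exact lt_of_le_of_ne (not_lt.1 hlt) hne
  · intro h hh h' hh' e
    simp only [Finset.mem_filter, Finset.mem_univ, true_and] at hh hh'
    have : h = h' ∨ h = Γ.flip h' ∨ Γ.flip h = h' ∨ Γ.flip h = Γ.flip h' := by
      split_ifs at e <;> have := g.1.injective e <;> tauto
    rcases this with h1 | h1 | h1 | h1
    · exact h1
    · rw [h1, Γ.flip_flip] at hh; exact absurd hh (lt_asymm hh')
    · rw [← h1, Γ.flip_flip] at hh'; exact absurd hh' (lt_asymm hh)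
    · exact Γ.flip.injective h1
  · intro y hy
    simp only [Finset.mem_filter, Finset.mem_univ, true_and] at hy
    obtain ⟨x, rfl⟩ := g.1.surjective y
    rw [hfl] at hy
    rcases lt_or_gt_of_ne (Γ.flip_ne x) with hx | hx
    · refine ⟨Γ.flip x, by simpa [Γ.flip_flip] using hx, ?_⟩
      rw [Γ.flip_flip, if_neg (lt_asymm hy)]
    · exact ⟨x, by simpa using hx, if_pos hy⟩
  · intro h _
    split_ifs
    · rw [edgeTerm_relabel]
    · rw [edgeTerm_relabel, edgeTerm_flip]

/-- The differential on linear combinations of graphs with given numbers of half-edges and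
vertices. -/
noncomputable def chainBoundary (r : Bool) (k m : ℕ) :
    Chain K r (k + 2) (m + 2) →ₗ[K] Chain K r k (m + 1) :=
  (orientationRel K r (k + 2) (m + 2)).liftQ
    (Finsupp.linearCombination K (graphBoundary K)) (by
      rw [orientationRel, Submodule.span_le]
      rintro _ ⟨g, Γ, rfl⟩
      have hs : ∀ (u : ℤˣ) (x : Graph r (k + 2) (m + 2) →₀ K),
          Finsupp.linearCombination K (graphBoundary K) (u • x) =
            u • Finsupp.linearCombination K (graphBoundary K) x := by
        intro u x
        rcases Int.units_eq_one_or u with rfl | rfl <;> simp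
      simp only [SetLike.mem_coe, LinearMap.mem_ker, map_sub, hs,
        Finsupp.linearCombination_single, one_smul, graphBoundary_relabel, sub_self])

theorem chainBoundary_cls (Γ : Graph r (k + 2) (m + 2)) :
    chainBoundary K r k m (cls K Γ) = graphBoundary K Γ := by
  refine (Submodule.liftQ_apply _ _ _).trans ?_
  simp

/-- Formal, possibly infinite linear combinations of isomorphism classes of oriented (ribbon)
graphs, modulo the relation that reversing the orientation changes the sign: the completion by
the number of edges. A graph with `k` half-edges has at most `k` vertices, and so it is the
product over all numbers of half-edges and of vertices. -/
abbrev FormalChain (r : Bool) : Type _ := ∀ k m : ℕ, Chain K r k m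

/-- The differential `d`, which removes one edge (two half-edges) and one vertex. Nothing is
mapped to graphs without vertices: a graph with a single vertex has only loops. -/
noncomputable def boundary (r : Bool) : FormalChain K r →ₗ[K] FormalChain K r where
  toFun x := fun k m => match m with
    | 0 => 0
    | m + 1 => chainBoundary K r k m (x (k + 2) (m + 2))
  map_add' x y := by
    funext k m
    cases m <;> simp
  map_smul' c x := by
    funext k m
    cases m <;> simp

/-- The homology `ker d / im d`. -/
abbrev Homology (r : Bool) : Type _ :=
  LinearMap.ker (boundary K r) ⧸ (LinearMap.range (boundary K r)).submoduleOf
    (LinearMap.ker (boundary K r))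

/-- The map to homology from a space of cycles. -/
noncomputable def toHomology {r : Bool} {S : Submodule K (FormalChain K r)}
    (hS : S ≤ LinearMap.ker (boundary K r)) : S →ₗ[K] Homology K r :=
  (Submodule.mkQ _).comp (Submodule.inclusion hS)

/-- The formal linear combinations of the graphs with the property `P`. -/
noncomputable def formalSpan (r : Bool) (P : ∀ {k m : ℕ}, Graph r k m → Prop) :
    Submodule K (FormalChain K r) where
  carrier := {x | ∀ k m, x k m ∈ Submodule.span K {y | ∃ Γ : Graph r k m, P Γ ∧ y = cls K Γ}}
  add_mem' hx hy k m := Submodule.add_mem _ (hx k m) (hy k m)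
  zero_mem' _ _ := Submodule.zero_mem _
  smul_mem' c _ hx k m := Submodule.smul_mem _ c (hx k m)

end Complex

namespace Graph

/-- The number of half-edges at a vertex. -/
def valence (Γ : Graph r k m) (v : Fin m) : ℕ := Finset.card {h | Γ.att h = v}

/-- The vertices `v` and `w` lie in the same connected component. -/
def Connected (Γ : Graph r k m) : Fin m → Fin m → Prop :=
  Relation.ReflTransGen fun v w => ∃ h, Γ.att h = v ∧ Γ.att (Γ.flip h) = w

/-- Each connected component is star-shaped: there are no loops, and in each
component all vertices are univalent with the exception of at most one, which has odd valence. -/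
def IsUnionOfOddStars (Γ : Graph r k m) : Prop :=
  (∀ h, Γ.att h ≠ Γ.att (Γ.flip h)) ∧
    (∀ v w, Γ.Connected v w → Γ.valence v ≠ 1 → Γ.valence w ≠ 1 → v = w) ∧
    ∀ v, Γ.valence v ≠ 1 → Odd (Γ.valence v)

/-- Each connected component has exactly two vertices and one edge (two half-edges). -/
def IsUnionOfSingleEdges (Γ : Graph r k m) : Prop :=
  ∀ v, {w | Γ.Connected v w}.ncard = 2 ∧ {h | Γ.Connected v (Γ.att h)}.ncard = 2

end Graph

end GraphCx

/-! Write $h$ for minus the sum, over all half-edges $a$ of a graph, of the graphs obtained by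
attaching next to $a$ a new edge with a univalent end (`attachMap`). It nearly contracts the
complex. In $dh\Gamma$ the contraction of the new edge gives $\Gamma$ back, and the contraction of
an edge not containing $a$ cancels against a term of $hd\Gamma$. What remains is
$(dh+hd)\Gamma=\sum_a(\Gamma-d_{e(a)}\Gamma_a)$, where $\Gamma_a$ is $\Gamma$ with the new edge at
$a$ and $e(a)$ is the edge of $a$ (`laplaceTerm_eq`).

If $e(a)$ has a univalent end, then after its contraction the new edge takes its place, and the
summand vanishes. If both ends of $e(a)$ have valence at least two (`Inner`), then
$d_{e(a)}\Gamma_a$ is zero or has fewer inner half-edges than $\Gamma$. Hence $dh+hd$ is triangular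
for the filtration by the number of inner half-edges, and this number is the diagonal entry
(`laplaceTerm_sub_mem`). In characteristic zero the nonzero diagonal entries are invertible, so
every cycle can be pushed down to graphs without inner half-edges, that is, disjoint unions of
stars. By the same argument a boundary supported on such graphs vanishes, once $d$ is known to
vanish on them. All this happens separately for each number of half-edges and vertices, where the
filtration is finite; infinite combinations cause no difficulty.

It remains to find which unions of stars are nonzero. A permutation $\pi$ of the rays of a star acts
as $\pi$ on the inner halves, on the outer halves and on the leaves, so its sign as an automorphism
is that of $\pi$ (`exists_automorphism`). Rotating a ribbon star with an even number of rays is odd,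
and so is exchanging two rays of a star without cyclic order; these graphs are zero. Odd ribbon
stars and single edges remain. A contractible edge of an odd star leaves an even star, so $d$
vanishes. All automorphisms of the surviving graphs are even (`sign_eq_of_odd_cycles`), so these
graphs are nonzero.

For $d^2=0$, contracting two edges in either order gives the same graph, but the two deleted
vertices are listed in opposite order, while the half-edges move in pairs. To make this precise,
`IsContraction` treats a contraction as the deletion of one endpoint, and the new cyclic order as a
first return map of `rot` times a transposition. -/

namespace GraphCx

open Equiv

/-! ### First return maps of permutations. -/

/-- `FirstReturn S θ b c`: the point `c` is the first of `θ b, θ (θ b), …` that lies in `S`. -/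
inductive FirstReturn {B : Type*} (S : Set B) (θ : B → B) : B → B → Prop
  | base (b : B) : θ b ∈ S → FirstReturn S θ b (θ b)
  | step (b c : B) : θ b ∉ S → FirstReturn S θ (θ b) c → FirstReturn S θ b c

namespace FirstReturn

variable {B C : Type*} {S S' : Set B} {θ : B → B} {b c c' : B}

theorem unique (h : FirstReturn S θ b c) (h' : FirstReturn S θ b c') : c = c' := by
  induction h with
  | base b hb =>
    cases h' with
    | base => rfl
    | step _ _ hn => exact absurd hb hn
  | step b c hn _ ih =>
    cases h' with
    | base _ hb => exact absurd hb hn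
    | step _ _ _ h2 => exact ih h2

theorem of_eq (h : θ b = c) (hc : c ∈ S) : FirstReturn S θ b c := by
  subst h; exact base b hc

theorem of_step (h : θ b = c') (hc : c' ∉ S) (h' : FirstReturn S θ c' c) :
    FirstReturn S θ b c := by
  subst h; exact step b c hc h'

theorem comp_right {s : B → B} (hs : ∀ z ∉ S, s z = z) {y : B}
    (h : FirstReturn S θ (s y) c) : FirstReturn S (fun z => θ (s z)) y c := by
  generalize hx : s y = x at h
  induction h generalizing y with
  | base b hb => exact of_eq (by rw [hx]) hb
  | step b c hn _ ih =>
    refine of_step (by rw [hx]) hn (ih (hs _ hn))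

theorem trans_of_subset (hS : S' ⊆ S) {z : B} (h : FirstReturn S θ b z) (hz : z ∉ S')
    (h' : FirstReturn S' θ z c) : FirstReturn S' θ b c := by
  induction h with
  | base b hb => exact step _ _ hz h'
  | step b z hn _ ih => exact step _ _ (fun h => hn (hS h)) (ih hz h')

theorem mono_of_mem (hS : S' ⊆ S) (h : FirstReturn S θ b c) (hc : c ∈ S') :
    FirstReturn S' θ b c := by
  induction h with
  | base b hb => exact base _ hc
  | step b z hn _ ih => exact step _ _ (fun h => hn (hS h)) (ih hc)

end FirstReturn

/-- The permutation `ρ` is the first return map of `θ` to the image of the injection `φ`. -/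
def Induced {A B : Type*} (φ : A → B) (θ : Perm B) (ρ : Perm A) : Prop :=
  ∀ x, FirstReturn (Set.range φ) θ (φ x) (φ (ρ x))

namespace Induced

variable {A B C : Type*} {φ : A → B} {θ : Perm B} {ρ ρ' : Perm A}

theorem unique (hφ : Function.Injective φ) (h : Induced φ θ ρ) (h' : Induced φ θ ρ') : ρ = ρ' :=
  Equiv.ext fun x => hφ ((h x).unique (h' x))

/-- The transposition only moves points of the image, so it changes the starting point of an
excursion and none of the points passed outside the image. -/
theorem mul_swap [DecidableEq A] [DecidableEq B] (hφ : Function.Injective φ)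
    (h : Induced φ θ ρ) (a b : A) :
    Induced φ (θ * swap (φ a) (φ b)) (ρ * swap a b) := by
  intro x
  have hs : ∀ z ∉ Set.range φ, swap (φ a) (φ b) z = z := fun z hz =>
    swap_apply_of_ne_of_ne (fun e => hz ⟨a, e.symm⟩) (fun e => hz ⟨b, e.symm⟩)
  have h1 := h (swap a b x)
  rw [hφ.map_swap] at h1
  exact h1.comp_right hs

/-- Each step of `θ` is itself an excursion of `κ` outside the larger image, so excursions
concatenate. Two successive contractions thus become a single first return map. -/
theorem comp {ψ : B → C} {κ : Perm C} (hψ : Function.Injective ψ) (h : Induced ψ κ θ)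
    (h' : Induced φ θ ρ) : Induced (ψ ∘ φ) κ ρ := by
  have hsub : Set.range (ψ ∘ φ) ⊆ Set.range ψ := Set.range_comp_subset_range φ ψ
  have key : ∀ b c, FirstReturn (Set.range φ) θ b c →
      FirstReturn (Set.range (ψ ∘ φ)) κ (ψ b) (ψ c) := by
    intro b c hbc
    induction hbc with
    | base b hb =>
      refine (h b).mono_of_mem hsub ?_
      obtain ⟨a, ha⟩ := hb
      exact ⟨a, by simp [ha]⟩
    | step b c hn _ ih =>
      refine (h b).trans_of_subset hsub ?_ ih
      rintro ⟨a, ha⟩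
      exact hn ⟨a, hψ ha⟩
  exact fun x => key _ _ (h' x)

theorem conj {u : Perm A} (h : Induced (φ ∘ u) θ ρ) : Induced φ θ (u * ρ * u⁻¹) := by
  intro x
  have := h (u⁻¹ x)
  rw [u.surjective.range_comp] at this
  simpa using this

theorem map (h : Induced φ θ ρ) (e : Perm B) : Induced (fun x => e (φ x)) (e * θ * e⁻¹) ρ := by
  have key : ∀ b c, FirstReturn (Set.range φ) θ b c →
      FirstReturn (Set.range fun x => e (φ x)) (e * θ * e⁻¹) (e b) (e c) := by
    have hr : ∀ b, e b ∈ (Set.range fun x => e (φ x)) ↔ b ∈ Set.range φ := fun b => by simp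
    intro b c hbc
    induction hbc with
    | base b hb => exact .of_eq (by simp) ((hr _).2 hb)
    | step b c hn _ ih => exact .of_step (by simp) (mt (hr _).1 hn) ih
  exact fun x => key _ _ (h x)

end Induced

/-- First return to the complement of two points. -/
theorem induced_skipTwo {n : ℕ} (θ : Perm (Fin (n + 2))) :
    Induced (fun x : Fin n => x.succ.succ) θ (skipTwo θ) := by
  have hr : ∀ z : Fin (n + 2), z ∈ Set.range (fun x : Fin n => x.succ.succ) ↔ z ≠ 0 ∧ z ≠ 1 :=
    fun z => ⟨by rintro ⟨x, rfl⟩; exact succ_succ_ne x, fun h => exists_succ_succ h.1 h.2⟩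
  intro x
  show FirstReturn _ _ x.succ.succ (skipTwo θ x).succ.succ
  rw [skipTwo_succ]
  have hx := succ_succ_ne x
  generalize x.succ.succ = y at *
  have inj := fun a b => (θ.injective.eq_iff (a := a) (b := b)).1
  unfold firstReturn
  split_ifs with h1 h2
  · exact .of_eq rfl ((hr _).2 h1)
  · exact .of_step rfl (mt (hr _).1 h1) (.of_eq rfl ((hr _).2 h2))
  · refine .of_step rfl (mt (hr _).1 h1) (.of_step rfl (mt (hr _).1 h2) (.of_eq rfl ((hr _).2 ?_)))
    -- Here `θ y` and `θ (θ y)` both lie in `{0, 1}`, and they exhaust it. Injectivity prevents the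
    -- third iterate from repeating one of them, because `y` is outside.
    have e1 := inj (θ y) y
    have e2 := inj (θ (θ y)) (θ y)
    have e3 := inj (θ (θ y)) y
    have e4 := inj (θ y) (θ (θ y))
    grind

/-! ### Extension of permutations by fixed points. -/

/-- The extension of a permutation by two fixed points at the front. -/
def extTwo {n : ℕ} (σ : Perm (Fin n)) : Perm (Fin (n + 2)) :=
  Perm.decomposeFin.symm (0, Perm.decomposeFin.symm (0, σ))

/-- The extension of a permutation by a fixed point at the front. -/
def extOne {n : ℕ} (σ : Perm (Fin n)) : Perm (Fin (n + 1)) := Perm.decomposeFin.symm (0, σ)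

section Ext

variable {n : ℕ} (σ : Perm (Fin n))

@[simp] theorem extOne_zero : extOne σ 0 = 0 := by simp [extOne]

@[simp] theorem extOne_succ (x : Fin n) : extOne σ x.succ = (σ x).succ := by
  simp [extOne]

@[simp] theorem sign_extOne : Perm.sign (extOne σ) = Perm.sign σ := by simp [extOne]

theorem extTwo_eq : extTwo σ = extOne (extOne σ) := rfl

@[simp] theorem extTwo_zero : extTwo σ 0 = 0 := by simp [extTwo_eq]

@[simp] theorem extTwo_one : extTwo σ 1 = 1 := by
  rw [← Fin.succ_zero_eq_one, extTwo_eq, extOne_succ, extOne_zero]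

@[simp] theorem extTwo_succ (x : Fin n) : extTwo σ x.succ.succ = (σ x).succ.succ := by
  simp [extTwo_eq]

@[simp] theorem sign_extTwo : Perm.sign (extTwo σ) = Perm.sign σ := by simp [extTwo_eq]

theorem perm_ext_two {θ θ' : Perm (Fin (n + 2))} (h0 : θ 0 = θ' 0) (h1 : θ 1 = θ' 1)
    (h : ∀ x : Fin n, θ x.succ.succ = θ' x.succ.succ) : θ = θ' := by
  ext1 z
  refine Fin.cases h0 (fun z => ?_) z
  refine Fin.cases h1 (fun z => h z) z

theorem perm_ext_one {θ θ' : Perm (Fin (n + 1))} (h0 : θ 0 = θ' 0)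
    (h : ∀ x : Fin n, θ x.succ = θ' x.succ) : θ = θ' := by
  ext1 z
  exact Fin.cases h0 h z

theorem extOne_mul (σ τ : Perm (Fin n)) : extOne (σ * τ) = extOne σ * extOne τ :=
  perm_ext_one (by simp) (by simp)

theorem extOne_inv (σ : Perm (Fin n)) : extOne σ⁻¹ = (extOne σ)⁻¹ := by
  rw [eq_inv_iff_mul_eq_one, ← extOne_mul, inv_mul_cancel]
  exact perm_ext_one (by simp) (by simp)

theorem extTwo_mul (σ τ : Perm (Fin n)) : extTwo (σ * τ) = extTwo σ * extTwo τ := by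
  simp [extTwo_eq, extOne_mul]

theorem extTwo_inv (σ : Perm (Fin n)) : extTwo σ⁻¹ = (extTwo σ)⁻¹ := by
  simp [extTwo_eq, extOne_inv]

theorem sameCycle_extOne (x y : Fin n) :
    (extOne σ).SameCycle x.succ y.succ ↔ σ.SameCycle x y := by
  rw [← sameCycle_skipZero, extOne, skipZero, Equiv.apply_symm_apply]

theorem sameCycle_extTwo (x y : Fin n) :
    (extTwo σ).SameCycle x.succ.succ y.succ.succ ↔ σ.SameCycle x y := by
  rw [extTwo_eq, sameCycle_extOne, sameCycle_extOne]

theorem sameCycle_of_fixed {α : Type*} {σ : Perm α} {x y : α} (hx : σ x = x) :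
    σ.SameCycle x y ↔ x = y := by
  constructor
  · rintro ⟨i, rfl⟩
    exact (Perm.zpow_apply_eq_self_of_apply_eq_self hx i).symm
  · rintro rfl; exact Perm.SameCycle.refl _ _

end Ext

end GraphCx

/-! ### Contractions relative to a listing of half-edges and vertices. -/

namespace GraphCx

open Equiv

variable {r : Bool} {k m : ℕ}

/-- `g` lists an edge of `Γ` that is not a loop and one of its endpoints: the
first two half-edges are the halves of the edge and the first vertex is the end of the second. -/
structure Lists (Γ : Graph r (k + 2) (m + 2)) (g : Reord (k + 2) (m + 2)) : Prop where
  flip_zero : Γ.flip (g.1 0) = g.1 1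
  vert : g.2 0 = Γ.att (g.1 1)
  ne : Γ.att (g.1 0) ≠ Γ.att (g.1 1)

/-- `Δ` is the contraction of the edge of `Γ` listed first by `g`; its half-edges and vertices are
the other half-edges of `Γ` and the vertices other than the first one, in the order of `g`. -/
structure IsContraction (Γ : Graph r (k + 2) (m + 2)) (Δ : Graph r k (m + 1))
    (g : Reord (k + 2) (m + 2)) : Prop extends Lists Γ g where
  att_of_eq : ∀ x, Γ.att (g.1 x.succ.succ) = Γ.att (g.1 1) →
    g.2 (Δ.att x).succ = Γ.att (g.1 0)
  att_of_ne : ∀ x, Γ.att (g.1 x.succ.succ) ≠ Γ.att (g.1 1) →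
    g.2 (Δ.att x).succ = Γ.att (g.1 x.succ.succ)
  flip : ∀ x, g.1 (Δ.flip x).succ.succ = Γ.flip (g.1 x.succ.succ)
  rot : ∀ hr, Induced (fun x : Fin k => g.1 x.succ.succ) (Γ.rot hr * swap (g.1 0) (g.1 1))
    (Δ.rot hr)

theorem succ_succ_injective {n : ℕ} : Function.Injective fun x : Fin n => x.succ.succ :=
  (Fin.succ_injective _).comp (Fin.succ_injective _)

theorem perm_succ_succ_injective {n : ℕ} (σ : Perm (Fin (n + 2))) :
    Function.Injective fun x : Fin n => σ x.succ.succ :=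
  σ.injective.comp succ_succ_injective

theorem perm_succ_succ_ne {n : ℕ} (σ : Perm (Fin (n + 2))) (x : Fin n) :
    σ x.succ.succ ≠ σ 0 ∧ σ x.succ.succ ≠ σ 1 :=
  ⟨fun h => (succ_succ_ne x).1 (σ.injective h), fun h => (succ_succ_ne x).2 (σ.injective h)⟩

theorem exists_perm_succ_succ {n : ℕ} {σ : Perm (Fin (n + 2))} {y : Fin (n + 2)} (h0 : y ≠ σ 0)
    (h1 : y ≠ σ 1) : ∃ x : Fin n, σ x.succ.succ = y := by
  obtain ⟨x, hx⟩ := exists_succ_succ (x := σ⁻¹ y) (fun h => h0 (by rw [← h]; simp))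
    (fun h => h1 (by rw [← h]; simp))
  exact ⟨x, by rw [hx]; simp⟩

theorem eq_relabel {Γ Δ : Graph r k m} {u : Reord k m} (ha : ∀ x, Δ.att (u.1 x) = u.2 (Γ.att x))
    (hf : ∀ x, Δ.flip (u.1 x) = u.1 (Γ.flip x))
    (hrot : ∀ hr x, Δ.rot hr (u.1 x) = u.1 (Γ.rot hr x)) : Δ = Γ.relabel u := by
  apply Graph.ext
  · funext x
    obtain ⟨x, rfl⟩ := u.1.surjective x
    simp [Graph.relabel, ha]
  · ext1 x
    obtain ⟨x, rfl⟩ := u.1.surjective x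
    simp [Graph.relabel, hf]
  · funext hr
    ext1 x
    obtain ⟨x, rfl⟩ := u.1.surjective x
    simp [Graph.relabel, hrot]

namespace IsContraction

variable {Γ : Graph r (k + 2) (m + 2)} {Δ Δ' : Graph r k (m + 1)} {g g' : Reord (k + 2) (m + 2)}

theorem unique (h : IsContraction Γ Δ g) (h' : IsContraction Γ Δ' g) : Δ = Δ' := by
  apply Graph.ext
  · funext x
    refine Fin.succ_injective _ (g.2.injective ?_)
    by_cases e : Γ.att (g.1 x.succ.succ) = Γ.att (g.1 1)
    · rw [h.att_of_eq x e, h'.att_of_eq x e]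
    · rw [h.att_of_ne x e, h'.att_of_ne x e]
  · ext1 x
    exact perm_succ_succ_injective g.1 ((h.flip x).trans (h'.flip x).symm)
  · funext hr
    exact (h.rot hr).unique (perm_succ_succ_injective g.1) (h'.rot hr)

/-- Change of the listing of a contracted edge. -/
theorem transfer (h : IsContraction Γ Δ g) (h' : Lists Γ g')
    (hg : g'.1 0 = g.1 0 ∨ g'.1 0 = g.1 1) :
    ∃ u : Reord k (m + 1), IsContraction Γ (Δ.relabel u) g' ∧ g'.sgn = u.sgn * g.sgn ∧
      ∀ x, g'.1 (u.1 x).succ.succ = g.1 x.succ.succ := by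
  -- The change of listing `w` either keeps the first edge and the deleted vertex, or reverses the
  -- edge; then the other endpoint is the deleted one.
  obtain ⟨w, hgw⟩ : ∃ w, g = g' * w := ⟨g'⁻¹ * g, by group⟩
  have W1 : ∀ x, g.1 x = g'.1 (w.1 x) := fun x => by rw [hgw]; rfl
  have W2 : ∀ x, g.2 x = g'.2 (w.2 x) := fun x => by rw [hgw]; rfl
  have I1 := fun x y => g'.1.injective.eq_iff (a := x) (b := y)
  have I2 := fun x y => g'.2.injective.eq_iff (a := x) (b := y)
  have hw : (w.1 0 = 0 ∧ w.1 1 = 1 ∧ w.2 0 = 0) ∨ (w.1 0 = 1 ∧ w.1 1 = 0 ∧ w.2 0 ≠ 0 ∧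
      g'.2 (w.2 0) = Γ.att (g'.1 0)) := by
    have a1 := h.flip_zero
    have a2 := h.vert
    have b1 := h'.flip_zero
    have b2 := h'.vert
    simp only [W1, W2] at a1 a2 hg
    rcases hg with hg | hg
    · rw [← hg, b1, I1] at a1
      rw [← a1, ← b2, I2] at a2
      rw [I1] at hg
      exact Or.inl ⟨hg.symm, a1.symm, a2⟩
    · rw [← hg, ← Γ.flip.injective.eq_iff, Γ.flip_flip, b1, I1] at a1
      rw [← hg] at a2
      rw [I1] at hg
      refine Or.inr ⟨a1, hg.symm, fun e => ?_, a2⟩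
      rw [e, b2] at a2
      exact h'.ne a2.symm
  have k1 : Keeps01 w.1 := by unfold Keeps01; tauto
  -- Reversing the edge costs one sign on the half-edges and, since `w.2` moves `0`, one sign on the
  -- vertices. The two cancel when the front places are dropped.
  have hsgn : Reord.sgn (skipTwo w.1, skipZero w.2) = w.sgn := by
    have a := sign_skipZero w.1
    have b := sign_skipZero (skipZero w.1)
    have c := sign_skipZero w.2
    have d := skipZero_succ w.1 0
    rw [Fin.succ_zero_eq_one] at d
    have e : skipZero w.1 0 = 0 := by
      apply Fin.succ_injective
      rcases hw with ⟨h1, h2, h3⟩ | ⟨h1, h2, h3, -⟩ <;> simp [d, h1, h2]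
    unfold Reord.sgn skipTwo
    rcases hw with ⟨h1, h2, h3⟩ | ⟨h1, h2, h3, -⟩ <;> rw [a, b, c, e] <;> simp [h1, h3]
  have hφ : ∀ x, g'.1 (skipTwo w.1 x).succ.succ = g.1 x.succ.succ := fun x => by
    rw [k1.skipTwo_succ, W1]
  have hne := h'.ne
  have hv := h'.vert
  -- When the edge is reversed, `w.2` sends the merged vertex to `0`, the place deleted by `g'`;
  -- `skipZero` redirects it to `w.2 0`, which `g'` lists as the surviving endpoint.
  have hatt : ∀ x, g'.2 (skipZero w.2 (Δ.att x)).succ =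
      if Γ.att (g.1 x.succ.succ) = Γ.att (g'.1 1) then Γ.att (g'.1 0)
      else Γ.att (g.1 x.succ.succ) := by
    intro x
    have ha := h.att_of_eq x
    have hb := h.att_of_ne x
    rw [W2] at ha hb
    have i0 := I2 (w.2 (Δ.att x).succ) 0
    rw [hv] at i0
    rw [skipZero_succ]
    rw [W1 0, W1 1] at ha
    rw [W1 1] at hb
    rcases hw with ⟨h1, h2, h3⟩ | ⟨h1, h2, h3, h4⟩
    · have : w.2 (Δ.att x).succ ≠ 0 := by
        rw [← h3]; exact fun e => Fin.succ_ne_zero _ (w.2.injective e)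
      rw [if_neg this]
      rw [h1, h2] at ha
      rw [h2] at hb
      split_ifs with e
      · exact ha e
      · exact hb e
    · rw [h1, h2] at ha
      rw [h2] at hb
      grind
  refine ⟨(skipTwo w.1, skipZero w.2), ⟨h', fun x => ?_, fun x => ?_, fun x => ?_, fun hr => ?_⟩,
    ?_, hφ⟩
  · obtain ⟨x, rfl⟩ := (skipTwo w.1).surjective x
    intro e
    rw [hφ] at e
    simp only [Graph.relabel, inv_apply_self']
    rw [hatt, if_pos e]
  · obtain ⟨x, rfl⟩ := (skipTwo w.1).surjective x
    intro e
    rw [hφ] at e ⊢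
    simp only [Graph.relabel, inv_apply_self']
    rw [hatt, if_neg e]
  · obtain ⟨x, rfl⟩ := (skipTwo w.1).surjective x
    simp only [Graph.relabel, Perm.mul_apply, inv_apply_self', hφ, h.flip]
  · refine Induced.conj (u := skipTwo w.1) ?_
    have := h.rot hr
    have hs : swap (g.1 0) (g.1 1) = swap (g'.1 0) (g'.1 1) := by
      rw [W1, W1]
      rcases hw with ⟨h1, h2, -⟩ | ⟨h1, h2, -, -⟩ <;> rw [h1, h2]
      exact swap_comm _ _
    rw [hs] at this
    convert this using 1
    funext x
    exact hφ x
  · rw [hsgn, hgw, Reord.sgn_mul, mul_comm g'.sgn, ← mul_assoc, Int.units_mul_self, one_mul]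

end IsContraction

theorem Lists.contractible {Γ : Graph r (k + 2) (m + 2)} {g : Reord (k + 2) (m + 2)}
    (h : Lists Γ g) {x : Fin (k + 2)} (h0 : x ≠ g.1 0) (h1 : x ≠ g.1 1)
    (hx : Γ.att x = Γ.att (g.1 0) ∨ Γ.att x = Γ.att (g.1 1)) : Γ.Contractible (g.1 0) := by
  refine ⟨?_, x, h0, ?_, ?_⟩ <;> rw [h.flip_zero]
  exacts [h.ne, h1, hx]

/-- The merged vertex of `Δ` carries a half-edge, which lies in `Γ` at one of the two ends of the
contracted edge. -/
theorem IsContraction.contractible {Γ : Graph r (k + 2) (m + 2)} {Δ : Graph r k (m + 1)}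
    {g : Reord (k + 2) (m + 2)} (h : IsContraction Γ Δ g) : Γ.Contractible (g.1 0) := by
  obtain ⟨v, hv⟩ := g.2.surjective (Γ.att (g.1 0))
  have hv0 : v ≠ 0 := by
    rintro rfl
    rw [h.vert] at hv
    exact h.ne hv.symm
  obtain ⟨z, rfl⟩ := Fin.exists_succ_eq.2 hv0
  obtain ⟨x, rfl⟩ := Δ.att_surj z
  obtain ⟨e0, e1⟩ := perm_succ_succ_ne g.1 x
  refine h.toLists.contractible e0 e1 ?_
  by_cases e : Γ.att (g.1 x.succ.succ) = Γ.att (g.1 1)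
  · exact Or.inr e
  · exact Or.inl ((h.att_of_ne x e).symm.trans hv)

/-- This is the bridge from `contract` to `IsContraction`. A listing is inverse to a reordering, and
it puts the deleted vertex $v_2$ first where `contract` has $v_1$ first; hence the extra
transposition. -/
theorem isContraction_of_movesToFront (Γ : Graph r (k + 2) (m + 2)) {h : Fin (k + 2)}
    {f : Reord (k + 2) (m + 2)} (hf : Γ.MovesToFront h f)
    (hc : (Γ.relabel f).Contractible 0) :
    IsContraction Γ ((Γ.relabel f).contract hf.isFront hc) (f.1⁻¹, f.2⁻¹ * swap 0 1) := by
  have e0 : f.1⁻¹ 0 = h := by rw [← hf.half_one, inv_apply_self']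
  have e1 : f.1⁻¹ 1 = Γ.flip h := by rw [← hf.half_two, inv_apply_self']
  have v0 : f.2⁻¹ 0 = Γ.att h := by rw [← hf.vert_one, inv_apply_self']
  have v1 : f.2⁻¹ 1 = Γ.att (Γ.flip h) := by rw [← hf.vert_two, inv_apply_self']
  have hatt : ∀ x, f.2⁻¹ (swap 0 1 (merge (f.2 (Γ.att (f.1⁻¹ x)))).succ) =
      if Γ.att (f.1⁻¹ x) = f.2⁻¹ 1 then f.2⁻¹ 0 else Γ.att (f.1⁻¹ x) := by
    intro x
    obtain ⟨z, hz⟩ : ∃ z, Γ.att (f.1⁻¹ x) = f.2⁻¹ z := ⟨f.2 (Γ.att (f.1⁻¹ x)), by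
      rw [inv_apply_self']⟩
    rw [hz, apply_inv_self']
    simp only [f.2⁻¹.injective.eq_iff]
    refine Fin.cases ?_ (fun z => ?_) z
    · simp [merge_zero]
    · rw [merge_succ]
      by_cases h0 : z = 0
      · subst h0; simp
      · have : z.succ ≠ 1 := by
          rw [← Fin.succ_zero_eq_one, Ne, (Fin.succ_injective _).eq_iff]; exact h0
        rw [if_neg this, swap_apply_of_ne_of_ne (Fin.succ_ne_zero _) this]
  refine ⟨⟨?_, ?_, ?_⟩, fun x => ?_, fun x => ?_, fun x => ?_, fun hr => ?_⟩
  · rw [e0, e1]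
  · simp only [Perm.mul_apply, swap_apply_left, e1, v1]
  · rw [e0, e1, ← v0, ← v1, Ne, f.2⁻¹.injective.eq_iff]; simp
  · intro e
    simp only [e0, e1, ← v0, ← v1, Graph.contract, Graph.relabel, Perm.mul_apply] at e ⊢
    rw [hatt, if_pos e]
  · intro e
    simp only [e1, ← v1, Graph.contract, Graph.relabel, Perm.mul_apply] at e ⊢
    rw [hatt, if_neg e]
  · simp only [Graph.contract]
    rw [hf.isFront.skip_flip]
    simp only [Graph.relabel, Perm.mul_apply, inv_apply_self']
  · have hi := (induced_skipTwo ((Γ.relabel f).rot hr * swap 0 1)).map f.1⁻¹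
    refine Eq.mp ?_ hi
    have : swap (f.1⁻¹ 0) (f.1⁻¹ 1) = f.1⁻¹ * swap 0 1 * f.1 := by
      rw [swap_apply_apply, inv_inv]
    have e : f.1⁻¹ * ((Γ.relabel f).rot hr * swap 0 1) * f.1⁻¹⁻¹ =
        Γ.rot hr * swap (f.1⁻¹ 0) (f.1⁻¹ 1) := by
      simp only [Graph.relabel, this]
      group
    rw [e]
    rfl

/-- A listed contractible edge has a contraction. -/
theorem exists_isContraction (Γ : Graph r (k + 2) (m + 2)) {g : Reord (k + 2) (m + 2)}
    (hg : Lists Γ g) (hc : Γ.Contractible (g.1 0)) : ∃ Δ, IsContraction Γ Δ g := by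
  obtain ⟨f, hf⟩ := Γ.exists_movesToFront hc
  have h0 := isContraction_of_movesToFront Γ hf (hf.contractible hc)
  obtain ⟨u, hu, -⟩ := h0.transfer hg 
    (Or.inl (Perm.eq_inv_iff_eq.2 hf.half_one))
  exact ⟨_, hu⟩

theorem exists_lists (Γ : Graph r (k + 2) (m + 2)) {h : Fin (k + 2)}
    (hc : Γ.att h ≠ Γ.att (Γ.flip h)) : ∃ g, Lists Γ g ∧ g.1 0 = h := by
  obtain ⟨σ, h0, h1⟩ := Graph.exists_perm_front (Γ.flip_ne h).symm
  have e0 : σ⁻¹ 0 = h := by rw [← h0, inv_apply_self']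
  have e1 : σ⁻¹ 1 = Γ.flip h := by rw [← h1, inv_apply_self']
  refine ⟨(σ⁻¹, swap 0 (Γ.att (Γ.flip h))), ⟨?_, ?_, ?_⟩, e0⟩
  · simp only [e0, e1]
  · simp only [e1, swap_apply_left]
  · simpa only [e0, e1] using hc

variable (K : Type*) [Field K]

/-- The minus sign comes from the transposition of $v_1$ and $v_2$: the orientation convention
starts with $v_1,v_2$, whereas a listing starts with the deleted vertex $v_2$ and lets the merged
vertex take the place of $v_1$. -/
theorem edgeTerm_of_isContraction {Γ : Graph r (k + 2) (m + 2)} {Δ : Graph r k (m + 1)}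
    {g : Reord (k + 2) (m + 2)} (h : IsContraction Γ Δ g) :
    edgeTerm K Γ (g.1 0) = -(g.sgn • cls K Δ) := by
  obtain ⟨f, hf⟩ := Γ.exists_movesToFront h.contractible
  have h0 := isContraction_of_movesToFront Γ hf (hf.contractible h.contractible)
  obtain ⟨u, hu, hs, -⟩ := h0.transfer h.toLists 
    (Or.inl (Perm.eq_inv_iff_eq.2 hf.half_one))
  have hcls := congrArg (cls K) (hu.unique h)
  rw [edgeTerm_eq K Γ h.contractible hf, ← hcls, cls_relabel, hs, smul_smul,
    mul_right_comm, Int.units_mul_self, one_mul]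
  have : Reord.sgn (f.1⁻¹, f.2⁻¹ * swap 0 1) = -f.sgn := by
    simp [Reord.sgn]
  rw [this, Units.neg_smul, neg_neg]

theorem edgeTerm_of_not_contractible {Γ : Graph r (k + 2) (m + 2)} {h : Fin (k + 2)}
    (hc : ¬ Γ.Contractible h) : edgeTerm K Γ h = 0 := dif_neg hc

/-- The sum over all half-edges counts every edge twice. -/
theorem two_smul_graphBoundary (Γ : Graph r (k + 2) (m + 2)) :
    (2 : K) • graphBoundary K Γ = ∑ h, edgeTerm K Γ h := by
  have hsplit := Finset.sum_filter_add_sum_filter_not Finset.univ (fun h => h < Γ.flip h)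
    (fun h => edgeTerm K Γ h)
  have : ∑ h with ¬ h < Γ.flip h, edgeTerm K Γ h = graphBoundary K Γ := by
    unfold graphBoundary
    refine Finset.sum_bij' (fun h _ => Γ.flip h) (fun h _ => Γ.flip h) ?_ ?_ ?_ ?_ ?_
    · intro h hh
      simp only [Finset.mem_filter, Finset.mem_univ, true_and, Γ.flip_flip] at hh ⊢
      exact lt_of_le_of_ne (not_lt.1 hh) (Γ.flip_ne h)
    · intro h hh
      simp only [Finset.mem_filter, Finset.mem_univ, true_and, Γ.flip_flip] at hh ⊢
      exact lt_asymm hh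
    · intro h _; exact Γ.flip_flip h
    · intro h _; exact Γ.flip_flip h
    · intro h _; exact (edgeTerm_flip K Γ h).symm
  rw [← hsplit, this, two_smul]
  rfl

end GraphCx

/-! ### Contracting two edges in either order. -/

namespace GraphCx

open Equiv

variable {r : Bool} {k m : ℕ}

/-- The reordering that exchanges the first two edges and the first two vertices. -/
def edgeSwap (k m : ℕ) : Reord (k + 4) (m + 3) :=
  (swap 0 (0 : Fin (k + 2)).succ.succ * swap 1 (1 : Fin (k + 2)).succ.succ, swap 0 1)

theorem edgeSwap_zero : (edgeSwap k m).1 0 = (0 : Fin (k + 2)).succ.succ := by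
  have h2 := (succ_succ_ne (1 : Fin (k + 2)))
  simp only [edgeSwap, Perm.mul_apply]
  rw [swap_apply_of_ne_of_ne (a := 1) (by simp) h2.1.symm, swap_apply_left]

theorem edgeSwap_one : (edgeSwap k m).1 1 = (1 : Fin (k + 2)).succ.succ := by
  have h2 := (succ_succ_ne (1 : Fin (k + 2)))
  simp only [edgeSwap, Perm.mul_apply, swap_apply_left]
  exact swap_apply_of_ne_of_ne h2.1 (fun e => by simpa using succ_succ_injective e)

theorem edgeSwap_two : (edgeSwap k m).1 (0 : Fin (k + 2)).succ.succ = 0 := by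
  have h1 := (succ_succ_ne (0 : Fin (k + 2)))
  simp only [edgeSwap, Perm.mul_apply]
  rw [swap_apply_of_ne_of_ne (a := 1) h1.2 (fun e => by simpa using succ_succ_injective e),
    swap_apply_right]

theorem edgeSwap_three : (edgeSwap k m).1 (1 : Fin (k + 2)).succ.succ = 1 := by
  have h1 := (succ_succ_ne (0 : Fin (k + 2)))
  simp only [edgeSwap, Perm.mul_apply, swap_apply_right]
  exact swap_apply_of_ne_of_ne (by simp) h1.2.symm

theorem edgeSwap_rest (x : Fin k) :
    (edgeSwap k m).1 x.succ.succ.succ.succ = x.succ.succ.succ.succ := by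
  have h0 := succ_succ_ne x
  have h1 := succ_succ_ne x.succ.succ
  simp only [edgeSwap, Perm.mul_apply]
  rw [swap_apply_of_ne_of_ne (a := 1) h1.2 fun e => h0.2 (succ_succ_injective e),
    swap_apply_of_ne_of_ne h1.1 fun e => h0.1 (succ_succ_injective e)]

theorem edgeSwap_sgn : (edgeSwap k m).sgn = -1 := by
  have h1 := (succ_succ_ne (0 : Fin (k + 2))).1
  have h2 := (succ_succ_ne (1 : Fin (k + 2))).2
  simp only [Reord.sgn, edgeSwap, Perm.sign_mul, Perm.sign_swap h1.symm, Perm.sign_swap h2.symm]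
  simp

/-- The two ends `v₁, v₂` and `w₁, w₂` of the first two listed edges satisfy
`v₂ ∉ {w₁, w₂}` and `w₂ ≠ v₁`. -/
structure Separated (Γ : Graph r (k + 4) (m + 3)) (g : Reord (k + 4) (m + 3)) : Prop where
  ne_one : Γ.att (g.1 (0 : Fin (k + 2)).succ.succ) ≠ Γ.att (g.1 1)
  ne_two : Γ.att (g.1 (1 : Fin (k + 2)).succ.succ) ≠ Γ.att (g.1 1)
  ne_three : Γ.att (g.1 0) ≠ Γ.att (g.1 (1 : Fin (k + 2)).succ.succ)

section Double

variable {Γ : Graph r (k + 4) (m + 3)} {Δ : Graph r (k + 2) (m + 2)} {Θ : Graph r k (m + 1)}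
  {g : Reord (k + 4) (m + 3)}

theorem IsContraction.att_congr (_ : IsContraction Γ Δ g) (x y : Fin (k + 2)) :
    Δ.att x = Δ.att y ↔ g.2 (Δ.att x).succ = g.2 (Δ.att y).succ := by
  simp

/-- The vertices of an iterated contraction. -/
theorem double_att (h : IsContraction Γ Δ g) (h' : IsContraction Δ Θ 1) (hs : Separated Γ g)
    (x : Fin k) : g.2 (Θ.att x).succ.succ =
      if Γ.att (g.1 x.succ.succ.succ.succ) = Γ.att (g.1 1) then Γ.att (g.1 0)
      else if Γ.att (g.1 x.succ.succ.succ.succ) = Γ.att (g.1 (1 : Fin (k + 2)).succ.succ)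
      then Γ.att (g.1 (0 : Fin (k + 2)).succ.succ) else Γ.att (g.1 x.succ.succ.succ.succ) := by
  have a0 := h.att_of_ne 0 hs.ne_one
  have a1 := h.att_of_ne 1 hs.ne_two
  have a2 := h.att_of_eq x.succ.succ
  have a3 := h.att_of_ne x.succ.succ
  have b0 := h'.att_of_eq x
  have b1 := h'.att_of_ne x
  simp only [Prod.fst_one, Prod.snd_one, Perm.one_apply] at b0 b1
  have c := h.att_congr x.succ.succ 1
  have h3 := hs.ne_three
  rw [a1] at c
  by_cases e : Γ.att (g.1 x.succ.succ.succ.succ) = Γ.att (g.1 1)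
  · rw [if_pos e]
    have a2 := a2 e
    rw [a2] at c
    rw [b1 (fun e => h3 (c.1 e)), a2]
  · rw [if_neg e]
    have a3 := a3 e
    rw [a3] at c
    split_ifs with e'
    · rw [b0 (c.2 e'), a0]
    · rw [b1 (fun e => e' (c.1 e)), a3]

/-- Both orders delete $v_2$ and $w_2$ and move their half-edges to $v_1$ and $w_1$, neither of
which is deleted. Both rotations are first return maps of `rot` times the same two transpositions,
which are disjoint and therefore commute. -/
theorem double_unique {Δ' : Graph r (k + 2) (m + 2)} {Θ' : Graph r k (m + 1)}
    (h : IsContraction Γ Δ g) (h' : IsContraction Δ Θ 1) (hs : Separated Γ g)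
    (i : IsContraction Γ Δ' (g * edgeSwap k m)) (i' : IsContraction Δ' Θ' 1) : Θ = Θ' := by
  have E0 : (g * edgeSwap k m).1 0 = g.1 (0 : Fin (k + 2)).succ.succ := by
    rw [Prod.fst_mul, Perm.mul_apply, edgeSwap_zero]
  have E1 : (g * edgeSwap k m).1 1 = g.1 (1 : Fin (k + 2)).succ.succ := by
    rw [Prod.fst_mul, Perm.mul_apply, edgeSwap_one]
  have E2 : (g * edgeSwap k m).1 (0 : Fin (k + 2)).succ.succ = g.1 0 := by
    rw [Prod.fst_mul, Perm.mul_apply, edgeSwap_two]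
  have E3 : (g * edgeSwap k m).1 (1 : Fin (k + 2)).succ.succ = g.1 1 := by
    rw [Prod.fst_mul, Perm.mul_apply, edgeSwap_three]
  have E4 : ∀ x : Fin k, (g * edgeSwap k m).1 x.succ.succ.succ.succ =
      g.1 x.succ.succ.succ.succ := fun x => by
    rw [Prod.fst_mul, Perm.mul_apply, edgeSwap_rest]
  have V : ∀ x : Fin (m + 1), (g * edgeSwap k m).2 x.succ.succ = g.2 x.succ.succ := fun x => by
    rw [Prod.snd_mul, Perm.mul_apply, edgeSwap,
      swap_apply_of_ne_of_ne (succ_succ_ne x).1 (succ_succ_ne x).2]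
  have hs' : Separated Γ (g * edgeSwap k m) := by
    refine ⟨?_, ?_, ?_⟩
    · rw [E1, E2]; exact hs.ne_three
    · rw [E3, E1]; exact hs.ne_two.symm
    · rw [E0, E3]; exact hs.ne_one
  apply Graph.ext
  · funext x
    apply succ_succ_injective
    apply g.2.injective
    have a := double_att h h' hs x
    have b := double_att i i' hs' x
    rw [V, E4, E1, E3, E2, E0] at b
    show g.2 (Θ.att x).succ.succ = g.2 (Θ'.att x).succ.succ
    rw [a, b]
    have := hs.ne_two
    grind
  · ext1 x
    apply succ_succ_injective
    apply succ_succ_injective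
    apply g.1.injective
    have a := h.flip x.succ.succ
    have b := i.flip x.succ.succ
    have a' := h'.flip x
    have b' := i'.flip x
    simp only [Prod.fst_one, Perm.one_apply] at a' b'
    rw [← a'] at a
    rw [← b', E4, E4] at b
    exact a.trans b.symm
  · funext hr
    have a := (h.rot hr).mul_swap (perm_succ_succ_injective g.1) 0 1
    have a' := Induced.comp (perm_succ_succ_injective g.1) a (h'.rot hr)
    have b := (i.rot hr).mul_swap (perm_succ_succ_injective _) 0 1
    have b' := Induced.comp (perm_succ_succ_injective _) b (i'.rot hr)
    refine a'.unique ((perm_succ_succ_injective g.1).comp succ_succ_injective) ?_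
    have hφ : (fun x => (g * edgeSwap k m).1 x.succ.succ) ∘
        (fun x : Fin k => (1 : Reord (k + 2) (m + 2)).1 x.succ.succ) =
        (fun x => g.1 x.succ.succ) ∘
        (fun x : Fin k => (1 : Reord (k + 2) (m + 2)).1 x.succ.succ) := funext E4
    rw [hφ, E0, E1, E2, E3] at b'
    refine Eq.mp ?_ b'
    congr 1
    rw [mul_assoc, mul_assoc]
    congr 1
    refine (Perm.Disjoint.commute ?_).eq
    have k1 := perm_succ_succ_ne g.1 0
    have k2 := perm_succ_succ_ne g.1 1
    intro x
    by_cases e : x = g.1 0 ∨ x = g.1 1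
    · left
      rcases e with rfl | rfl
      · exact swap_apply_of_ne_of_ne k1.1.symm k2.1.symm
      · exact swap_apply_of_ne_of_ne k1.2.symm k2.2.symm
    · right
      exact swap_apply_of_ne_of_ne (fun h => e (Or.inl h)) (fun h => e (Or.inr h))

theorem double_exists (h : IsContraction Γ Δ g) (h' : IsContraction Δ Θ 1)
    (hs : Separated Γ g) :
    ∃ Δ', IsContraction Γ Δ' (g * edgeSwap k m) ∧ IsContraction Δ' Θ 1 := by
  have E0 : (g * edgeSwap k m).1 0 = g.1 (0 : Fin (k + 2)).succ.succ := by
    rw [Prod.fst_mul, Perm.mul_apply, edgeSwap_zero]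
  have E1 : (g * edgeSwap k m).1 1 = g.1 (1 : Fin (k + 2)).succ.succ := by
    rw [Prod.fst_mul, Perm.mul_apply, edgeSwap_one]
  have E2 : (g * edgeSwap k m).1 (0 : Fin (k + 2)).succ.succ = g.1 0 := by
    rw [Prod.fst_mul, Perm.mul_apply, edgeSwap_two]
  have E3 : (g * edgeSwap k m).1 (1 : Fin (k + 2)).succ.succ = g.1 1 := by
    rw [Prod.fst_mul, Perm.mul_apply, edgeSwap_three]
  have E4 : ∀ x : Fin k, (g * edgeSwap k m).1 x.succ.succ.succ.succ =
      g.1 x.succ.succ.succ.succ := fun x => by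
    rw [Prod.fst_mul, Perm.mul_apply, edgeSwap_rest]
  have V0 : (g * edgeSwap k m).2 0 = g.2 1 := by
    rw [Prod.snd_mul, Perm.mul_apply, edgeSwap, swap_apply_left]
  have V1 : (g * edgeSwap k m).2 1 = g.2 0 := by
    rw [Prod.snd_mul, Perm.mul_apply, edgeSwap, swap_apply_right]
  have a0 := h.att_of_ne 0 hs.ne_one
  have a1 := h.att_of_ne 1 hs.ne_two
  have hw : g.2 1 = Γ.att (g.1 (1 : Fin (k + 2)).succ.succ) := by
    have := h'.vert
    simp only [Prod.fst_one, Prod.snd_one, Perm.one_apply] at this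
    rw [← a1, ← this, Fin.succ_zero_eq_one]
  have hL : Lists Γ (g * edgeSwap k m) := by
    refine ⟨?_, ?_, ?_⟩
    · rw [E0, E1, ← h.flip]
      have := h'.flip_zero
      simp only [Prod.fst_one, Perm.one_apply] at this
      rw [this]
    · rw [V0, E1, hw]
    · rw [E0, E1, ← a0, ← a1]
      intro e
      exact h'.ne ((h.att_congr 0 1).2 e)
  -- If $v_1=w_1$, a half of the first edge accompanies the second. Otherwise the edges are
  -- disjoint, and a companion of the second edge in `Δ` is already one in `Γ`.
  have hC : Γ.Contractible ((g * edgeSwap k m).1 0) := by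
    by_cases e : Γ.att (g.1 0) = Γ.att (g.1 (0 : Fin (k + 2)).succ.succ)
    · refine hL.contractible (x := g.1 0) ?_ ?_ (Or.inl (by rw [E0, e]))
      · rw [E0]; exact (perm_succ_succ_ne g.1 0).1.symm
      · rw [E1]; exact (perm_succ_succ_ne g.1 1).1.symm
    · obtain ⟨-, y, hy0, hy1, hy⟩ := h'.contractible
      rw [h'.flip_zero] at hy1 hy
      simp only [Prod.fst_one, Perm.one_apply] at hy0 hy1 hy
      refine hL.contractible (x := g.1 y.succ.succ) ?_ ?_ ?_
      · rw [E0]; exact fun e => hy0 (perm_succ_succ_injective g.1 e)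
      · rw [E1]; exact fun e => hy1 (perm_succ_succ_injective g.1 e)
      · rw [E0, E1]
        rw [h.att_congr, h.att_congr, a0, a1] at hy
        by_cases e' : Γ.att (g.1 y.succ.succ) = Γ.att (g.1 1)
        · rw [h.att_of_eq y e'] at hy
          have := hs.ne_three
          tauto
        · rwa [h.att_of_ne y e'] at hy
  obtain ⟨Δ', i⟩ := exists_isContraction Γ hL hC
  have b0 := i.att_of_ne 0 (by rw [E1, E2]; exact hs.ne_three)
  have b1 := i.att_of_ne 1 (by rw [E1, E3]; exact hs.ne_two.symm)
  rw [E2] at b0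
  rw [E3] at b1
  have hL' : Lists Δ' (1 : Reord (k + 2) (m + 2)) := by
    refine ⟨?_, ?_, ?_⟩ <;> simp only [Prod.fst_one, Prod.snd_one, Perm.one_apply]
    · have := i.flip 0
      rw [E2, h.flip_zero, ← E3] at this
      exact perm_succ_succ_injective _ this
    · rw [← h.vert, ← V1] at b1
      have := (g * edgeSwap k m).2.injective b1
      rw [← Fin.succ_zero_eq_one] at this
      exact (Fin.succ_injective _ this).symm
    · rw [Ne, i.att_congr, b0, b1]
      exact h.ne
  -- The vertex $v_1$ survives both contractions. A half-edge of `Θ` at it lies in `Δ'` at $v_1$ or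
  -- $v_2$, so the first edge is not isolated there.
  have hC' : Δ'.Contractible ((1 : Reord (k + 2) (m + 2)).1 0) := by
    obtain ⟨a, ha⟩ := g.2.surjective (Γ.att (g.1 0))
    have ha0 : a ≠ 0 := by
      rintro rfl
      rw [h.vert] at ha
      exact h.ne ha.symm
    have ha1 : a ≠ 1 := by
      rintro rfl
      rw [hw] at ha
      exact hs.ne_three ha.symm
    obtain ⟨b, rfl⟩ := exists_succ_succ ha0 ha1
    obtain ⟨x, rfl⟩ := Θ.att_surj b
    have hx := double_att h h' hs x
    rw [ha] at hx
    refine hL'.contractible (x := x.succ.succ) (succ_succ_ne x).1 (succ_succ_ne x).2 ?_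
    simp only [Prod.fst_one, Perm.one_apply]
    rw [i.att_congr, i.att_congr, b0, b1]
    have c0 := i.att_of_eq x.succ.succ
    have c1 := i.att_of_ne x.succ.succ
    rw [E4, E1, E0] at c0
    rw [E4, E1] at c1
    have := hs.ne_three
    have := hs.ne_two
    have := hs.ne_one
    grind
  obtain ⟨Θ', i'⟩ := exists_isContraction Δ' hL' hC'
  exact ⟨Δ', i, double_unique h h' hs i i' ▸ i'⟩

end Double

end GraphCx

/-! ### The square of the differential. -/

namespace GraphCx

open Equiv

variable {r : Bool} {k m : ℕ} (K : Type*) [Field K]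

open Classical in
/-- The contraction of the edge at `h`, and then of the edge at `f`. -/
noncomputable def iterTerm (Γ : Graph r (k + 4) (m + 3)) (h f : Fin (k + 4)) :
    Chain K r k (m + 1) :=
  if H : ∃ p : Graph r (k + 2) (m + 2) × Reord (k + 4) (m + 3) × Fin (k + 2),
      IsContraction Γ p.1 p.2.1 ∧ p.2.1.1 0 = h ∧ p.2.1.1 p.2.2.succ.succ = f then
    -(H.choose.2.1.sgn • edgeTerm K H.choose.1 H.choose.2.2)
  else 0

variable {Γ : Graph r (k + 4) (m + 3)} {h f : Fin (k + 4)}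

theorem exists_of_iterTerm_ne_zero (hne : iterTerm K Γ h f ≠ 0) :
    ∃ (Δ : Graph r (k + 2) (m + 2)) (g : Reord (k + 4) (m + 3)) (x : Fin (k + 2)),
      IsContraction Γ Δ g ∧ g.1 0 = h ∧ g.1 x.succ.succ = f ∧ Δ.Contractible x := by
  unfold iterTerm at hne
  split_ifs at hne with H
  · obtain ⟨h1, h2, h3⟩ := H.choose_spec
    refine ⟨_, _, _, h1, h2, h3, ?_⟩
    by_contra hc
    exact hne (by rw [edgeTerm_of_not_contractible K hc, smul_zero, neg_zero])
  · exact absurd rfl hne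

/-- This gives independence of the choice in the definition: two listings of the first edge differ
by a `transfer`, and its sign is absorbed by `edgeTerm_relabel`. The listing may begin with either
half of that edge. -/
theorem iterTerm_eq {Δ : Graph r (k + 2) (m + 2)} {g : Reord (k + 4) (m + 3)}
    {x : Fin (k + 2)} (hc : IsContraction Γ Δ g) (hh : g.1 0 = h ∨ g.1 1 = h)
    (hf : g.1 x.succ.succ = f) : iterTerm K Γ h f = -(g.sgn • edgeTerm K Δ x) := by
  have hcon : Γ.Contractible h := by
    rcases hh with rfl | rfl
    · exact hc.contractible
    · rw [← hc.flip_zero]; exact hc.contractible.flip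
  have hfh : f ≠ h ∧ f ≠ Γ.flip h := by
    have hx := perm_succ_succ_ne g.1 x
    rw [hf] at hx
    rcases hh with rfl | rfl
    · rwa [hc.flip_zero]
    · rw [← hc.flip_zero, Γ.flip_flip, hc.flip_zero]; exact hx.symm
  have H : ∃ p : Graph r (k + 2) (m + 2) × Reord (k + 4) (m + 3) × Fin (k + 2),
      IsContraction Γ p.1 p.2.1 ∧ p.2.1.1 0 = h ∧ p.2.1.1 p.2.2.succ.succ = f := by
    obtain ⟨g', hg', rfl⟩ := exists_lists Γ hcon.1
    obtain ⟨Δ', hΔ'⟩ := exists_isContraction Γ hg' hcon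
    rw [hg'.flip_zero] at hfh
    obtain ⟨x', hx'⟩ := exists_perm_succ_succ hfh.1 hfh.2
    exact ⟨(Δ', g', x'), hΔ', rfl, hx'⟩
  rw [iterTerm, dif_pos H]
  obtain ⟨h1, h2, h3⟩ := H.choose_spec
  generalize H.choose = p at h1 h2 h3
  obtain ⟨Δ', g', x'⟩ := p
  dsimp only at h1 h2 h3 ⊢
  obtain ⟨u, hu, hs, hx⟩ := hc.transfer h1.toLists (hh.imp (fun e => h2.trans e.symm)
    (fun e => h2.trans e.symm))
  obtain rfl := h1.unique hu
  have : x' = u.1 x := perm_succ_succ_injective g'.1 (h3.trans (hf.symm.trans (hx x).symm))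
  rw [this, edgeTerm_relabel, smul_smul, hs, mul_right_comm, Int.units_mul_self, one_mul]

theorem iterTerm_flip_left : iterTerm K Γ (Γ.flip h) f = iterTerm K Γ h f := by
  have key : ∀ h', iterTerm K Γ h' f ≠ 0 → iterTerm K Γ (Γ.flip h') f = iterTerm K Γ h' f := by
    intro h' hne
    obtain ⟨Δ, g, x, hc, rfl, hf, -⟩ := exists_of_iterTerm_ne_zero K hne
    rw [iterTerm_eq K hc (Or.inl rfl) hf, iterTerm_eq K hc (Or.inr hc.flip_zero.symm) hf]
  by_cases e : iterTerm K Γ h f = 0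
  · by_cases e' : iterTerm K Γ (Γ.flip h) f = 0
    · rw [e, e']
    · have := key _ e'
      rwa [Γ.flip_flip, eq_comm] at this
  · exact key _ e

theorem iterTerm_flip_right : iterTerm K Γ h (Γ.flip f) = iterTerm K Γ h f := by
  have key : ∀ f', iterTerm K Γ h f' ≠ 0 → iterTerm K Γ h (Γ.flip f') = iterTerm K Γ h f' := by
    intro h' hne
    obtain ⟨Δ, g, x, hc, hh, rfl, -⟩ := exists_of_iterTerm_ne_zero K hne
    rw [iterTerm_eq K hc (Or.inl hh) rfl, iterTerm_eq K hc (Or.inl hh) (hc.flip x),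
      edgeTerm_flip]
  by_cases e : iterTerm K Γ h f = 0
  · by_cases e' : iterTerm K Γ h (Γ.flip f) = 0
    · rw [e, e']
    · have := key _ e'
      rwa [Γ.flip_flip, eq_comm] at this
  · exact key _ e

theorem exists_perm_four {n : ℕ} {a b c d : Fin (n + 4)} (hab : a ≠ b) (hac : a ≠ c) (had : a ≠ d)
    (hbc : b ≠ c) (hbd : b ≠ d) (hcd : c ≠ d) : ∃ σ : Perm (Fin (n + 4)), σ 0 = a ∧ σ 1 = b ∧
      σ (0 : Fin (n + 2)).succ.succ = c ∧ σ (1 : Fin (n + 2)).succ.succ = d := by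
  obtain ⟨σ, h0, h1⟩ := Graph.exists_perm_front hab
  have hc : ∃ c' : Fin (n + 2), c'.succ.succ = σ c := exists_succ_succ
    (fun e => hac (σ.injective (h0.trans e.symm))) (fun e => hbc (σ.injective (h1.trans e.symm)))
  have hd : ∃ d' : Fin (n + 2), d'.succ.succ = σ d := exists_succ_succ
    (fun e => had (σ.injective (h0.trans e.symm))) (fun e => hbd (σ.injective (h1.trans e.symm)))
  obtain ⟨c', hc⟩ := hc
  obtain ⟨d', hd⟩ := hd
  have hcd' : c' ≠ d' := by
    rintro rfl
    exact hcd (σ.injective (hc.symm.trans hd))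
  obtain ⟨τ, h2, h3⟩ := Graph.exists_perm_front hcd'
  refine ⟨(extTwo τ * σ)⁻¹, ?_, ?_, ?_, ?_⟩ <;> rw [Perm.inv_eq_iff_eq, Perm.mul_apply]
  · rw [h0, extTwo_zero]
  · rw [h1, extTwo_one]
  · rw [← hc, extTwo_succ, h2]
  · rw [← hd, extTwo_succ, h3]

/-- List both edges first, together with their deleted ends. Exchanging the two edges takes two
transpositions of half-edges and one of vertices, which is odd, and by `double_exists` the resulting
graph is the same. -/
theorem iterTerm_antisymm_of_separated {Δ : Graph r (k + 2) (m + 2)} {g : Reord (k + 4) (m + 3)}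
    {x : Fin (k + 2)} (hc : IsContraction Γ Δ g) (hh : g.1 0 = h) (hf : g.1 x.succ.succ = f)
    (hx : Δ.Contractible x) (h1 : Γ.att f ≠ Γ.att (Γ.flip h))
    (h2 : Γ.att (Γ.flip f) ≠ Γ.att (Γ.flip h)) (h3 : Γ.att h ≠ Γ.att (Γ.flip f)) :
    iterTerm K Γ f h = -iterTerm K Γ h f := by
  have hfh := perm_succ_succ_ne g.1 x
  rw [hf, hh, ← hc.flip_zero, hh] at hfh
  have hff : Γ.flip f ≠ h ∧ Γ.flip f ≠ Γ.flip h := by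
    refine ⟨fun e => hfh.2 ?_, fun e => hfh.1 (Γ.flip.injective e)⟩
    rw [← e, Γ.flip_flip]
  obtain ⟨σ, s0, s1, s2, s3⟩ := exists_perm_four (Γ.flip_ne h).symm hfh.1.symm hff.1.symm
    hfh.2.symm hff.2.symm (Γ.flip_ne f).symm
  obtain ⟨τ, t0, t1⟩ := Graph.exists_perm_front h2.symm
  set G : Reord (k + 4) (m + 3) := (σ, τ⁻¹) with hG
  have G1 : G.1 = σ := rfl
  have v0 : G.2 0 = Γ.att (Γ.flip h) := by rw [hG]; simp only [← t0, inv_apply_self']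
  have v1 : G.2 1 = Γ.att (Γ.flip f) := by rw [hG]; simp only [← t1, inv_apply_self']
  have hL : Lists Γ G := by
    refine ⟨?_, ?_, ?_⟩
    · rw [G1, s0, s1]
    · rw [v0, G1, s1]
    · rw [G1, s0, s1, ← hh]; exact hc.contractible.1
  obtain ⟨u, hu, -, hx'⟩ := hc.transfer hL (Or.inl (by rw [G1, s0, hh]))
  have hux : u.1 x = 0 := perm_succ_succ_injective G.1 (by
    show G.1 (u.1 x).succ.succ = G.1 (0 : Fin (k + 2)).succ.succ
    rw [hx', hf, ← s2])
  have hx0 := hx.relabel u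
  rw [hux] at hx0
  generalize Δ.relabel u = Δ' at hu hx0
  have hs : Separated Γ G := by
    refine ⟨?_, ?_, ?_⟩ <;> simp only [G1, s0, s1, s2, s3]
    exacts [h1, h2, h3]
  have fl : Δ'.flip 0 = 1 := by
    apply perm_succ_succ_injective G.1
    show G.1 (Δ'.flip 0).succ.succ = _
    rw [hu.flip, G1, s2, ← s3]
  have hL' : Lists Δ' (1 : Reord (k + 2) (m + 2)) := by
    refine ⟨?_, ?_, ?_⟩ <;> simp only [Prod.fst_one, Prod.snd_one, Perm.one_apply]
    · exact fl
    · have := hu.att_of_ne 1 hs.ne_two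
      rw [G1, s3, ← v1, G.2.injective.eq_iff, ← Fin.succ_zero_eq_one] at this
      rw [← Fin.succ_zero_eq_one]
      exact (Fin.succ_injective _ this).symm
    · have := hx0.1
      rwa [fl] at this
  obtain ⟨Θ, hΘ⟩ := exists_isContraction Δ' hL' hx0
  obtain ⟨Δ'', i, i'⟩ := double_exists hu hΘ hs
  have e1 : iterTerm K Γ h f = -(G.sgn • edgeTerm K Δ' 0) :=
    iterTerm_eq K hu (Or.inl s0) s2
  have e2 : iterTerm K Γ f h = -((G * edgeSwap k m).sgn • edgeTerm K Δ'' 0) := by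
    refine iterTerm_eq K i (Or.inl ?_) ?_
    · rw [Prod.fst_mul, Perm.mul_apply, edgeSwap_zero]; exact s2
    · rw [Prod.fst_mul, Perm.mul_apply, edgeSwap_two]; exact s0
  have e3 := edgeTerm_of_isContraction K hΘ
  have e4 := edgeTerm_of_isContraction K i'
  simp only [Prod.fst_one, Perm.one_apply] at e3 e4
  rw [e1, e2, e3, e4, Reord.sgn_mul, edgeSwap_sgn]
  simp

/-- After the first contraction the second edge is still not a loop, so in `Γ` the two edges share
at most one vertex. Each has an end not on the other; directing both edges towards such ends makes
them separated. -/
theorem iterTerm_antisymm_of_ne_zero (hne : iterTerm K Γ h f ≠ 0) :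
    iterTerm K Γ f h = -iterTerm K Γ h f := by
  have main : ∀ h' f', (h' = h ∨ h' = Γ.flip h) → (f' = f ∨ f' = Γ.flip f) →
      Γ.att f' ≠ Γ.att (Γ.flip h') → Γ.att (Γ.flip f') ≠ Γ.att (Γ.flip h') →
      Γ.att h' ≠ Γ.att (Γ.flip f') → iterTerm K Γ f h = -iterTerm K Γ h f := by
    intro h' f' hh hf h1 h2 h3
    have e1 : iterTerm K Γ h' f' = iterTerm K Γ h f := by
      rcases hh with rfl | rfl <;> rcases hf with rfl | rfl <;>
        simp only [iterTerm_flip_left, iterTerm_flip_right]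
    have e2 : iterTerm K Γ f' h' = iterTerm K Γ f h := by
      rcases hh with rfl | rfl <;> rcases hf with rfl | rfl <;>
        simp only [iterTerm_flip_left, iterTerm_flip_right]
    rw [← e1, ← e2]
    rw [← e1] at hne
    obtain ⟨Δ, g, x, a, b, c, d⟩ := exists_of_iterTerm_ne_zero K hne
    exact iterTerm_antisymm_of_separated K a b c d h1 h2 h3
  obtain ⟨Δ, g, x, hc, hh, hf, hx⟩ := exists_of_iterTerm_ne_zero K hne
  have hl := hc.contractible.1
  rw [hh] at hl
  have hx1 := hx.1
  rw [Ne, hc.att_congr] at hx1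
  have a0 := hc.att_of_eq x
  have a1 := hc.att_of_ne x
  have b0 := hc.att_of_eq (Δ.flip x)
  have b1 := hc.att_of_ne (Δ.flip x)
  rw [hc.flip, hf, ← hc.flip_zero, hh] at b0 b1
  rw [hf, ← hc.flip_zero, hh] at a0 a1
  have m1 := main h f (Or.inl rfl) (Or.inl rfl)
  have m2 := main (Γ.flip h) f (Or.inr rfl) (Or.inl rfl)
  have m3 := main h (Γ.flip f) (Or.inl rfl) (Or.inr rfl)
  have m4 := main (Γ.flip h) (Γ.flip f) (Or.inr rfl) (Or.inr rfl)
  simp only [Γ.flip_flip] at m2 m3 m4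
  grind

theorem iterTerm_antisymm : iterTerm K Γ f h = -iterTerm K Γ h f := by
  by_cases e : iterTerm K Γ h f = 0
  · by_cases e' : iterTerm K Γ f h = 0
    · rw [e, e', neg_zero]
    · rw [iterTerm_antisymm_of_ne_zero K e', neg_neg]
  · exact iterTerm_antisymm_of_ne_zero K e

theorem iterTerm_eq_zero_of_mem (hfh : f = h ∨ f = Γ.flip h) : iterTerm K Γ h f = 0 := by
  by_contra hne
  obtain ⟨Δ, g, x, hc, rfl, rfl, -⟩ := exists_of_iterTerm_ne_zero K hne
  have := perm_succ_succ_ne g.1 x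
  rw [hc.flip_zero] at hfh
  tauto

/-- A sum over the half-edges off the edge listed first. -/
theorem sum_perm_succ_succ {M : Type*} [AddCommMonoid M] {n : ℕ} (σ : Perm (Fin (n + 2)))
    (F : Fin (n + 2) → M) (h0 : F (σ 0) = 0) (h1 : F (σ 1) = 0) :
    ∑ y, F y = ∑ x : Fin n, F (σ x.succ.succ) := by
  rw [← Equiv.sum_comp σ, Fin.sum_univ_succ, Fin.sum_univ_succ, h0, Fin.succ_zero_eq_one, h1,
    zero_add, zero_add]

theorem chainBoundary_units_smul (u : ℤˣ) (x : Chain K r (k + 2) (m + 2)) :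
    chainBoundary K r k m (u • x) = u • chainBoundary K r k m x := by
  rcases Int.units_eq_one_or u with rfl | rfl <;> simp

theorem two_smul_chainBoundary_edgeTerm (Γ : Graph r (k + 4) (m + 3)) (h : Fin (k + 4)) :
    (2 : K) • chainBoundary K r k m (edgeTerm K Γ h) = ∑ f, iterTerm K Γ h f := by
  by_cases hc : Γ.Contractible h
  · obtain ⟨g, hg, rfl⟩ := exists_lists Γ hc.1
    obtain ⟨Δ, hΔ⟩ := exists_isContraction Γ hg hc
    rw [edgeTerm_of_isContraction K hΔ, map_neg, chainBoundary_units_smul, chainBoundary_cls,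
      smul_neg, smul_comm, two_smul_graphBoundary, Finset.smul_sum, ← Finset.sum_neg_distrib,
      sum_perm_succ_succ g.1 _ (iterTerm_eq_zero_of_mem K (Or.inl rfl))
        (iterTerm_eq_zero_of_mem K (Or.inr hΔ.flip_zero.symm))]
    exact Finset.sum_congr rfl fun x _ => (iterTerm_eq K hΔ (Or.inl rfl) rfl).symm
  · rw [edgeTerm_of_not_contractible K hc, map_zero, smul_zero]
    symm
    refine Finset.sum_eq_zero fun f _ => ?_
    by_contra hne
    obtain ⟨Δ, g, x, hΔ, rfl, -⟩ := exists_of_iterTerm_ne_zero K hne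
    exact hc hΔ.contractible

theorem chain_induction {p : Chain K r k m → Prop} (h0 : p 0) (hadd : ∀ x y, p x → p y → p (x + y))
    (hsmul : ∀ (c : K) x, p x → p (c • x)) (hcls : ∀ Γ, p (cls K Γ)) (x : Chain K r k m) : p x := by
  obtain ⟨x, rfl⟩ : ∃ y, Chain.mk K y = x := Submodule.mkQ_surjective _ x
  induction x using Finsupp.induction_linear with
  | zero => rw [map_zero]; exact h0
  | add f g hf hg => rw [map_add]; exact hadd _ _ hf hg
  | single Γ c =>
    have : Finsupp.single Γ c = c • Finsupp.single Γ (1 : K) := by simp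
    rw [this, map_smul]
    exact hsmul _ _ (hcls Γ)

/-- Summing over half-edges counts each edge twice, so $4d^2\Gamma$ is the double sum of an
antisymmetric function. It equals its own negative, and $2$ is invertible. -/
theorem chainBoundary_chainBoundary [CharZero K] (x : Chain K r (k + 4) (m + 3)) :
    chainBoundary K r k m (chainBoundary K r (k + 2) (m + 1) x) = 0 := by
  induction x using chain_induction with
  | h0 => simp
  | hadd x y hx hy => rw [map_add, map_add, hx, hy, add_zero]
  | hsmul c x hx => rw [map_smul, map_smul, hx, smul_zero]
  | hcls Γ =>
    rw [chainBoundary_cls]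
    have h2 : (2 : K) • ((2 : K) • chainBoundary K r k m (graphBoundary K Γ)) =
        ∑ h, ∑ f, iterTerm K Γ h f := by
      rw [← map_smul, two_smul_graphBoundary, map_sum, Finset.smul_sum]
      exact Finset.sum_congr rfl fun h _ => two_smul_chainBoundary_edgeTerm K Γ h
    have h3 : ∑ h, ∑ f, iterTerm K Γ h f = -∑ h, ∑ f, iterTerm K Γ h f := by
      conv_lhs => rw [Finset.sum_comm]
      simp only [← Finset.sum_neg_distrib]
      exact Finset.sum_congr rfl fun h _ => Finset.sum_congr rfl fun f _ => iterTerm_antisymm K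
    rw [eq_neg_iff_add_eq_zero, ← two_smul K, ← h2] at h3
    have two : (2 : K) ≠ 0 := two_ne_zero
    simpa [smul_eq_zero, two] using h3

theorem boundary_comp_boundary [CharZero K] : boundary K r ∘ₗ boundary K r = 0 := by
  ext x k m
  rcases m with _ | m
  · rfl
  · exact chainBoundary_chainBoundary K (x (k + 4) (m + 3))

end GraphCx

/-! ### Attaching an edge with a univalent end. -/

namespace GraphCx

open Equiv

variable {r : Bool} {k m : ℕ}

theorem sameCycle_of_fixed' {α : Type*} {σ : Perm α} {x y : α} (hy : σ y = y) :
    σ.SameCycle x y ↔ x = y := by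
  rw [Perm.sameCycle_comm, sameCycle_of_fixed hy, eq_comm]

theorem fin_two_cases {n : ℕ} {p : Fin (n + 2) → Prop} (h0 : p 0) (h1 : p 1)
    (h : ∀ x : Fin n, p x.succ.succ) (x : Fin (n + 2)) : p x :=
  Fin.cases h0 (fun x => Fin.cases h1 (fun x => h x) x) x

namespace Graph

/-- The vertex map of `attach`. -/
def attachAtt (Γ : Graph r k m) (a : Fin k) : Fin (k + 2) → Fin (m + 1) :=
  Fin.cases (Γ.att a).succ fun y => Fin.cases 0 (fun x => (Γ.att x).succ) y

@[simp] theorem attachAtt_zero (Γ : Graph r k m) (a : Fin k) :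
    Γ.attachAtt a 0 = (Γ.att a).succ := rfl

@[simp] theorem attachAtt_one (Γ : Graph r k m) (a : Fin k) : Γ.attachAtt a 1 = 0 := rfl

@[simp] theorem attachAtt_succ (Γ : Graph r k m) (a x : Fin k) :
    Γ.attachAtt a x.succ.succ = (Γ.att x).succ := rfl

/-- Attaches a new edge, with halves `0` and `1`, whose first half is placed right after the
half-edge `a` and whose other end is a new univalent vertex `0`. -/
def attach (Γ : Graph r k m) (a : Fin k) : Graph r (k + 2) (m + 1) where
  att := Γ.attachAtt a
  att_surj v := by
    refine Fin.cases ⟨1, rfl⟩ (fun v => ?_) v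
    obtain ⟨x, rfl⟩ := Γ.att_surj v
    exact ⟨x.succ.succ, rfl⟩
  flip := extTwo Γ.flip * swap 0 1
  flip_flip := by
    refine fin_two_cases ?_ ?_ fun x => ?_
    · simp
    · simp
    · simp [swap_apply_of_ne_of_ne (succ_succ_ne _).1 (succ_succ_ne _).2, Γ.flip_flip]
  flip_ne := by
    refine fin_two_cases ?_ ?_ fun x => ?_
    · simp
    · simp
    · rw [Perm.mul_apply, swap_apply_of_ne_of_ne (succ_succ_ne _).1 (succ_succ_ne _).2,
        extTwo_succ]
      exact fun h => Γ.flip_ne x (succ_succ_injective h)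
  -- The transposition replaces `a ↦ rot a` by `a ↦ 0 ↦ rot a`, while `1` stays fixed, alone at its
  -- vertex.
  rot hr := extTwo (Γ.rot hr) * swap a.succ.succ 0
  rot_cycle hr := by
    have hz := (succ_succ_ne a).1
    have inj := fun y z => (succ_succ_injective (n := k)).eq_iff (a := y) (b := z)
    have h1 := fun z : Fin k => (succ_succ_ne z).1
    have h2 := fun z : Fin k => (succ_succ_ne z).2
    have s0 : ∀ y, (extTwo (Γ.rot hr)).SameCycle 0 y ↔ 0 = y :=
      fun y => sameCycle_of_fixed (extTwo_zero _)
    have s0' : ∀ y, (extTwo (Γ.rot hr)).SameCycle y 0 ↔ y = 0 :=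
      fun y => sameCycle_of_fixed' (extTwo_zero _)
    have s1 : ∀ y, (extTwo (Γ.rot hr)).SameCycle 1 y ↔ 1 = y :=
      fun y => sameCycle_of_fixed (extTwo_one _)
    have s1' : ∀ y, (extTwo (Γ.rot hr)).SameCycle y 1 ↔ y = 1 :=
      fun y => sameCycle_of_fixed' (extTwo_one _)
    have hn : ¬ (extTwo (Γ.rot hr)).SameCycle a.succ.succ 0 := by rw [s0']; exact hz
    have h3 := fun v : Fin m => (Fin.succ_ne_zero v)
    refine fin_two_cases (fin_two_cases ?_ ?_ fun x => ?_) (fin_two_cases ?_ ?_ fun x => ?_)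
      fun x => fin_two_cases ?_ ?_ fun y => ?_ <;>
    simp only [sameCycle_mul_swap _ _ _ hn, s0, s0', s1, s1', sameCycle_extTwo, Γ.rot_cycle,
      attachAtt_zero, attachAtt_one, attachAtt_succ, Fin.succ_inj, h1, h2, h3,
      (h3 _).symm, (h1 _).symm, (h2 _).symm, zero_ne_one, one_ne_zero] <;> grind

variable (Γ : Graph r k m) (a : Fin k)

@[simp] theorem attach_att_zero : (Γ.attach a).att 0 = (Γ.att a).succ := rfl

@[simp] theorem attach_att_one : (Γ.attach a).att 1 = 0 := rfl

@[simp] theorem attach_att_succ (x : Fin k) : (Γ.attach a).att x.succ.succ = (Γ.att x).succ := rfl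

@[simp] theorem attach_flip_zero : (Γ.attach a).flip 0 = 1 := by simp [attach]

@[simp] theorem attach_flip_one : (Γ.attach a).flip 1 = 0 := by simp [attach]

@[simp] theorem attach_flip_succ (x : Fin k) :
    (Γ.attach a).flip x.succ.succ = (Γ.flip x).succ.succ := by
  simp [attach, swap_apply_of_ne_of_ne (succ_succ_ne _).1 (succ_succ_ne _).2]

theorem attach_rot (hr : r = true) :
    (Γ.attach a).rot hr = extTwo (Γ.rot hr) * swap a.succ.succ 0 := rfl

theorem attach_relabel (g : Reord k m) :
    (Γ.relabel g).attach (g.1 a) = (Γ.attach a).relabel (extTwo g.1, extOne g.2) := by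
  apply eq_relabel
  · refine fin_two_cases ?_ ?_ fun x => ?_ <;> simp [relabel]
  · refine fin_two_cases ?_ ?_ fun x => ?_ <;> simp [relabel]
  · intro hr x
    have : extTwo ((Γ.relabel g).rot hr) * swap (g.1 a).succ.succ 0 =
        extTwo g.1 * (extTwo (Γ.rot hr) * swap a.succ.succ 0) * (extTwo g.1)⁻¹ := by
      have e : swap (g.1 a).succ.succ 0 = extTwo g.1 * swap a.succ.succ 0 * (extTwo g.1)⁻¹ := by
        rw [← swap_apply_apply, extTwo_succ, extTwo_zero]
      rw [e]
      simp only [relabel, extTwo_mul, extTwo_inv]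
      group
    rw [attach_rot, attach_rot, this]
    simp

end Graph

theorem extTwo_swap {n : ℕ} (x y : Fin n) : extTwo (swap x y) = swap x.succ.succ y.succ.succ := by
  refine perm_ext_two ?_ ?_ fun z => ?_
  · rw [extTwo_zero, swap_apply_of_ne_of_ne (succ_succ_ne x).1.symm (succ_succ_ne y).1.symm]
  · rw [extTwo_one, swap_apply_of_ne_of_ne (succ_succ_ne x).2.symm (succ_succ_ne y).2.symm]
  · rw [extTwo_succ]
    exact succ_succ_injective.map_swap x y z

theorem Induced.extend {n l : ℕ} {φ : Fin n → Fin l} {θ : Perm (Fin l)} {ρ : Perm (Fin n)}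
    {ψ : Fin (n + 2) → Fin (l + 2)} (h : Induced φ θ ρ) (h0 : ψ 0 = 0) (h1 : ψ 1 = 1)
    (hψ : ∀ x, ψ x.succ.succ = (φ x).succ.succ) :
    Induced ψ (extTwo θ) (extTwo ρ) := by
  have hr : ∀ b, b.succ.succ ∈ Set.range ψ ↔ b ∈ Set.range φ := by
    intro b
    constructor
    · rintro ⟨z, hz⟩
      revert z
      refine fin_two_cases ?_ ?_ fun x => ?_
      · rw [h0]; exact fun e => absurd e.symm (succ_succ_ne b).1
      · rw [h1]; exact fun e => absurd e.symm (succ_succ_ne b).2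
      · rw [hψ]; exact fun e => ⟨x, succ_succ_injective e⟩
    · rintro ⟨x, rfl⟩; exact ⟨x.succ.succ, hψ x⟩
  have key : ∀ b c, FirstReturn (Set.range φ) θ b c →
      FirstReturn (Set.range ψ) (extTwo θ) b.succ.succ c.succ.succ := by
    intro b c hbc
    induction hbc with
    | base b hb => exact .of_eq (extTwo_succ _ _) ((hr _).2 hb)
    | step b c hn _ ih => exact .of_step (extTwo_succ _ _) (mt (hr _).1 hn) ih
  refine fin_two_cases ?_ ?_ fun x => ?_
  · rw [extTwo_zero, h0]; exact .of_eq (extTwo_zero _) ⟨0, h0⟩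
  · rw [extTwo_one, h1]; exact .of_eq (extTwo_one _) ⟨1, h1⟩
  · rw [extTwo_succ, hψ, hψ]; exact key _ _ (h x)

/-- The contraction of the new edge. -/
theorem isContraction_attach_new (Γ : Graph r k (m + 1)) (a : Fin k) :
    IsContraction (Γ.attach a) Γ 1 := by
  refine ⟨⟨?_, ?_, ?_⟩, fun x => ?_, fun x => ?_, fun x => ?_, fun hr => ?_⟩ <;>
    simp only [Prod.fst_one, Prod.snd_one, Perm.one_apply]
  · simp
  · simp
  · simp
  · simp
  · simp
  · simp
  · have hr' : ∀ z : Fin k, z.succ.succ ∈ Set.range (fun x : Fin k => x.succ.succ) :=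
      fun z => ⟨z, rfl⟩
    have hr0 : (0 : Fin (k + 2)) ∉ Set.range (fun x : Fin k => x.succ.succ) := by
      rintro ⟨x, hx⟩; exact (succ_succ_ne x).1 hx
    have hr1 : (1 : Fin (k + 2)) ∉ Set.range (fun x : Fin k => x.succ.succ) := by
      rintro ⟨x, hx⟩; exact (succ_succ_ne x).2 hx
    have ne0 := fun z : Fin k => (succ_succ_ne z).1
    have ne1 := fun z : Fin k => (succ_succ_ne z).2
    intro x
    rw [Graph.attach_rot]
    dsimp only
    -- Only at `a` does the excursion leave the old half-edges: it runs from `a` through `0` and `1`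
    -- to `rot a`.
    by_cases e : x = a
    · subst e
      have t0 : (extTwo (Γ.rot hr) * swap x.succ.succ 0 * swap 0 1 : Perm (Fin (k + 2))) x.succ.succ = 0 := by
        simp [swap_apply_of_ne_of_ne (ne0 x) (ne1 x)]
      have t1 : (extTwo (Γ.rot hr) * swap x.succ.succ 0 * swap 0 1 : Perm (Fin (k + 2))) 0 = 1 := by
        simp [swap_apply_of_ne_of_ne (ne1 x).symm]
      have t2 : (extTwo (Γ.rot hr) * swap x.succ.succ 0 * swap 0 1 : Perm (Fin (k + 2))) 1 =
          (Γ.rot hr x).succ.succ := by simp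
      exact .of_step t0 hr0 (.of_step t1 hr1 (.of_eq t2 (hr' _)))
    · refine .of_eq ?_ (hr' _)
      simp [swap_apply_of_ne_of_ne (ne0 x) (ne1 x),
        swap_apply_of_ne_of_ne (fun h => e (succ_succ_injective h)) (ne0 x)]

/-- Attaching an edge away from a contracted edge. -/
theorem IsContraction.attach {Γ : Graph r (k + 2) (m + 2)} {Δ : Graph r k (m + 1)}
    {g : Reord (k + 2) (m + 2)} (h : IsContraction Γ Δ g) (b : Fin k) :
    IsContraction (Γ.attach (g.1 b.succ.succ)) (Δ.attach b)
      ((extTwo g.1, extOne g.2) * edgeSwap k m) := by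
  -- Extending `g` by fixed points lists the new edge and its leaf first. `edgeSwap` then exchanges
  -- them with the old edge and its deleted vertex.
  have E0 : ((extTwo g.1, extOne g.2) * edgeSwap k m).1 0 = (g.1 0).succ.succ := by
    rw [Prod.fst_mul, Perm.mul_apply, edgeSwap_zero, extTwo_succ]
  have E1 : ((extTwo g.1, extOne g.2) * edgeSwap k m).1 1 = (g.1 1).succ.succ := by
    rw [Prod.fst_mul, Perm.mul_apply, edgeSwap_one, extTwo_succ]
  have E2 : ((extTwo g.1, extOne g.2) * edgeSwap k m).1 (0 : Fin (k + 2)).succ.succ = 0 := by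
    rw [Prod.fst_mul, Perm.mul_apply, edgeSwap_two, extTwo_zero]
  have E3 : ((extTwo g.1, extOne g.2) * edgeSwap k m).1 (1 : Fin (k + 2)).succ.succ = 1 := by
    rw [Prod.fst_mul, Perm.mul_apply, edgeSwap_three, extTwo_one]
  have E4 : ∀ x : Fin k, ((extTwo g.1, extOne g.2) * edgeSwap k m).1 x.succ.succ.succ.succ =
      (g.1 x.succ.succ).succ.succ := fun x => by
    rw [Prod.fst_mul, Perm.mul_apply, edgeSwap_rest, extTwo_succ]
  have V0 : ((extTwo g.1, extOne g.2) * edgeSwap k m).2 0 = (g.2 0).succ := by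
    rw [Prod.snd_mul, Perm.mul_apply, edgeSwap, swap_apply_left, ← Fin.succ_zero_eq_one,
      extOne_succ]
  have V1 : ((extTwo g.1, extOne g.2) * edgeSwap k m).2 (0 : Fin (m + 2)).succ = 0 := by
    rw [Fin.succ_zero_eq_one, Prod.snd_mul, Perm.mul_apply, edgeSwap, swap_apply_right,
      extOne_zero]
  have V2 : ∀ w : Fin (m + 1), ((extTwo g.1, extOne g.2) * edgeSwap k m).2 w.succ.succ =
      (g.2 w.succ).succ := fun w => by
    rw [Prod.snd_mul, Perm.mul_apply, edgeSwap,
      swap_apply_of_ne_of_ne (succ_succ_ne w).1 (succ_succ_ne w).2, extOne_succ]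
  refine ⟨⟨?_, ?_, ?_⟩, ?_, ?_, ?_, fun hr => ?_⟩
  · rw [E0, E1, Graph.attach_flip_succ, h.flip_zero]
  · rw [V0, E1, Graph.attach_att_succ, h.vert]
  · rw [E0, E1, Graph.attach_att_succ, Graph.attach_att_succ, Ne, Fin.succ_inj]
    exact h.ne
  · rw [E0, E1]
    refine fin_two_cases ?_ ?_ fun x => ?_
    · rw [E2]
      simp only [Graph.attach_att_succ, Graph.attach_att_zero, V2, Fin.succ_inj]
      exact h.att_of_eq b
    · rw [E3]
      simp only [Graph.attach_att_succ, Graph.attach_att_one]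
      exact fun e => absurd e.symm (Fin.succ_ne_zero _)
    · rw [E4]
      simp only [Graph.attach_att_succ, V2, Fin.succ_inj]
      exact h.att_of_eq x
  · rw [E1]
    refine fin_two_cases ?_ ?_ fun x => ?_
    · rw [E2]
      simp only [Graph.attach_att_succ, Graph.attach_att_zero, V2, Fin.succ_inj, ne_eq]
      exact h.att_of_ne b
    · rw [E3]
      simp only [Graph.attach_att_one, V1, implies_true]
    · rw [E4]
      simp only [Graph.attach_att_succ, V2, Fin.succ_inj, ne_eq]
      exact h.att_of_ne x
  · refine fin_two_cases ?_ ?_ fun x => ?_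
    · rw [Graph.attach_flip_zero, E2, E3, Graph.attach_flip_zero]
    · rw [Graph.attach_flip_one, E2, E3, Graph.attach_flip_one]
    · rw [Graph.attach_flip_succ, E4, E4, Graph.attach_flip_succ, h.flip]
  · have hi : Induced (fun x => ((extTwo g.1, extOne g.2) * edgeSwap k m).1 x.succ.succ)
        (extTwo (Γ.rot hr * swap (g.1 0) (g.1 1))) (extTwo (Δ.rot hr)) :=
      (h.rot hr).extend E2 E3 E4
    have := hi.mul_swap (perm_succ_succ_injective _) b.succ.succ 0
    rw [E4, E2] at this
    rw [Graph.attach_rot, Graph.attach_rot, E0, E1]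
    refine Eq.mp ?_ this
    congr 1
    -- One transposition inserts the new half next to `b`, the other belongs to the contracted edge.
    -- They are disjoint, as `b` is off that edge.
    rw [extTwo_mul, extTwo_swap, mul_assoc, mul_assoc]
    congr 1
    refine (Perm.Disjoint.commute ?_).eq
    intro x
    have k1 := perm_succ_succ_ne g.1 b
    have hb := fun z : Fin (k + 2) => (succ_succ_ne z).1
    by_cases e : x = (g.1 0).succ.succ ∨ x = (g.1 1).succ.succ
    · right
      rcases e with rfl | rfl
      · exact swap_apply_of_ne_of_ne (fun e => k1.1 (succ_succ_injective e).symm) (hb _)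
      · exact swap_apply_of_ne_of_ne (fun e => k1.2 (succ_succ_injective e).symm) (hb _)
    · left
      exact swap_apply_of_ne_of_ne (fun h => e (Or.inl h)) (fun h => e (Or.inr h))

end GraphCx

/-! ### Inner edges, and contracting an edge next to an attached one. -/

namespace GraphCx

open Equiv

variable {r : Bool} {k m : ℕ}

/-- An attached edge may replace an edge with a univalent end `y` that it is placed next to. -/
theorem isContraction_attach_univalent (Γ : Graph r k (m + 1)) {x y a : Fin k}
    (hxy : Γ.flip x = y) (hy : ∀ z, Γ.att z = Γ.att y → z = y) (ha : a = x ∨ a = y) :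
    IsContraction (Γ.attach a) Γ
      (swap 0 x.succ.succ * swap 1 y.succ.succ, swap 0 (Γ.att y).succ) := by
  have ne0 := fun z : Fin k => (succ_succ_ne z).1
  have ne1 := fun z : Fin k => (succ_succ_ne z).2
  have inj := fun p q => (succ_succ_injective (n := k)).eq_iff (a := p) (b := q)
  have hne : x ≠ y := by rw [← hxy]; exact (Γ.flip_ne x).symm
  have hyx : Γ.flip y = x := by rw [← hxy, Γ.flip_flip]
  -- The new halves `0`, `1` take the places of `x`, `y`, and the new leaf takes the place of the
  -- vertex of `y`; everything else stays.
  set g : Reord (k + 2) (m + 2) :=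
    (swap 0 x.succ.succ * swap 1 y.succ.succ, swap 0 (Γ.att y).succ) with hg
  have E0 : g.1 0 = x.succ.succ := by
    rw [hg, Perm.mul_apply, swap_apply_of_ne_of_ne (a := 1) (by simp) (ne0 y).symm,
      swap_apply_left]
  have E1 : g.1 1 = y.succ.succ := by
    rw [hg, Perm.mul_apply, swap_apply_left, swap_apply_of_ne_of_ne (ne0 y)]
    rw [Ne, inj]; exact hne.symm
  have Ex : g.1 x.succ.succ = 0 := by
    rw [hg, Perm.mul_apply, swap_apply_of_ne_of_ne (a := 1) (ne1 x), swap_apply_right]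
    rw [Ne, inj]; exact hne
  have Ey : g.1 y.succ.succ = 1 := by
    rw [hg, Perm.mul_apply, swap_apply_right, swap_apply_of_ne_of_ne (by simp) (ne1 x).symm]
  have Ez : ∀ z, z ≠ x → z ≠ y → g.1 z.succ.succ = z.succ.succ := fun z h1 h2 => by
    rw [hg, Perm.mul_apply, swap_apply_of_ne_of_ne (a := 1) (ne1 z),
      swap_apply_of_ne_of_ne (ne0 z)]
    · rw [Ne, inj]; exact h1
    · rw [Ne, inj]; exact h2
  have V0 : g.2 0 = (Γ.att y).succ := by rw [hg]; simp
  have V1 : g.2 (Γ.att y).succ = 0 := by rw [hg]; simp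
  have V2 : ∀ w, w ≠ Γ.att y → g.2 w.succ = w.succ := fun w hw => by
    rw [hg]
    exact swap_apply_of_ne_of_ne (Fin.succ_ne_zero _) (by rwa [Ne, Fin.succ_inj])
  have hxy' : Γ.att x ≠ Γ.att y := fun e => hne (hy x e)
  have vne := fun w : Fin (m + 1) => Fin.succ_ne_zero w
  have cases3 : ∀ {p : Fin k → Prop}, p x → p y → (∀ z, z ≠ x → z ≠ y → p z) → ∀ z, p z := by
    intro p h1 h2 h3 z
    by_cases e1 : z = x
    · exact e1 ▸ h1
    by_cases e2 : z = y
    · exact e2 ▸ h2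
    exact h3 z e1 e2
  refine ⟨⟨?_, ?_, ?_⟩, ?_, ?_, ?_, fun hr => ?_⟩
  · rw [E0, E1, Graph.attach_flip_succ, hxy]
  · rw [V0, E1, Graph.attach_att_succ]
  · rw [E0, E1, Graph.attach_att_succ, Graph.attach_att_succ, Ne, Fin.succ_inj]
    exact hxy'
  · rw [E0, E1]
    refine cases3 ?_ ?_ fun z h1 h2 => ?_
    · rw [Ex, V2 _ hxy']; simp
    · rw [Ey]
      simp only [Graph.attach_att_one, Graph.attach_att_succ]
      exact fun e => absurd e.symm (vne _)
    · rw [Ez z h1 h2]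
      simp only [Graph.attach_att_succ, Fin.succ_inj]
      exact fun e => absurd (hy z e) h2
  · rw [E1]
    refine cases3 ?_ ?_ fun z h1 h2 => ?_
    · rw [Ex, V2 _ hxy']
      simp only [Graph.attach_att_zero, Graph.attach_att_succ, ne_eq, Fin.succ_inj]
      rcases ha with rfl | rfl <;> simp
    · rw [Ey, V1]; simp
    · rw [Ez z h1 h2, V2 _ fun e => h2 (hy z e)]
      simp
  · refine cases3 ?_ ?_ fun z h1 h2 => ?_
    · rw [Ex, hxy, Ey]; simp
    · rw [Ey, hyx, Ex]; simp
    · rw [Ez z h1 h2, Ez, Graph.attach_flip_succ]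
      · intro e; rw [← hyx] at e; exact h2 (Γ.flip.injective e)
      · intro e; rw [← hxy] at e; exact h1 (Γ.flip.injective e)
  · set ρ := Γ.rot hr with hρ
    have ry : ρ y = y := hy _ ((Γ.rot_cycle hr _ _).1 (by
      rw [Perm.sameCycle_apply_left]))
    have ryz : ∀ z, z ≠ y → ρ z ≠ y := fun z hz e => hz (ρ.injective (e.trans ry.symm))
    rw [Graph.attach_rot, ← hρ, E0, E1]
    set θ : Perm (Fin (k + 2)) :=
      extTwo ρ * swap a.succ.succ 0 * swap x.succ.succ y.succ.succ with hθ
    have n1 : x.succ.succ ∉ Set.range (fun z : Fin k => g.1 z.succ.succ) := by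
      rintro ⟨z, hz⟩; rw [← E0] at hz; exact (perm_succ_succ_ne g.1 z).1 hz
    have n2 : y.succ.succ ∉ Set.range (fun z : Fin k => g.1 z.succ.succ) := by
      rintro ⟨z, hz⟩; rw [← E1] at hz; exact (perm_succ_succ_ne g.1 z).2 hz
    have hr' : ∀ z : Fin k, g.1 z.succ.succ ∈ Set.range (fun z : Fin k => g.1 z.succ.succ) :=
      fun z => ⟨z, rfl⟩
    have tz : ∀ z : Fin k, z ≠ x → z ≠ y → θ z.succ.succ = (ρ z).succ.succ := by
      intro z h1 h2
      rw [hθ, Perm.mul_apply, Perm.mul_apply, swap_apply_of_ne_of_ne (a := x.succ.succ),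
        swap_apply_of_ne_of_ne _ (ne0 z), extTwo_succ]
      · rw [Ne, inj]; rcases ha with rfl | rfl <;> assumption
      · rwa [Ne, inj]
      · rwa [Ne, inj]
    have t1 : θ 1 = 1 := by
      rw [hθ, Perm.mul_apply, Perm.mul_apply, swap_apply_of_ne_of_ne (ne1 x).symm (ne1 y).symm,
        swap_apply_of_ne_of_ne (ne1 a).symm (by simp), extTwo_one]
    have t0 : θ 0 = (ρ a).succ.succ := by
      rw [hθ, Perm.mul_apply, Perm.mul_apply, swap_apply_of_ne_of_ne (ne0 x).symm (ne0 y).symm,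
        swap_apply_right, extTwo_succ]
    have tend : FirstReturn (Set.range fun z : Fin k => g.1 z.succ.succ) θ 1 1 := by
      refine .of_eq t1 ?_
      rw [← Ey]; exact hr' y
    have h0 : (0 : Fin (k + 2)) ∈ Set.range fun z : Fin k => g.1 z.succ.succ := by
      rw [← Ex]; exact hr' x
    have done : ∀ c : Fin k, c ≠ x → c ≠ y →
        c.succ.succ ∈ Set.range fun z : Fin k => g.1 z.succ.succ := fun c h1 h2 => by
      rw [← Ez c h1 h2]; exact hr' c
    -- With `ρ` the old rotation, the paths are `x → y → 0 → ρ x` if the new half is placed at `x`,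
    -- and `x → 0 → y → ρ x` if it is placed at `y`. Either way `0` inherits the position of `x`; a
    -- fixed `x` needs a separate case.
    rcases ha with rfl | rfl
    · have tx : θ a.succ.succ = y.succ.succ := by
        rw [hθ, Perm.mul_apply, Perm.mul_apply, swap_apply_left, swap_apply_of_ne_of_ne _ (ne0 y),
          extTwo_succ, ry]
        rw [Ne, inj]; exact hne.symm
      have ty : θ y.succ.succ = 0 := by
        rw [hθ, Perm.mul_apply, Perm.mul_apply, swap_apply_right, swap_apply_left, extTwo_zero]
      have back : FirstReturn (Set.range fun z : Fin k => g.1 z.succ.succ) θ a.succ.succ 0 :=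
        .of_step tx n2 (.of_eq ty h0)
      refine cases3 ?_ ?_ fun z h1 h2 => ?_ <;> dsimp only
      · rw [Ex]
        by_cases e : ρ a = a
        · rw [e, Ex]
          exact .of_step (t0.trans (by rw [e])) n1 back
        · rw [Ez _ e (ryz a hne)]
          exact .of_eq t0 (done _ e (ryz a hne))
      · rw [ry, Ey]; exact tend
      · rw [Ez z h1 h2]
        by_cases e : ρ z = a
        · rw [e, Ex]
          exact .of_step ((tz z h1 h2).trans (by rw [e])) n1 back
        · rw [Ez _ e (ryz z h2)]
          exact .of_eq (tz z h1 h2) (done _ e (ryz z h2))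
    · have tx : θ x.succ.succ = 0 := by
        rw [hθ, Perm.mul_apply, Perm.mul_apply, swap_apply_left, swap_apply_left, extTwo_zero]
      have ty : θ a.succ.succ = (ρ x).succ.succ := by
        rw [hθ, Perm.mul_apply, Perm.mul_apply, swap_apply_right, swap_apply_of_ne_of_ne _ (ne0 x),
          extTwo_succ]
        rw [Ne, inj]; exact hne
      rw [ry] at t0
      refine cases3 ?_ ?_ fun z h1 h2 => ?_ <;> dsimp only
      · rw [Ex]
        refine .of_step t0 n2 ?_
        by_cases e : ρ x = x
        · rw [e, Ex]
          exact .of_step (ty.trans (by rw [e])) n1 (.of_eq tx h0)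
        · rw [Ez _ e (ryz x hne)]
          exact .of_eq ty (done _ e (ryz x hne))
      · rw [ry, Ey]; exact tend
      · rw [Ez z h1 h2]
        by_cases e : ρ z = x
        · rw [e, Ex]
          exact .of_step ((tz z h1 h2).trans (by rw [e])) n1 (.of_eq tx h0)
        · rw [Ez _ e (ryz z h2)]
          exact .of_eq (tz z h1 h2) (done _ e (ryz z h2))

namespace Graph

/-- The half-edge `a` is not alone at its vertex. -/
def Accompanied (Γ : Graph r k m) (a : Fin k) : Prop := ∃ b, b ≠ a ∧ Γ.att b = Γ.att a

/-- Both ends of the edge of `a` have valence at least two. -/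
def Inner (Γ : Graph r k m) (a : Fin k) : Prop :=
  Γ.Accompanied a ∧ Γ.Accompanied (Γ.flip a)

open Classical in
/-- The number of half-edges of edges without univalent ends. -/
noncomputable def innerCount (Γ : Graph r k m) : ℕ := Finset.card {a | Γ.Inner a}

/-- The new edge has a univalent end and is not inner. As a companion its half `0` helps only
half-edges at the vertex of `a`; these are already accompanied by `a`, or, for `a` itself, because
`a` is inner. -/
theorem inner_attach {Γ : Graph r k m} {a : Fin k} (ha : Γ.Inner a) (y : Fin (k + 2))
    (hy : (Γ.attach a).Inner y) : ∃ z, y = z.succ.succ ∧ Γ.Inner z := by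
  have key : ∀ z, (Γ.attach a).Accompanied z.succ.succ → Γ.Accompanied z := by
    rintro z ⟨b, hb, hbz⟩
    revert b
    refine fin_two_cases ?_ ?_ fun x => ?_
    · intro _ h
      rw [attach_att_zero, attach_att_succ, Fin.succ_inj] at h
      by_cases e : a = z
      · exact e ▸ ha.1
      · exact ⟨a, e, h⟩
    · intro _ h
      rw [attach_att_one, attach_att_succ] at h
      exact absurd h.symm (Fin.succ_ne_zero _)
    · intro h1 h
      rw [attach_att_succ, attach_att_succ, Fin.succ_inj] at h
      exact ⟨x, fun e => h1 (e ▸ rfl), h⟩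
  have h1 : ¬ (Γ.attach a).Accompanied 1 := by
    rintro ⟨b, hb, hb1⟩
    revert b
    refine fin_two_cases ?_ ?_ fun x => ?_ <;> simp
  revert y
  refine fin_two_cases ?_ ?_ fun x => ?_
  · intro h
    exact absurd (attach_flip_zero Γ a ▸ h.2) h1
  · intro h
    exact absurd h.1 h1
  · intro h
    refine ⟨x, rfl, key _ h.1, key _ ?_⟩
    have := h.2
    rwa [attach_flip_succ] at this

end Graph

/-- A half-edge alone at its vertex and off the contracted edge stays alone, because that vertex is
not an endpoint of the edge. -/
theorem IsContraction.inner {Γ : Graph r (k + 2) (m + 2)} {Δ : Graph r k (m + 1)}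
    {g : Reord (k + 2) (m + 2)} (h : IsContraction Γ Δ g) {x : Fin k} (hx : Δ.Inner x) :
    Γ.Inner (g.1 x.succ.succ) := by
  have key : ∀ x, Δ.Accompanied x → Γ.Accompanied (g.1 x.succ.succ) := by
    rintro x ⟨b, hb, hbx⟩
    by_contra hcon
    have n : ∀ z, z ≠ g.1 x.succ.succ → Γ.att z ≠ Γ.att (g.1 x.succ.succ) :=
      fun z h1 h2 => hcon ⟨z, h1, h2⟩
    have k0 := n _ (perm_succ_succ_ne g.1 x).1.symm
    have k1 := n _ (perm_succ_succ_ne g.1 x).2.symm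
    have kb := n (g.1 b.succ.succ) fun e => hb (perm_succ_succ_injective g.1 e)
    have e1 := h.att_of_ne x k1.symm
    have e2 := h.att_of_ne b
    have e3 := h.att_of_eq b
    rw [hbx, e1] at e2 e3
    by_cases e : Γ.att (g.1 b.succ.succ) = Γ.att (g.1 1)
    · exact k0 (e3 e).symm
    · exact kb (e2 e).symm
  exact ⟨key _ hx.1, h.flip x ▸ key _ hx.2⟩

theorem IsContraction.innerCount_le {Γ : Graph r (k + 2) (m + 2)} {Δ : Graph r k (m + 1)}
    {g : Reord (k + 2) (m + 2)} (h : IsContraction Γ Δ g) : Δ.innerCount ≤ Γ.innerCount :=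
  Finset.card_le_card_of_injOn (fun x => g.1 x.succ.succ)
    (fun x hx => by simpa using h.inner (by simpa using hx))
    (perm_succ_succ_injective g.1).injOn

/-- The inner half-edges of `Δ` inject into those of `Γ`, and `a` is missed because its edge has
been contracted. -/
theorem innerCount_contraction_attach_lt {Γ : Graph r k (m + 1)} {Δ : Graph r k (m + 1)}
    {a : Fin k} {g : Reord (k + 2) (m + 2)} (h : IsContraction (Γ.attach a) Δ g)
    (h0 : g.1 0 = a.succ.succ) (ha : Γ.Inner a) : Δ.innerCount < Γ.innerCount := by
  classical
  have hz : ∀ x, Δ.Inner x → ∃ z, g.1 x.succ.succ = z.succ.succ ∧ Γ.Inner z :=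
    fun x hx => Graph.inner_attach ha _ (h.inner hx)
  choose! F hF hF' using hz
  have hlt : Γ.innerCount = (Finset.univ.filter fun z => Γ.Inner z).card := by
    unfold Graph.innerCount; congr
  have hlt' : Δ.innerCount = (Finset.univ.filter fun z => Δ.Inner z).card := by
    unfold Graph.innerCount; congr
  rw [hlt, hlt']
  have hmem : a ∈ Finset.univ.filter fun z => Γ.Inner z := by simpa using ha
  refine lt_of_le_of_lt ?_ (Finset.card_erase_lt_of_mem hmem)
  refine Finset.card_le_card_of_injOn F ?_ ?_
  · intro x hx
    have hx : Δ.Inner x := by simpa using hx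
    simp only [Finset.coe_erase, Finset.coe_filter, Finset.mem_univ, true_and, Set.mem_sdiff,
      Set.mem_ofPred_eq, Set.mem_singleton_iff]
    refine ⟨hF' x hx, fun e => (perm_succ_succ_ne g.1 x).1 ?_⟩
    rw [hF x hx, e, h0]
  · intro x hx y hy e
    have hx : Δ.Inner x := by simpa using hx
    have hy : Δ.Inner y := by simpa using hy
    apply perm_succ_succ_injective g.1
    show g.1 x.succ.succ = g.1 y.succ.succ
    rw [hF x hx, hF y hy, e]

variable (K : Type*) [Field K]

/-- The new edge takes the place of the contracted one. The listing is a product of three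
transpositions, and its sign cancels the minus in `edgeTerm_of_isContraction`. -/
theorem edgeTerm_attach_of_not_inner {Γ : Graph r k (m + 1)} {a : Fin k} (ha : ¬ Γ.Inner a) :
    edgeTerm K (Γ.attach a) a.succ.succ = cls K Γ := by
  have main : ∀ x y, Γ.flip x = y → ¬ Γ.Accompanied y → (a = x ∨ a = y) →
      edgeTerm K (Γ.attach a) a.succ.succ = cls K Γ := by
    intro x y hxy hy hax
    have hy' : ∀ z, Γ.att z = Γ.att y → z = y := fun z hz => by
      by_contra hne; exact hy ⟨z, hne, hz⟩
    have hc := isContraction_attach_univalent Γ hxy hy' hax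
    have h1 := edgeTerm_of_isContraction K hc
    have hs : Reord.sgn (swap 0 x.succ.succ * swap 1 y.succ.succ, swap 0 (Γ.att y).succ) = -1 := by
      simp only [Reord.sgn, Perm.sign_mul, Perm.sign_swap (succ_succ_ne x).1.symm,
        Perm.sign_swap (succ_succ_ne y).2.symm, Perm.sign_swap (Fin.succ_ne_zero _).symm]
      simp
    rw [hs] at h1
    have h0 : (swap 0 x.succ.succ * swap 1 y.succ.succ : Perm (Fin (k + 2))) 0 = x.succ.succ := by
      rw [Perm.mul_apply, swap_apply_of_ne_of_ne (a := 1) (by simp) (succ_succ_ne y).1.symm,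
        swap_apply_left]
    rw [h0] at h1
    have h2 : edgeTerm K (Γ.attach a) a.succ.succ = edgeTerm K (Γ.attach a) x.succ.succ := by
      rcases hax with rfl | rfl
      · rfl
      · rw [← hxy, ← Graph.attach_flip_succ, edgeTerm_flip]
    rw [h2, h1]
    simp
  by_cases h : Γ.Accompanied a
  · exact main a _ rfl (fun h' => ha ⟨h, h'⟩) (Or.inl rfl)
  · exact main (Γ.flip a) a (Γ.flip_flip a) h (Or.inr rfl)

/-- The span of the graphs with fewer than `n` inner half-edges. -/
noncomputable def innerFiltration (r : Bool) (k m n : ℕ) : Submodule K (Chain K r k m) :=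
  Submodule.span K {y | ∃ Γ : Graph r k m, Γ.innerCount < n ∧ y = cls K Γ}

theorem units_smul_mem {M : Type*} [AddCommGroup M] [Module K M] {S : Submodule K M} {x : M}
    (u : ℤˣ) (hx : x ∈ S) : u • x ∈ S := by
  rcases Int.units_eq_one_or u with rfl | rfl
  · simpa using hx
  · simpa using hx

theorem edgeTerm_attach_of_inner {Γ : Graph r k (m + 1)} {a : Fin k} (ha : Γ.Inner a) :
    edgeTerm K (Γ.attach a) a.succ.succ ∈ innerFiltration K r k (m + 1) Γ.innerCount := by
  by_cases hc : (Γ.attach a).Contractible a.succ.succ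
  · obtain ⟨g, hg, h0⟩ := exists_lists _ hc.1
    rw [← h0] at hc ⊢
    obtain ⟨Δ, hΔ⟩ := exists_isContraction _ hg hc
    rw [edgeTerm_of_isContraction K hΔ]
    refine neg_mem (units_smul_mem K _ (Submodule.subset_span ⟨Δ, ?_, rfl⟩))
    exact innerCount_contraction_attach_lt hΔ h0 ha
  · rw [edgeTerm_of_not_contractible K hc]
    exact zero_mem _

/-- The value of the Laplacian of the contracting homotopy on a graph. -/
noncomputable def laplaceTerm (Γ : Graph r k (m + 1)) : Chain K r k (m + 1) :=
  ∑ a, (cls K Γ - edgeTerm K (Γ.attach a) a.succ.succ)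

/-- Half-edges that are not inner contribute zero. Each inner one contributes `Γ` minus a term of
lower filtration, so the eigenvalue is their number. -/
theorem laplaceTerm_sub_mem (Γ : Graph r k (m + 1)) :
    laplaceTerm K Γ - (Γ.innerCount : K) • cls K Γ ∈
      innerFiltration K r k (m + 1) Γ.innerCount := by
  classical
  have h1 : laplaceTerm K Γ = ∑ a with Γ.Inner a,
      (cls K Γ - edgeTerm K (Γ.attach a) a.succ.succ) := by
    unfold laplaceTerm
    symm
    refine Finset.sum_subset (Finset.filter_subset _ _) fun a _ ha => ?_
    rw [edgeTerm_attach_of_not_inner K (by simpa using ha), sub_self]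
  have h2 : (Γ.innerCount : K) • cls K Γ = ∑ a with Γ.Inner a, cls K Γ := by
    rw [Finset.sum_const, Nat.cast_smul_eq_nsmul]
    unfold Graph.innerCount
    congr!
  rw [h1, h2, Finset.sum_sub_distrib, sub_sub_cancel_left]
  exact neg_mem (sum_mem fun a ha => edgeTerm_attach_of_inner K (by simpa using ha))

end GraphCx

/-! ### The homotopy and its Laplacian. -/

namespace GraphCx

open Equiv

variable {r : Bool} {k m : ℕ} (K : Type*) [Field K]

/-- Minus the sum of all graphs obtained by attaching an edge with a univalent end. -/
noncomputable def attachSum (Γ : Graph r k m) : Chain K r (k + 2) (m + 1) :=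
  -∑ a, cls K (Γ.attach a)

theorem attachSum_relabel (Γ : Graph r k m) (g : Reord k m) :
    attachSum K (Γ.relabel g) = g.sgn • attachSum K Γ := by
  unfold attachSum
  rw [smul_neg, Finset.smul_sum, ← Equiv.sum_comp g.1]
  congr 1
  refine Finset.sum_congr rfl fun a _ => ?_
  rw [Graph.attach_relabel, cls_relabel]
  simp [Reord.sgn]

/-- The contracting homotopy. -/
noncomputable def attachMap (r : Bool) (k m : ℕ) :
    Chain K r k m →ₗ[K] Chain K r (k + 2) (m + 1) :=
  (orientationRel K r k m).liftQ
    (Finsupp.linearCombination K (attachSum K)) (by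
      rw [orientationRel, Submodule.span_le]
      rintro _ ⟨g, Γ, rfl⟩
      have hs : ∀ (u : ℤˣ) (x : Graph r k m →₀ K),
          Finsupp.linearCombination K (attachSum K) (u • x) =
            u • Finsupp.linearCombination K (attachSum K) x := by
        intro u x
        rcases Int.units_eq_one_or u with rfl | rfl <;> simp
      simp only [SetLike.mem_coe, LinearMap.mem_ker, map_sub, hs,
        Finsupp.linearCombination_single, one_smul, attachSum_relabel, sub_self])

theorem attachMap_cls (Γ : Graph r k m) : attachMap K r k m (cls K Γ) = attachSum K Γ := by
  refine (Submodule.liftQ_apply _ _ _).trans ?_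
  simp

theorem attachMap_units_smul (u : ℤˣ) (x : Chain K r k m) :
    attachMap K r k m (u • x) = u • attachMap K r k m x := by
  rcases Int.units_eq_one_or u with rfl | rfl <;> simp

theorem edgeTerm_attach_zero (Γ : Graph r k (m + 1)) (a : Fin k) :
    edgeTerm K (Γ.attach a) 0 = -cls K Γ := by
  have := edgeTerm_of_isContraction K (isContraction_attach_new Γ a)
  simpa [Reord.sgn] using this

/-- Each of the two halves of the new edge contributes `-cls K Γ`, and the sign in `attachSum` turns
this into the positive term. -/
theorem two_smul_chainBoundary_attachSum (Γ : Graph r k (m + 1)) :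
    (2 : K) • chainBoundary K r k m (attachSum K Γ) =
      ∑ a, ((2 : K) • cls K Γ - ∑ x : Fin k, edgeTerm K (Γ.attach a) x.succ.succ) := by
  unfold attachSum
  rw [map_neg, map_sum, smul_neg, Finset.smul_sum, ← Finset.sum_neg_distrib]
  refine Finset.sum_congr rfl fun a _ => ?_
  rw [chainBoundary_cls, two_smul_graphBoundary, Fin.sum_univ_succ, Fin.sum_univ_succ,
    Fin.succ_zero_eq_one, ← Graph.attach_flip_zero Γ a, edgeTerm_flip, edgeTerm_attach_zero,
    two_smul]
  abel

/-- The half-edges of the contraction are those of `Γ` off the edge of `x`, and there attaching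
commutes with contracting. The sign of `edgeSwap` is compensated by the minus in `attachSum`, so
these terms cancel those of $dh$. -/
theorem attachMap_edgeTerm (Γ : Graph r (k + 2) (m + 2)) (x : Fin (k + 2)) :
    attachMap K r k (m + 1) (edgeTerm K Γ x) =
      ∑ a, if a = x ∨ a = Γ.flip x then 0 else edgeTerm K (Γ.attach a) x.succ.succ := by
  by_cases hc : Γ.Contractible x
  · obtain ⟨g, hg, rfl⟩ := exists_lists Γ hc.1
    obtain ⟨Δ, hΔ⟩ := exists_isContraction Γ hg hc
    rw [edgeTerm_of_isContraction K hΔ, map_neg, attachMap_units_smul, attachMap_cls,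
      sum_perm_succ_succ g.1 (fun a => if a = g.1 0 ∨ a = Γ.flip (g.1 0) then 0
        else edgeTerm K (Γ.attach a) (g.1 0).succ.succ) (if_pos (Or.inl rfl)) (if_pos (Or.inr hΔ.flip_zero.symm)),
      attachSum, smul_neg, neg_neg, Finset.smul_sum]
    refine Finset.sum_congr rfl fun b _ => ?_
    have hb := perm_succ_succ_ne g.1 b
    rw [if_neg (by rw [hΔ.flip_zero]; tauto)]
    have h1 := edgeTerm_of_isContraction K (hΔ.attach b)
    rw [Prod.fst_mul, Perm.mul_apply, edgeSwap_zero, extTwo_succ] at h1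
    rw [h1, Reord.sgn_mul, edgeSwap_sgn]
    simp [Reord.sgn]
  · rw [edgeTerm_of_not_contractible K hc, map_zero]
    symm
    refine Finset.sum_eq_zero fun a _ => ?_
    split_ifs with h
    · rfl
    · refine edgeTerm_of_not_contractible K fun h' => hc ?_
      obtain ⟨h1, z, hz0, hz1, hz⟩ := h'
      rw [Graph.attach_flip_succ] at h1 hz1 hz
      simp only [Graph.attach_att_succ, ne_eq, Fin.succ_inj] at h1 hz
      refine ⟨h1, ?_⟩
      revert z
      refine fin_two_cases ?_ ?_ fun z => ?_
      -- If the only companion is the new half, then `a`, at the same vertex and off the edge, is a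
      -- companion already in `Γ`.
      · intro _ _ hz
        simp only [Graph.attach_att_zero, Fin.succ_inj] at hz
        exact ⟨a, fun e => h (Or.inl e), fun e => h (Or.inr e), hz⟩
      · intro _ _ hz
        simp only [Graph.attach_att_one, (Fin.succ_ne_zero _).symm, or_self] at hz
      · intro hz0 hz1 hz
        simp only [Graph.attach_att_succ, Fin.succ_inj] at hz
        exact ⟨z, fun e => hz0 (e ▸ rfl), fun e => hz1 (e ▸ rfl), hz⟩

/-- With one vertex all old edges are loops, so only the new edge can be contracted, and $hd$ is not
needed. -/
theorem laplaceTerm_of_single_vertex [CharZero K] (Γ : Graph r k 1) :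
    chainBoundary K r k 0 (attachSum K Γ) = laplaceTerm K Γ := by
  have h0 : ∀ a x : Fin k, edgeTerm K (Γ.attach a) x.succ.succ = 0 := fun a x =>
    edgeTerm_of_not_contractible K fun h => h.1 (by
      rw [Graph.attach_flip_succ, Graph.attach_att_succ, Graph.attach_att_succ]
      congr 1
      exact Subsingleton.elim _ _)
  have h2 := two_smul_chainBoundary_attachSum K Γ
  simp only [h0, Finset.sum_const_zero, sub_zero] at h2
  unfold laplaceTerm
  simp only [h0, sub_zero]
  rw [← Finset.smul_sum] at h2
  exact smul_right_injective _ (two_ne_zero (α := K)) h2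

/-- For fixed `a`, contractions of edges off `a` cancel between $dh$ and $hd$. The halves `a` and
`Γ.flip a` remain and give equal terms, matching the factor $2$ from counting edges by halves. -/
theorem laplaceTerm_eq [CharZero K] (Γ : Graph r (k + 2) (m + 2)) :
    chainBoundary K r (k + 2) (m + 1) (attachSum K Γ) +
      attachMap K r k (m + 1) (graphBoundary K Γ) = laplaceTerm K Γ := by
  apply smul_right_injective _ (two_ne_zero (α := K))
  dsimp only
  rw [smul_add, two_smul_chainBoundary_attachSum, ← map_smul, two_smul_graphBoundary, map_sum]
  simp only [attachMap_edgeTerm]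
  rw [Finset.sum_comm (f := fun x a => if a = x ∨ a = Γ.flip x then (0 : Chain K r (k + 2) (m + 2))
    else edgeTerm K (Γ.attach a) x.succ.succ), ← Finset.sum_add_distrib, laplaceTerm,
    Finset.smul_sum]
  refine Finset.sum_congr rfl fun a _ => ?_
  have hne : a ≠ Γ.flip a := (Γ.flip_ne a).symm
  have hsum : ∑ x : Fin (k + 2), edgeTerm K (Γ.attach a) x.succ.succ =
      (∑ x : Fin (k + 2), if a = x ∨ a = Γ.flip x then 0
        else edgeTerm K (Γ.attach a) x.succ.succ) +
      (2 : K) • edgeTerm K (Γ.attach a) a.succ.succ := by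
    have hpair : ∑ x : Fin (k + 2), (if a = x ∨ a = Γ.flip x then
        edgeTerm K (Γ.attach a) x.succ.succ else 0) =
        (2 : K) • edgeTerm K (Γ.attach a) a.succ.succ := by
      rw [← Finset.sum_filter]
      have : Finset.univ.filter (fun x => a = x ∨ a = Γ.flip x) = {a, Γ.flip a} := by
        ext x
        simp only [Finset.mem_filter, Finset.mem_univ, true_and, Finset.mem_insert,
          Finset.mem_singleton]
        constructor
        · rintro (rfl | rfl)
          · exact Or.inl rfl
          · exact Or.inr (Γ.flip_flip x).symm
        · rintro (rfl | rfl)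
          · exact Or.inl rfl
          · exact Or.inr (Γ.flip_flip a).symm
      rw [this, Finset.sum_pair hne, ← Graph.attach_flip_succ, edgeTerm_flip, two_smul]
    rw [← hpair, ← Finset.sum_add_distrib]
    refine Finset.sum_congr rfl fun x _ => ?_
    split_ifs <;> simp
  rw [hsum, smul_sub]
  abel

/-- The chains that the boundary map, if it is defined on them, maps to zero. -/
noncomputable def cycles (r : Bool) : ∀ k m : ℕ, Submodule K (Chain K r k m)
  | k + 2, m + 2 => LinearMap.ker (chainBoundary K r k m)
  | _, _ => ⊤

theorem chainBoundary_mem_cycles [CharZero K] (y : Chain K r (k + 2) (m + 2)) :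
    chainBoundary K r k m y ∈ cycles K r k (m + 1) := by
  rcases k with _ | _ | k
  · trivial
  · trivial
  rcases m with _ | m
  · trivial
  · exact chainBoundary_chainBoundary K y

theorem isEmpty_graph_zero : IsEmpty (Graph r 0 (m + 1)) :=
  ⟨fun Γ => by obtain ⟨x, -⟩ := Γ.att_surj 0; exact x.elim0⟩

theorem isEmpty_graph_one : IsEmpty (Graph r 1 m) :=
  ⟨fun Γ => Γ.flip_ne 0 (Subsingleton.elim _ _)⟩

/-- A uniform operator for all degrees: it is $dh+hd$ where a differential leaves, and $dh$ alone
otherwise. With fewer than two half-edges there are no graphs on which to check its values. -/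
theorem exists_laplace [CharZero K] (r : Bool) (k m : ℕ) :
    ∃ L : Chain K r k (m + 1) →ₗ[K] Chain K r k (m + 1),
      (∀ Γ, L (cls K Γ) = laplaceTerm K Γ) ∧
      ∀ x ∈ cycles K r k (m + 1), chainBoundary K r k m (attachMap K r k (m + 1) x) = L x := by
  rcases k with _ | _ | k
  · exact ⟨chainBoundary K r 0 m ∘ₗ attachMap K r 0 (m + 1),
      fun Γ => isEmpty_graph_zero.elim Γ, fun _ _ => rfl⟩
  · exact ⟨chainBoundary K r 1 m ∘ₗ attachMap K r 1 (m + 1),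
      fun Γ => isEmpty_graph_one.elim Γ, fun _ _ => rfl⟩
  rcases m with _ | m
  · refine ⟨chainBoundary K r (k + 2) 0 ∘ₗ attachMap K r (k + 2) 1, fun Γ => ?_, fun _ _ => rfl⟩
    rw [LinearMap.comp_apply, attachMap_cls]
    exact laplaceTerm_of_single_vertex K Γ
  · refine ⟨chainBoundary K r (k + 2) (m + 1) ∘ₗ attachMap K r (k + 2) (m + 2) +
      attachMap K r k (m + 1) ∘ₗ chainBoundary K r k m, fun Γ => ?_, fun x hx => ?_⟩
    · rw [LinearMap.add_apply, LinearMap.comp_apply, LinearMap.comp_apply, attachMap_cls,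
        chainBoundary_cls]
      exact laplaceTerm_eq K Γ
    · have hx : chainBoundary K r k m x = 0 := hx
      rw [LinearMap.add_apply, LinearMap.comp_apply, LinearMap.comp_apply, hx, map_zero, add_zero]

theorem innerFiltration_mono {n n' : ℕ} (h : n ≤ n') :
    innerFiltration K r k m n ≤ innerFiltration K r k m n' :=
  Submodule.span_mono fun _ ⟨Γ, h1, h2⟩ => ⟨Γ, h1.trans_le h, h2⟩

theorem innerFiltration_zero : innerFiltration K r k m 0 = ⊥ := by
  simp [innerFiltration]

theorem mem_innerFiltration (x : Chain K r k m) : x ∈ innerFiltration K r k m (k + 1) := by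
  induction x using chain_induction with
  | h0 => exact zero_mem _
  | hadd x y hx hy => exact add_mem hx hy
  | hsmul c x hx => exact Submodule.smul_mem _ _ hx
  | hcls Γ =>
    refine Submodule.subset_span ⟨Γ, Nat.lt_succ_of_le ?_, rfl⟩
    exact (Finset.card_le_univ _).trans_eq (Fintype.card_fin k)

theorem laplace_sub_mem {L : Chain K r k (m + 1) →ₗ[K] Chain K r k (m + 1)}
    (hL : ∀ Γ, L (cls K Γ) = laplaceTerm K Γ) {n : ℕ} {x : Chain K r k (m + 1)}
    (hx : x ∈ innerFiltration K r k (m + 1) (n + 1)) :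
    L x - (n : K) • x ∈ innerFiltration K r k (m + 1) n := by
  induction hx using Submodule.span_induction with
  | mem x hx =>
    obtain ⟨Γ, hΓ, rfl⟩ := hx
    have h1 := laplaceTerm_sub_mem K Γ
    rcases (Nat.lt_succ_iff.1 hΓ).eq_or_lt with e | hlt
    · rw [hL, ← e]; exact h1
    · have h2 : cls K Γ ∈ innerFiltration K r k (m + 1) n :=
        Submodule.subset_span ⟨Γ, hlt, rfl⟩
      -- A graph with fewer than `n` inner half-edges already lies in the smaller piece, so
      -- replacing its own eigenvalue by `n` is harmless.
      have h3 := add_mem (innerFiltration_mono K hlt.le h1)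
        (Submodule.smul_mem _ ((Γ.innerCount : K) - n) h2)
      rw [hL]
      convert h3 using 1
      rw [sub_smul]
      abel
  | zero => simp
  | add x y _ _ hx hy =>
    convert add_mem hx hy using 1
    rw [map_add, smul_add]; abel
  | smul c x _ hx =>
    convert Submodule.smul_mem _ c hx using 1
    rw [map_smul, smul_sub, smul_comm]

theorem sub_laplace_mem [CharZero K] {L : Chain K r k (m + 1) →ₗ[K] Chain K r k (m + 1)}
    (hL : ∀ Γ, L (cls K Γ) = laplaceTerm K Γ) {n : ℕ} (hn : n ≠ 0) {x : Chain K r k (m + 1)}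
    (hx : x ∈ innerFiltration K r k (m + 1) (n + 1)) :
    x - (n : K)⁻¹ • L x ∈ innerFiltration K r k (m + 1) n := by
  have h := Submodule.smul_mem _ (-(n : K)⁻¹) (laplace_sub_mem K hL hx)
  have hn' : (n : K) ≠ 0 := Nat.cast_ne_zero.2 hn
  convert h using 1
  rw [smul_sub, smul_smul, neg_mul, inv_mul_cancel₀ hn', neg_smul, neg_smul, one_smul]
  abel

/-- Every cycle is homologous to a combination of graphs without inner edges. -/
theorem exists_sub_chainBoundary_mem [CharZero K] (n : ℕ) :
    ∀ x ∈ cycles K r k (m + 1), x ∈ innerFiltration K r k (m + 1) n →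
      ∃ y, x - chainBoundary K r k m y ∈ innerFiltration K r k (m + 1) 1 := by
  induction n with
  | zero => exact fun x _ h => ⟨0, by simpa using innerFiltration_mono K zero_le_one h⟩
  | succ n ih =>
    intro x hx hxn
    rcases eq_or_ne n 0 with rfl | hn
    · exact ⟨0, by simpa using hxn⟩
    obtain ⟨L, hL, hL'⟩ := exists_laplace K r k m
    -- On a cycle the Laplacian is $dh$, so subtracting its multiple by $n^{-1}$ keeps the homology
    -- class and removes the top piece of the filtration.
    have hz := sub_laplace_mem K hL hn hxn
    rw [← hL' x hx, ← map_smul] at hz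
    obtain ⟨y, hy⟩ := ih _ (sub_mem hx (chainBoundary_mem_cycles K _)) hz
    refine ⟨(n : K)⁻¹ • attachMap K r k (m + 1) x + y, ?_⟩
    rwa [map_add, ← sub_sub]

/-- A boundary that is a combination of graphs without inner edges vanishes. -/
theorem chainBoundary_eq_zero_of_mem [CharZero K]
    (hd : ∀ x ∈ innerFiltration K r (k + 2) (m + 2) 1, chainBoundary K r k m x = 0) (n : ℕ) :
    ∀ y ∈ innerFiltration K r (k + 2) (m + 2) n,
      chainBoundary K r k m y ∈ innerFiltration K r k (m + 1) 1 →
      chainBoundary K r k m y = 0 := by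
  induction n with
  | zero => exact fun y hy _ => hd y (innerFiltration_mono K zero_le_one hy)
  | succ n ih =>
    intro y hy hdy
    rcases eq_or_ne n 0 with rfl | hn
    · exact hd y hy
    obtain ⟨L, hL, hL'⟩ := exists_laplace K r k m
    -- `M` is the Laplacian in the degree of `y`, and `L` the one in the degree of its boundary.
    set M : Chain K r (k + 2) (m + 2) →ₗ[K] Chain K r (k + 2) (m + 2) :=
      chainBoundary K r (k + 2) (m + 1) ∘ₗ attachMap K r (k + 2) (m + 2) +
        attachMap K r k (m + 1) ∘ₗ chainBoundary K r k m with hM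
    have hM' : ∀ Γ, M (cls K Γ) = laplaceTerm K Γ := fun Γ => by
      rw [hM, LinearMap.add_apply, LinearMap.comp_apply, LinearMap.comp_apply, attachMap_cls,
        chainBoundary_cls]
      exact laplaceTerm_eq K Γ
    -- Without inner half-edges the eigenvalue is $0$, and the next lower piece of the filtration is
    -- zero.
    have h0 : L (chainBoundary K r k m y) = 0 := by
      have := laplace_sub_mem K hL (n := 0) hdy
      rw [innerFiltration_zero, Submodule.mem_bot] at this
      simpa using this
    -- By $d^2=0$, $dMy=dh\,dy=L\,dy$. Hence subtracting $n^{-1}My$ from `y` lowers the filtration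
    -- and leaves $dy$ unchanged.
    have h1 : chainBoundary K r k m (M y) = 0 := by
      rw [hM, LinearMap.add_apply, map_add, LinearMap.comp_apply, LinearMap.comp_apply,
        chainBoundary_chainBoundary, zero_add, hL' _ (chainBoundary_mem_cycles K y), h0]
    have h2 : chainBoundary K r k m (y - (n : K)⁻¹ • M y) = chainBoundary K r k m y := by
      rw [map_sub, map_smul, h1, smul_zero, sub_zero]
    rw [← h2]
    exact ih _ (sub_laplace_mem K hM' hn hy) (h2.symm ▸ hdy)

/-! ### Homology from the graphs without inner edges. -/

section Homology

variable (P : ∀ {k m : ℕ}, Graph r k m → Prop)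

/-- The homology is the space spanned by a class of graphs without inner edges, if
this class is large enough and consists of cycles. -/
theorem bijective_toHomology [CharZero K]
    (h1 : ∀ {k m} (Γ : Graph r k m), P Γ → Γ.innerCount = 0)
    (h2 : ∀ {k m} (Γ : Graph r k m), Γ.innerCount = 0 → P Γ ∨ cls K Γ = 0)
    (h3 : ∀ {k m} (Γ : Graph r (k + 2) (m + 2)), P Γ → graphBoundary K Γ = 0) :
    ∃ hS : formalSpan K r P ≤ LinearMap.ker (boundary K r),
      Function.Bijective (toHomology K hS) := by
  have hspan : ∀ k m, Submodule.span K {y | ∃ Γ : Graph r k m, P Γ ∧ y = cls K Γ} =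
      innerFiltration K r k m 1 := by
    intro k m
    refine le_antisymm (Submodule.span_mono fun y ⟨Γ, hΓ, e⟩ => ⟨Γ, ?_, e⟩)
      (Submodule.span_le.2 ?_)
    · rw [h1 Γ hΓ]; exact zero_lt_one
    · rintro y ⟨Γ, hΓ, rfl⟩
      rcases h2 Γ (Nat.lt_one_iff.1 hΓ) with h | h
      · exact Submodule.subset_span ⟨Γ, h, rfl⟩
      · rw [h]; exact zero_mem _
  have hd : ∀ {k m} (x) (_ : x ∈ innerFiltration K r (k + 2) (m + 2) 1),
      chainBoundary K r k m x = 0 := by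
    intro k m x hx
    rw [← hspan] at hx
    induction hx using Submodule.span_induction with
    | mem x hx =>
      obtain ⟨Γ, hΓ, rfl⟩ := hx
      rw [chainBoundary_cls, h3 Γ hΓ]
    | zero => exact map_zero _
    | add x y _ _ hx hy => rw [map_add, hx, hy, add_zero]
    | smul c x _ hx => rw [map_smul, hx, smul_zero]
  have hS : formalSpan K r P ≤ LinearMap.ker (boundary K r) := by
    intro x hx
    rw [LinearMap.mem_ker]
    funext k m
    rcases m with _ | m
    · rfl
    · exact hd _ (hspan _ _ ▸ hx (k + 2) (m + 2))
  refine ⟨hS, ?_, ?_⟩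
  · rw [injective_iff_map_eq_zero]
    rintro ⟨s, hs⟩ h0
    have : Submodule.inclusion hS ⟨s, hs⟩ ∈ (LinearMap.range (boundary K r)).submoduleOf
        (LinearMap.ker (boundary K r)) := (Submodule.Quotient.mk_eq_zero _).1 h0
    obtain ⟨y, hy⟩ : ∃ y, boundary K r y = s := this
    rw [Submodule.mk_eq_zero]
    subst hy
    funext k m
    rcases m with _ | m
    · rfl
    · exact chainBoundary_eq_zero_of_mem K hd _ (y (k + 2) (m + 2)) (mem_innerFiltration K _)
        (hspan k (m + 1) ▸ hs k (m + 1))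
  · intro z
    obtain ⟨⟨x, hx⟩, rfl⟩ := Submodule.mkQ_surjective _ z
    have hcyc : ∀ k m, x k m ∈ cycles K r k m := by
      intro k m
      rcases k with _ | _ | k
      · trivial
      · trivial
      rcases m with _ | _ | m
      · trivial
      · trivial
      · exact congrFun (congrFun hx k) (m + 1)
    have hex : ∀ k m, ∃ y, x k (m + 1) - chainBoundary K r k m y ∈
        innerFiltration K r k (m + 1) 1 := fun k m =>
      exists_sub_chainBoundary_mem K _ _ (hcyc k (m + 1)) (mem_innerFiltration K _)
    choose Y hY using hex
    -- The primitives are chosen independently in each degree, since infinite combinations are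
    -- allowed. The components set to $0$ never enter `boundary`.
    let y : FormalChain K r := fun k m => match k, m with
      | k + 2, m + 2 => Y k m
      | _, _ => 0
    have hmem : x - boundary K r y ∈ formalSpan K r P := by
      intro k m
      rw [hspan]
      rcases m with _ | m
      -- No boundary lands on graphs without vertices, but these have no half-edges and so trivially
      -- no inner ones.
      · have h0 : ∀ Γ : Graph r k 0, Γ.innerCount = 0 := fun Γ => by
          exact Finset.card_eq_zero.2
            (Finset.eq_empty_of_forall_notMem fun a _ => (Γ.att a).elim0)
        induction (x - boundary K r y) k 0 using chain_induction with
        | h0 => exact zero_mem _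
        | hadd x y hx hy => exact add_mem hx hy
        | hsmul c x hx => exact Submodule.smul_mem _ _ hx
        | hcls Γ => exact Submodule.subset_span ⟨Γ, by rw [h0]; exact zero_lt_one, rfl⟩
      · exact hY k m
    refine ⟨⟨x - boundary K r y, hmem⟩, ?_⟩
    refine (Submodule.Quotient.eq _).2 ?_
    refine ⟨-y, ?_⟩
    rw [map_neg]
    simp [sub_eq_add_neg]

end Homology

end GraphCx

/-! ### Automorphisms of stars and the surviving graphs. -/

namespace GraphCx

open Equiv

variable {r : Bool} {k m : ℕ}

namespace Graph

theorem accompanied_iff {Γ : Graph r k m} {a : Fin k} :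
    Γ.Accompanied a ↔ Γ.valence (Γ.att a) ≠ 1 := by
  rw [← not_iff_not, not_not, valence, Finset.card_eq_one]
  constructor
  · intro h
    refine ⟨a, Finset.ext fun b => ?_⟩
    simp only [Finset.mem_filter, Finset.mem_univ, true_and, Finset.mem_singleton]
    exact ⟨fun hb => by_contra fun hne => h ⟨b, hne, hb⟩, fun hb => hb ▸ rfl⟩
  · rintro ⟨c, hc⟩ ⟨b, hne, hb⟩
    have h1 : a ∈ ({c} : Finset (Fin k)) := hc ▸ by simp
    have h2 : b ∈ ({c} : Finset (Fin k)) := hc ▸ by simp [hb]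
    rw [Finset.mem_singleton] at h1 h2
    exact hne (h2.trans h1.symm)

theorem innerCount_eq_zero {Γ : Graph r k m} : Γ.innerCount = 0 ↔ ∀ a, ¬ Γ.Inner a := by
  simp [innerCount, Finset.filter_eq_empty_iff]

theorem att_rot (Γ : Graph r k m) (hr : r = true) (x : Fin k) : Γ.att (Γ.rot hr x) = Γ.att x :=
  (Γ.rot_cycle hr _ _).1 (by rw [Perm.sameCycle_apply_left])

/-- Permuting the edges at a vertex all of whose neighbours are univalent is an automorphism. -/
theorem exists_automorphism (Γ : Graph r k m) {v : Fin m}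
    (hv : ∀ a, Γ.att a = v → ¬ Γ.Accompanied (Γ.flip a)) (π : Perm {a // Γ.att a = v})
    (hπ : ∀ (hr : r = true) (a : {a // Γ.att a = v}),
      Γ.rot hr (π a) = π ⟨Γ.rot hr a, (Γ.att_rot hr a).trans a.2⟩) :
    ∃ g : Reord k m, Γ.relabel g = Γ ∧ g.sgn = Perm.sign π := by
  have uniq : ∀ a, Γ.att a = v → ∀ b, Γ.att b = Γ.att (Γ.flip a) → b = Γ.flip a :=
    fun a ha b hb => by_contra fun hne => hv a ha ⟨b, hne, hb⟩
  have nv : ∀ a, Γ.att a = v → Γ.att (Γ.flip a) ≠ v := fun a ha e =>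
    Γ.flip_ne a (uniq a ha a (ha.trans e.symm)).symm
  let i : {a // Γ.att a = v} ↪ Fin k := ⟨Subtype.val, Subtype.val_injective⟩
  let e : {a // Γ.att a = v} ↪ Fin k :=
    ⟨fun a => Γ.flip a, fun a b h => Subtype.ext (Γ.flip.injective h)⟩
  let f : {a // Γ.att a = v} ↪ Fin m :=
    ⟨fun a => Γ.att (Γ.flip a), fun a b h => Subtype.ext (Γ.flip.injective (uniq b b.2 _ h))⟩
  have mi : ∀ x, x ∈ Set.range i ↔ Γ.att x = v := fun x =>
    ⟨by rintro ⟨a, rfl⟩; exact a.2, fun h => ⟨⟨x, h⟩, rfl⟩⟩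
  have me : ∀ x, x ∈ Set.range e ↔ Γ.att (Γ.flip x) = v := fun x =>
    ⟨by rintro ⟨a, rfl⟩; exact (congrArg Γ.att (Γ.flip_flip a)).trans a.2,
      fun h => ⟨⟨Γ.flip x, h⟩, Γ.flip_flip x⟩⟩
  -- `π` acts three times: on the halves at `v`, on the opposite halves and on the leaves. Two of
  -- the three signs cancel.
  set g : Reord k m := (π.viaFintypeEmbedding i * π.viaFintypeEmbedding e,
    π.viaFintypeEmbedding f) with hg
  have G1 : ∀ a : {a // Γ.att a = v}, g.1 a = π a := fun a => by
    have h1 : π.viaFintypeEmbedding e a = a :=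
      Perm.viaFintypeEmbedding_apply_notMem_range _ _ (by rw [me]; exact nv a a.2)
    rw [hg, Perm.mul_apply, h1]
    exact Perm.viaFintypeEmbedding_apply_image π i a
  have G2 : ∀ a : {a // Γ.att a = v}, g.1 (Γ.flip a) = Γ.flip (π a) := fun a => by
    have h1 : π.viaFintypeEmbedding e (Γ.flip a) = Γ.flip (π a) :=
      Perm.viaFintypeEmbedding_apply_image π e a
    rw [hg, Perm.mul_apply, h1]
    exact Perm.viaFintypeEmbedding_apply_notMem_range _ _ (by rw [mi]; exact nv _ (π a).2)
  have G3 : ∀ x, Γ.att x ≠ v → Γ.att (Γ.flip x) ≠ v → g.1 x = x := fun x h1 h2 => by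
    have h3 : π.viaFintypeEmbedding e x = x :=
      Perm.viaFintypeEmbedding_apply_notMem_range _ _ (by rwa [me])
    rw [hg, Perm.mul_apply, h3]
    exact Perm.viaFintypeEmbedding_apply_notMem_range _ _ (by rwa [mi])
  have V1 : ∀ a : {a // Γ.att a = v}, g.2 (Γ.att (Γ.flip a)) = Γ.att (Γ.flip (π a)) :=
    fun a => Perm.viaFintypeEmbedding_apply_image π f a
  have V2 : ∀ w, (∀ a, Γ.att a = v → w ≠ Γ.att (Γ.flip a)) → g.2 w = w := fun w hw =>
    Perm.viaFintypeEmbedding_apply_notMem_range _ _ (by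
      rintro ⟨a, ha⟩; exact hw a a.2 ha.symm)
  have cases3 : ∀ {p : Fin k → Prop}, (∀ a : {a // Γ.att a = v}, p a) →
      (∀ a : {a // Γ.att a = v}, p (Γ.flip a)) →
      (∀ x, Γ.att x ≠ v → Γ.att (Γ.flip x) ≠ v → p x) → ∀ x, p x := by
    intro p h1 h2 h3 x
    by_cases e1 : Γ.att x = v
    · exact h1 ⟨x, e1⟩
    by_cases e2 : Γ.att (Γ.flip x) = v
    · have := h2 ⟨_, e2⟩
      rwa [Γ.flip_flip] at this
    exact h3 x e1 e2
  refine ⟨g, ?_, ?_⟩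
  · symm
    refine eq_relabel ?_ ?_ fun hr => ?_
    · refine cases3 (fun a => ?_) (fun a => ?_) fun x h1 h2 => ?_
      · rw [G1, (π a).2, a.2, V2]
        exact fun b hb e => nv b hb e.symm
      · rw [G2, V1]
      · rw [G3 x h1 h2, V2]
        intro a ha e
        have := uniq a ha x e
        rw [this, Γ.flip_flip] at h2
        exact h2 ha
    · refine cases3 (fun a => ?_) (fun a => ?_) fun x h1 h2 => ?_
      · rw [G1, G2]
      · rw [G2, Γ.flip_flip, Γ.flip_flip, G1]
      · rw [G3 x h1 h2, G3 _ h2 (by rwa [Γ.flip_flip])]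
    · have rf : ∀ a, Γ.att a = v → Γ.rot hr (Γ.flip a) = Γ.flip a := fun a ha =>
        uniq a ha _ (Γ.att_rot hr _)
      refine cases3 (fun a => ?_) (fun a => ?_) fun x h1 h2 => ?_
      · rw [G1, hπ]
        exact (G1 ⟨Γ.rot hr a, (Γ.att_rot hr a).trans a.2⟩).symm
      · rw [G2, rf a a.2, G2, rf _ (π a).2]
      · rw [G3 x h1 h2, G3 _ ((Γ.att_rot hr x).trans_ne h1)]
        intro e
        have h4 := rf _ e
        rw [Γ.flip_flip] at h4
        have := (Γ.rot hr).injective h4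
        rw [this] at e
        exact h2 e
  · rw [hg, Reord.sgn, Perm.sign_mul, Perm.viaFintypeEmbedding_sign,
      Perm.viaFintypeEmbedding_sign, Perm.viaFintypeEmbedding_sign, Int.units_mul_self, one_mul]

end Graph

variable (K : Type*) [Field K] [CharZero K]

theorem cls_eq_zero_of_odd_automorphism {Γ : Graph r k m} {g : Reord k m} (hg : Γ.relabel g = Γ)
    (hs : g.sgn = -1) : cls K Γ = 0 := by
  have h := cls_relabel K g Γ
  rw [hg, hs, Units.neg_smul, one_smul, eq_neg_iff_add_eq_zero, ← two_smul K] at h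
  have two : (2 : K) ≠ 0 := two_ne_zero
  simpa [smul_eq_zero, two] using h

/-- Turning the star by one step is an automorphism, and a cycle of even length is an odd
permutation. -/
theorem cls_eq_zero_of_even_star {Γ : Graph true k m} {v : Fin m}
    (hv : ∀ a, Γ.att a = v → ¬ Γ.Accompanied (Γ.flip a)) (he : Even (Γ.valence v)) :
    cls K Γ = 0 := by
  have hcard : Fintype.card {a // Γ.att a = v} = Γ.valence v := Fintype.card_subtype _
  set π : Perm {a // Γ.att a = v} := (Γ.rot rfl).subtypePerm fun x => by rw [Γ.att_rot] with hπ
  obtain ⟨g, hg, hs⟩ := Γ.exists_automorphism hv π fun _ a => rfl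
  refine cls_eq_zero_of_odd_automorphism K hg (hs.trans ?_)
  have hsc : ∀ x y, π.SameCycle x y := fun x y => by
    rw [hπ, Perm.sameCycle_subtypePerm, Γ.rot_cycle, x.2, y.2]
  obtain ⟨a, ha⟩ := Γ.att_surj v
  have hpos : 0 < Γ.valence v := Finset.card_pos.2 ⟨a, by simp [ha]⟩
  have h2 : 1 < Fintype.card {a // Γ.att a = v} := by
    rw [hcard]
    obtain ⟨c, hc⟩ := he
    omega
  have hmove : ∀ x, π x ≠ x := by
    intro x hx
    obtain ⟨y, hy⟩ := Fintype.exists_ne_of_one_lt_card h2 x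
    exact hy ((sameCycle_of_fixed hx).1 (hsc x y)).symm
  have hcyc : π.IsCycle := ⟨⟨a, ha⟩, hmove _, fun y _ => hsc _ y⟩
  have hsupp : π.support = Finset.univ := Finset.eq_univ_iff_forall.2 fun x => by
    simpa using hmove x
  rw [hcyc.sign, hsupp, Finset.card_univ, hcard, he.neg_one_pow]

/-- With no cyclic order to respect, exchanging two rays is an odd automorphism. -/
theorem cls_eq_zero_of_multiple_star {Γ : Graph false k m} {v : Fin m}
    (hv : ∀ a, Γ.att a = v → ¬ Γ.Accompanied (Γ.flip a)) (hne : Γ.valence v ≠ 1) :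
    cls K Γ = 0 := by
  obtain ⟨a, rfl⟩ := Γ.att_surj v
  obtain ⟨b, hb, hba⟩ := Graph.accompanied_iff.2 hne
  obtain ⟨g, hg, hs⟩ := Γ.exists_automorphism hv (swap ⟨a, rfl⟩ ⟨b, hba⟩)
    fun h => by simp at h
  refine cls_eq_zero_of_odd_automorphism K hg (hs.trans (Perm.sign_swap ?_))
  exact fun e => hb (Subtype.ext_iff.1 e).symm

namespace Graph

theorem not_accompanied_flip {Γ : Graph r k m} (h : Γ.innerCount = 0) {v : Fin m}
    (hv : Γ.valence v ≠ 1) (a : Fin k) (ha : Γ.att a = v) : ¬ Γ.Accompanied (Γ.flip a) :=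
  fun h' => innerCount_eq_zero.1 h a ⟨accompanied_iff.2 (by rwa [ha]), h'⟩

/-- A path leaving `v` arrives at a univalent vertex, from which it can only return. -/
theorem Connected.eq_or_of_star {Γ : Graph r k m} {v w : Fin m} (hvw : Γ.Connected v w)
    (hv : ∀ a, Γ.att a = v → ¬ Γ.Accompanied (Γ.flip a)) :
    w = v ∨ ∃ a, Γ.att a = v ∧ Γ.att (Γ.flip a) = w := by
  induction hvw with
  | refl => exact Or.inl rfl
  | tail _ h ih =>
    obtain ⟨b, rfl, rfl⟩ := h
    rcases ih with h | ⟨a, ha, hab⟩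
    · exact Or.inr ⟨b, h, rfl⟩
    · have : b = Γ.flip a := by_contra fun hne => hv a ha ⟨b, hne, hab.symm⟩
      rw [this, Γ.flip_flip]
      exact Or.inl ha

theorem IsUnionOfOddStars.innerCount {Γ : Graph r k m} (h : Γ.IsUnionOfOddStars) :
    Γ.innerCount = 0 := by
  refine innerCount_eq_zero.2 fun a ⟨h1, h2⟩ => h.1 a ?_
  exact h.2.1 _ _ (Relation.ReflTransGen.single ⟨a, rfl, rfl⟩) (accompanied_iff.1 h1)
    (accompanied_iff.1 h2)

theorem isUnionOfOddStars_of {Γ : Graph r k m} (h : Γ.innerCount = 0)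
    (hodd : ∀ v, Γ.valence v ≠ 1 → Odd (Γ.valence v)) : Γ.IsUnionOfOddStars := by
  refine ⟨fun a e => ?_, fun v w hvw hv hw => ?_, hodd⟩
  · exact innerCount_eq_zero.1 h a ⟨⟨Γ.flip a, Γ.flip_ne a, e.symm⟩, ⟨a, (Γ.flip_ne a).symm, e⟩⟩
  · rcases hvw.eq_or_of_star (not_accompanied_flip h hv) with h1 | ⟨a, ha, rfl⟩
    · exact h1.symm
    · exact absurd (accompanied_iff.2 hw) (not_accompanied_flip h hv a ha)

/-- `att` maps the half-edges of a component onto its vertices. Both sets have two elements, so the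
map is injective. -/
theorem IsUnionOfSingleEdges.not_accompanied {Γ : Graph r k m} (h : Γ.IsUnionOfSingleEdges)
    (a : Fin k) : ¬ Γ.Accompanied a := by
  rintro ⟨b, hb, hba⟩
  obtain ⟨h1, h2⟩ := h (Γ.att a)
  have hinj : ∀ x ∈ {h | Γ.Connected (Γ.att a) (Γ.att h)},
      ∀ y ∈ {h | Γ.Connected (Γ.att a) (Γ.att h)}, Γ.att x = Γ.att y → x = y := by
    intro x hx y hy e
    refine Set.inj_on_of_surj_on_of_ncard_le (s := {h | Γ.Connected (Γ.att a) (Γ.att h)})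
      (t := {w | Γ.Connected (Γ.att a) w}) (fun x _ => Γ.att x) (fun x hx => hx) ?_
      (h2.trans h1.symm).le hx hy e
    intro w hw
    obtain ⟨x, rfl⟩ := Γ.att_surj w
    exact ⟨x, hw, rfl⟩
  exact hb (hinj b (by rw [Set.mem_ofPred_eq, hba]; exact .refl) a .refl hba)

theorem isUnionOfSingleEdges_of {Γ : Graph r k m} (h : ∀ a, ¬ Γ.Accompanied a) :
    Γ.IsUnionOfSingleEdges := by
  have inj : ∀ a b, Γ.att a = Γ.att b → a = b := fun a b e =>
    by_contra fun hne => h b ⟨a, hne, e⟩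
  intro v
  obtain ⟨a, rfl⟩ := Γ.att_surj v
  have hc : ∀ w, Γ.Connected (Γ.att a) w ↔ w = Γ.att a ∨ w = Γ.att (Γ.flip a) := by
    intro w
    constructor
    · intro hw
      rcases hw.eq_or_of_star (fun b _ => h _) with h1 | ⟨b, hb, rfl⟩
      · exact Or.inl h1
      · rw [inj b a hb]; exact Or.inr rfl
    · rintro (rfl | rfl)
      · exact .refl
      · exact .single ⟨a, rfl, rfl⟩
  have hne := (Γ.flip_ne a).symm
  constructor
  · have : {w | Γ.Connected (Γ.att a) w} = {Γ.att a, Γ.att (Γ.flip a)} := Set.ext hc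
    rw [this, Set.ncard_pair fun e => hne (inj _ _ e)]
  · have : {b | Γ.Connected (Γ.att a) (Γ.att b)} = {a, Γ.flip a} := by
      ext b
      refine (hc _).trans ?_
      constructor
      · exact Or.imp (inj _ _) (inj _ _)
      · rintro (rfl | rfl)
        · exact Or.inl rfl
        · exact Or.inr rfl
    rw [this, Set.ncard_pair hne]

end Graph

theorem isUnionOfOddStars_or_cls_eq_zero {Γ : Graph true k m} (h : Γ.innerCount = 0) :
    Γ.IsUnionOfOddStars ∨ cls K Γ = 0 := by
  by_cases hodd : ∀ v, Γ.valence v ≠ 1 → Odd (Γ.valence v)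
  · exact Or.inl (Graph.isUnionOfOddStars_of h hodd)
  · push Not at hodd
    obtain ⟨v, hv, he⟩ := hodd
    exact Or.inr (cls_eq_zero_of_even_star K (Graph.not_accompanied_flip h hv)
      (Nat.not_odd_iff_even.1 he))

theorem isUnionOfSingleEdges_or_cls_eq_zero {Γ : Graph false k m} (h : Γ.innerCount = 0) :
    Γ.IsUnionOfSingleEdges ∨ cls K Γ = 0 := by
  by_cases h1 : ∀ a, ¬ Γ.Accompanied a
  · exact Or.inl (Graph.isUnionOfSingleEdges_of h1)
  · push Not at h1
    obtain ⟨a, ha⟩ := h1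
    have hv := Graph.accompanied_iff.1 ha
    exact Or.inr (cls_eq_zero_of_multiple_star K (Graph.not_accompanied_flip h hv) hv)

/-- The univalent end brings no further half-edges to the merged vertex, which only loses the
contracted half. -/
theorem IsContraction.valence_of_univalent {Γ : Graph r (k + 2) (m + 2)} {Δ : Graph r k (m + 1)}
    {g : Reord (k + 2) (m + 2)} (h : IsContraction Γ Δ g) (hu : ¬ Γ.Accompanied (g.1 1)) :
    ∃ w, Γ.valence (Γ.att (g.1 0)) = Δ.valence w + 1 := by
  obtain ⟨v, hv⟩ := g.2.surjective (Γ.att (g.1 0))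
  have hv0 : v ≠ 0 := by
    rintro rfl
    rw [h.vert] at hv
    exact h.ne hv.symm
  obtain ⟨w, rfl⟩ := Fin.exists_succ_eq.2 hv0
  refine ⟨w, ?_⟩
  have hne : ∀ x : Fin k, Γ.att (g.1 x.succ.succ) ≠ Γ.att (g.1 1) := fun x e =>
    hu ⟨_, (perm_succ_succ_ne g.1 x).2, e⟩
  have hw : ∀ x : Fin k, Δ.att x = w ↔ Γ.att (g.1 x.succ.succ) = Γ.att (g.1 0) := fun x => by
    rw [← h.att_of_ne x (hne x), ← hv, g.2.injective.eq_iff, Fin.succ_inj]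
  have hset : (Finset.univ.filter fun y => Γ.att y = Γ.att (g.1 0)) =
      insert (g.1 0) ((Finset.univ.filter fun x => Δ.att x = w).map
        ⟨_, perm_succ_succ_injective g.1⟩) := by
    ext y
    simp only [Finset.mem_filter, Finset.mem_univ, true_and, Finset.mem_insert, Finset.mem_map,
      Function.Embedding.coeFn_mk, hw]
    constructor
    · intro hy
      by_cases e : y = g.1 0
      · exact Or.inl e
      · have e1 : y ≠ g.1 1 := by rintro rfl; exact h.ne hy.symm
        obtain ⟨x, rfl⟩ := exists_perm_succ_succ e e1
        exact Or.inr ⟨x, hy, rfl⟩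
    · rintro (rfl | ⟨x, hx, rfl⟩)
      · rfl
      · exact hx
  unfold Graph.valence
  rw [hset, Finset.card_insert_of_notMem, Finset.card_map]
  simp only [Finset.mem_map, Function.Embedding.coeFn_mk, not_exists, not_and]
  exact fun x _ e => (perm_succ_succ_ne g.1 x).1 e

/-- A contractible edge has an end of odd valence at least three. Contracting it leaves a union of
stars in which one centre has even valence, and the class of such a graph is zero. -/
theorem graphBoundary_of_oddStars {Γ : Graph true (k + 2) (m + 2)} (hΓ : Γ.IsUnionOfOddStars) :
    graphBoundary K Γ = 0 := by
  have key : ∀ h, Γ.Contractible h → Γ.Accompanied h → edgeTerm K Γ h = 0 := by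
    intro h hc ha
    obtain ⟨g, hg, rfl⟩ := exists_lists Γ hc.1
    obtain ⟨Δ, hΔ⟩ := exists_isContraction Γ hg hc
    have hv := Graph.accompanied_iff.1 ha
    have hu := Graph.not_accompanied_flip hΓ.innerCount hv _ rfl
    rw [hg.flip_zero] at hu
    obtain ⟨w, hw⟩ := hΔ.valence_of_univalent hu
    have hodd := hΓ.2.2 _ hv
    rw [hw, Nat.odd_add_one, Nat.not_odd_iff_even] at hodd
    have h0 : Δ.innerCount = 0 := Nat.le_zero.1 (hΓ.innerCount ▸ hΔ.innerCount_le)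
    rw [edgeTerm_of_isContraction K hΔ]
    rcases isUnionOfOddStars_or_cls_eq_zero K h0 with h1 | h1
    -- An even valence is not one, so `w` would have to have odd valence in a union of odd stars.
    · refine absurd (h1.2.2 w ?_) (Nat.not_odd_iff_even.2 hodd)
      intro e
      rw [e] at hodd
      exact absurd hodd (by decide)
    · rw [h1, smul_zero, neg_zero]
  refine Finset.sum_eq_zero fun h _ => ?_
  by_cases hc : Γ.Contractible h
  · obtain ⟨-, x, h0, h1, hx | hx⟩ := id hc
    · exact key h hc ⟨x, h0, hx⟩
    · rw [← edgeTerm_flip]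
      exact key _ hc.flip ⟨x, h1, hx⟩
  · exact edgeTerm_of_not_contractible K hc

theorem graphBoundary_of_singleEdges (K : Type*) [Field K] {Γ : Graph r (k + 2) (m + 2)}
    (hΓ : Γ.IsUnionOfSingleEdges) : graphBoundary K Γ = 0 := by
  refine Finset.sum_eq_zero fun h _ => edgeTerm_of_not_contractible K fun hc => ?_
  obtain ⟨-, x, h0, h1, hx | hx⟩ := hc
  · exact hΓ.not_accompanied _ ⟨x, h0, hx⟩
  · exact hΓ.not_accompanied _ ⟨x, h1, hx⟩

end GraphCx

/-! ### Non-vanishing: signs of automorphisms. -/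

namespace GraphCx

open Equiv

variable {r : Bool} {k m : ℕ}

section NonVanishing

variable (K : Type*) [Field K]

open Classical in
/-- The sum of the signs of the isomorphisms from `Γ` to `Γ'`. -/
noncomputable def signedIso (Γ Γ' : Graph r k m) : K :=
  ∑ g : Reord k m, if Γ.relabel g = Γ' then ((g.sgn : ℤ) : K) else 0

theorem signedIso_relabel (Γ Γ' : Graph r k m) (u : Reord k m) :
    signedIso K Γ (Γ'.relabel u) = ((u.sgn : ℤ) : K) * signedIso K Γ Γ' := by
  unfold signedIso
  rw [Finset.mul_sum, ← Equiv.sum_comp (Equiv.mulLeft u)]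
  refine Finset.sum_congr rfl fun g _ => ?_
  have h : Γ.relabel (u * g) = Γ'.relabel u ↔ Γ.relabel g = Γ' := by
    rw [← Graph.relabel_relabel]
    constructor
    · intro h
      have := congrArg (Graph.relabel u⁻¹) h
      simpa only [Graph.relabel_relabel, inv_mul_cancel, inv_mul_cancel_left,
        Graph.relabel_one] using this
    · rintro rfl; rfl
  rw [Equiv.coe_mulLeft]
  by_cases e : Γ.relabel g = Γ'
  · rw [if_pos (h.2 e), if_pos e, Reord.sgn_mul]; simp
  · rw [if_neg (mt h.1 e), if_neg e, mul_zero]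

/-- The signed count of isomorphisms from `Γ` respects the orientation relations, hence is a
functional on the quotient. At `Γ` it is the number of automorphisms, which is nonzero in
characteristic zero. -/
theorem cls_ne_zero_of_even_automorphisms [CharZero K] (Γ : Graph r k m)
    (h : ∀ g, Γ.relabel g = Γ → g.sgn = 1) : cls K Γ ≠ 0 := by
  classical
  have hle : orientationRel K r k m ≤
      LinearMap.ker (Finsupp.linearCombination K (signedIso K Γ)) := by
    rw [orientationRel, Submodule.span_le]
    rintro _ ⟨u, Γ', rfl⟩
    rw [SetLike.mem_coe, LinearMap.mem_ker]
    rcases Int.units_eq_one_or u.sgn with e | e <;>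
      simp [e, signedIso_relabel]
  intro h0
  have h1 : Finsupp.single Γ (1 : K) ∈ orientationRel K r k m :=
    (Submodule.Quotient.mk_eq_zero _).1 h0
  have h2 := hle h1
  rw [LinearMap.mem_ker, Finsupp.linearCombination_single, one_smul, signedIso] at h2
  have h3 : ∀ g : Reord k m, (if Γ.relabel g = Γ then ((g.sgn : ℤ) : K) else 0) =
      if Γ.relabel g = Γ then 1 else 0 := fun g => by
    split_ifs with e
    · rw [h g e]; simp
    · rfl
  simp only [h3] at h2
  rw [Finset.sum_boole, Nat.cast_eq_zero, Finset.card_eq_zero] at h2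
  have : (1 : Reord k m) ∈ (Finset.univ.filter fun g : Reord k m => Γ.relabel g = Γ) := by
    simp [Graph.relabel_one]
  rw [h2] at this
  simp at this

end NonVanishing

section Sign

variable {B C : Type*} [Fintype B] [DecidableEq B] [Fintype C] [DecidableEq C]
  {p : C → B} {ρ : Perm C}

/-- On a cycle of `ρ` that it preserves, a permutation commuting with `ρ` is a power of `ρ`. So the
power of `σ` by the odd product of the cycle lengths is $1$. -/
theorem sign_eq_one_of_fibrewise (hρ : ∀ x y, ρ.SameCycle x y ↔ p x = p y)
    (hodd : ∀ b, Odd (Finset.card {x | p x = b})) {σ : Perm C} (hσ : ∀ x, p (σ x) = p x)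
    (hc : Commute σ ρ) : Perm.sign σ = 1 := by
  set n := ∏ b, Finset.card {x | p x = b} with hn
  have hn_odd : Odd n := Finset.prod_induction _ Odd (fun _ _ => Odd.mul) odd_one fun b _ => hodd b
  have hρn : ∀ x, (ρ ^ n) x = x := by
    intro x
    have hcyc : ρ.IsCycleOn ({y | p y = p x} : Finset C) := by
      refine ⟨⟨?_, ρ.injective.injOn, ?_⟩, ?_⟩
      · intro y hy
        have hy : p y = p x := by simpa using hy
        have : p (ρ y) = p y := (hρ _ _).1 (by rw [Perm.sameCycle_apply_left])
        simpa using this.trans hy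
      · intro y hy
        have hy : p y = p x := by simpa using hy
        refine ⟨ρ⁻¹ y, ?_, apply_inv_self' ρ y⟩
        have : p (ρ⁻¹ y) = p y := (hρ _ _).1 ⟨1, by rw [zpow_one, apply_inv_self']⟩
        simpa using this.trans hy
      · intro y hy z hz
        have hy : p y = p x := by simpa using hy
        have hz : p z = p x := by simpa using hz
        exact (hρ _ _).2 (hy.trans hz.symm)
    exact (hcyc.pow_apply_eq (by simp)).2 (Finset.dvd_prod_of_mem _ (Finset.mem_univ (p x)))
  have hσn : σ ^ n = 1 := by
    ext1 x
    obtain ⟨j, hj⟩ := (hρ x (σ x)).2 (hσ x).symm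
    -- This product fixes `x`, so its `n`-th power does too; that power is `σ ^ n`, because `ρ ^ n =
    -- 1` and the factors commute.
    have hfix : (ρ ^ (-j) * σ) x = x := by
      rw [Perm.mul_apply, ← hj, ← Perm.mul_apply, ← zpow_add, neg_add_cancel, zpow_zero,
        Perm.one_apply]
    have h1 := Perm.pow_apply_eq_self_of_apply_eq_self hfix n
    have hcomm : Commute (ρ ^ (-j)) σ := (hc.zpow_right (-j)).symm
    have h2 : (ρ ^ (-j)) ^ n = 1 := by
      rw [← zpow_natCast, ← zpow_mul, mul_comm, zpow_mul, zpow_natCast]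
      have : ρ ^ n = 1 := Equiv.ext hρn
      rw [this, one_zpow]
    rwa [hcomm.mul_pow, h2, one_mul] at h1
  have := congrArg Perm.sign hσn
  rw [map_pow, map_one] at this
  rcases Int.units_eq_one_or (Perm.sign σ) with e | e
  · exact e
  · rw [e, hn_odd.neg_one_pow] at this
    exact absurd this (by decide)

/-- A permutation of the disjoint union of odd cycles that respects the cyclic orders has the same
sign as the permutation of the cycles. -/
theorem sign_eq_of_odd_cycles (hρ : ∀ x y, ρ.SameCycle x y ↔ p x = p y)
    (hodd : ∀ b, Odd (Finset.card {x | p x = b})) (n : ℕ) :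
    ∀ (σ : Perm C) (τ : Perm B), (∀ x, p (σ x) = τ (p x)) → Commute σ ρ →
      τ.support.card = n → Perm.sign σ = Perm.sign τ := by
  induction n using Nat.strong_induction_on with
  | _ n ih =>
    intro σ τ hστ hc hn
    by_cases hτ : τ = 1
    · subst hτ
      rw [Perm.sign_one]
      exact sign_eq_one_of_fibrewise hρ hodd (fun x => by simpa using hστ x) hc
    obtain ⟨v, hv⟩ : ∃ v, τ v ≠ v := by
      by_contra! hcon
      exact hτ (Equiv.ext hcon)
    let e : {x // p x = v} × Bool ↪ C :=
      ⟨fun z => if z.2 then σ z.1 else z.1, by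
        rintro ⟨x, b⟩ ⟨y, c⟩ h
        have key : ∀ x y : {x // p x = v}, σ x ≠ y := fun x y h => hv (by
          have := hστ x
          rw [h, x.2, y.2] at this
          exact this.symm)
        cases b <;> cases c
        · simpa [Subtype.ext_iff] using h
        · exact absurd h.symm (key y x)
        · exact absurd h (key x y)
        · simpa [Subtype.ext_iff] using h⟩
    -- The involution `s` exchanges the fibres over `v` and `τ v` along `σ`. It commutes with `ρ`,
    -- covers a transposition and, the fibres being odd, has sign $-1$ as well. Multiplying by it
    -- shrinks the support of `τ` and changes both signs.
    set s : Perm C := Perm.viaFintypeEmbedding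
      (prodCongrRight fun _ : {x // p x = v} => swap false true) e with hs
    have s1 : ∀ x, p x = v → s x = σ x := fun x hx =>
      Perm.viaFintypeEmbedding_apply_image _ e (⟨x, hx⟩, false)
    have s2 : ∀ x, p x = v → s (σ x) = x := fun x hx =>
      Perm.viaFintypeEmbedding_apply_image _ e (⟨x, hx⟩, true)
    have s3 : ∀ x, p x ≠ v → p x ≠ τ v → s x = x := fun x h1 h2 => by
      refine Perm.viaFintypeEmbedding_apply_notMem_range _ _ ?_
      rintro ⟨⟨y, b⟩, rfl⟩
      cases b
      · exact h1 y.2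
      · exact h2 ((hστ y).trans (by rw [y.2]))
    have hsign : Perm.sign s = -1 := by
      rw [hs, Perm.viaFintypeEmbedding_sign, Perm.sign_prodCongrRight]
      simp only [Perm.sign_swap (show false ≠ true by decide), Finset.prod_const]
      rw [Finset.card_univ, Fintype.card_subtype, (hodd v).neg_one_pow]
    have cases3 : ∀ {q : C → Prop}, (∀ x, p x = v → q x) → (∀ x, p x = v → q (σ x)) →
        (∀ x, p x ≠ v → p x ≠ τ v → q x) → ∀ x, q x := by
      intro q h1 h2 h3 x
      by_cases e1 : p x = v
      · exact h1 x e1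
      by_cases e2 : p x = τ v
      · obtain ⟨y, rfl⟩ := σ.surjective x
        rw [hστ, τ.injective.eq_iff] at e2
        exact h2 y e2
      exact h3 x e1 e2
    have hcov : ∀ x, p (s x) = swap v (τ v) (p x) := by
      refine cases3 (fun x hx => ?_) (fun x hx => ?_) fun x h1 h2 => ?_
      · rw [s1 x hx, hστ, hx, swap_apply_left]
      · rw [s2 x hx, hστ, hx, swap_apply_right]
      · rw [s3 x h1 h2, swap_apply_of_ne_of_ne h1 h2]
    have hρp : ∀ x, p (ρ x) = p x := fun x => (hρ _ _).1 (by rw [Perm.sameCycle_apply_left])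
    have hcx : ∀ x, σ (ρ x) = ρ (σ x) := fun x => Equiv.congr_fun hc.eq x
    have hcomm : Commute s ρ := by
      refine Equiv.ext ?_
      refine cases3 (fun x hx => ?_) (fun x hx => ?_) fun x h1 h2 => ?_ <;>
        simp only [Perm.mul_apply]
      · rw [s1 x hx, s1 _ ((hρp x).trans hx), hcx]
      · rw [s2 x hx, ← hcx, s2 _ ((hρp x).trans hx)]
      · rw [s3 x h1 h2, s3 _ (by rwa [hρp]) (by rwa [hρp])]
    have := ih _ (hn ▸ Perm.card_support_swap_mul hv) (s * σ) (swap v (τ v) * τ)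
      (fun x => by rw [Perm.mul_apply, Perm.mul_apply, hcov, hστ]) (hcomm.mul_left hc) rfl
    rw [Perm.sign_mul, Perm.sign_mul, hsign, Perm.sign_swap hv.symm] at this
    exact mul_left_cancel this

theorem sign_eq_mul_subtypePerm {α : Type*} [Fintype α] [DecidableEq α] (q : α → Prop)
    [DecidablePred q] (σ : Perm α) (h : ∀ x, q (σ x) ↔ q x) :
    Perm.sign σ = Perm.sign (σ.subtypePerm h) *
      Perm.sign (σ.subtypePerm (p := fun x => ¬ q x) fun x => not_congr (h x)) := by
  rw [← Perm.sign_subtypeCongr]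
  congr 1
  ext1 x
  by_cases hx : q x
  · rw [Perm.subtypeCongr.left_apply _ _ hx]; rfl
  · rw [Perm.subtypeCongr.right_apply _ _ hx]; rfl

end Sign

section Automorphism

variable {Γ : Graph r k m} {g : Reord k m}

theorem att_of_automorphism (hg : Γ.relabel g = Γ) (x : Fin k) :
    Γ.att (g.1 x) = g.2 (Γ.att x) := by
  have := congrFun (congrArg Graph.att hg) (g.1 x)
  simpa only [Graph.relabel, inv_apply_self'] using this.symm

theorem rot_of_automorphism (hg : Γ.relabel g = Γ) (hr : r = true) :
    Commute g.1 (Γ.rot hr) := by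
  have : g.1 * Γ.rot hr * g.1⁻¹ = Γ.rot hr := congrFun (congrArg Graph.rot hg) hr
  exact mul_inv_eq_iff_eq_mul.1 this

theorem accompanied_of_automorphism (hg : Γ.relabel g = Γ) (x : Fin k) :
    Γ.Accompanied (g.1 x) ↔ Γ.Accompanied x := by
  constructor
  · rintro ⟨b, hb, h⟩
    obtain ⟨b, rfl⟩ := g.1.surjective b
    rw [att_of_automorphism hg, att_of_automorphism hg, g.2.injective.eq_iff] at h
    exact ⟨b, fun e => hb (e ▸ rfl), h⟩
  · rintro ⟨b, hb, h⟩
    exact ⟨g.1 b, fun e => hb (g.1.injective e), by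
      rw [att_of_automorphism hg, att_of_automorphism hg, h]⟩

/-- `att` is a bijection that conjugates the permutation of the half-edges into that of the
vertices, so the signs agree. -/
theorem sgn_of_automorphism_of_univalent (h : ∀ a, ¬ Γ.Accompanied a) (hg : Γ.relabel g = Γ) :
    g.sgn = 1 := by
  have hbij : Function.Bijective Γ.att :=
    ⟨fun a b e => by_contra fun hne => h b ⟨a, hne, e⟩, Γ.att_surj⟩
  rw [Reord.sgn, Perm.sign_eq_sign_of_equiv g.1 g.2 (Equiv.ofBijective _ hbij)
    (att_of_automorphism hg), Int.units_mul_self]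

/-- Over the univalent vertices `att` is a bijection, so half-edges and vertices are permuted with
the same sign. Over the others the half-edges form odd cycles respected by the automorphism, and
again the signs agree. -/
theorem sgn_of_automorphism_of_odd {Γ : Graph true k m} {g : Reord k m}
    (h : ∀ v, Γ.valence v ≠ 1 → Odd (Γ.valence v)) (hg : Γ.relabel g = Γ) : g.sgn = 1 := by
  classical
  have hacc := accompanied_of_automorphism hg
  have hatt := att_of_automorphism hg
  have hval : ∀ v, Γ.valence (g.2 v) ≠ 1 ↔ Γ.valence v ≠ 1 := by
    intro v
    obtain ⟨a, rfl⟩ := Γ.att_surj v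
    rw [← hatt, ← Graph.accompanied_iff, ← Graph.accompanied_iff, hacc]
  have hrot : ∀ x, Γ.Accompanied (Γ.rot rfl x) ↔ Γ.Accompanied x := fun x => by
    rw [Graph.accompanied_iff, Graph.accompanied_iff, Γ.att_rot]
  rw [Reord.sgn, sign_eq_mul_subtypePerm Γ.Accompanied g.1 hacc,
    sign_eq_mul_subtypePerm (fun v => Γ.valence v ≠ 1) g.2 hval]
  have h1 : Perm.sign (g.1.subtypePerm hacc) = Perm.sign (g.2.subtypePerm (p := fun v => Γ.valence v ≠ 1) hval) := by
    let p : {a // Γ.Accompanied a} → {v // Γ.valence v ≠ 1} :=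
      fun a => ⟨Γ.att a, Graph.accompanied_iff.1 a.2⟩
    refine sign_eq_of_odd_cycles (p := p) (ρ := (Γ.rot rfl).subtypePerm hrot) ?_ ?_ _ _ _ ?_ ?_ rfl
    · intro x y
      rw [Perm.sameCycle_subtypePerm, Γ.rot_cycle, Subtype.ext_iff]
    · rintro ⟨v, hv⟩
      have := h v hv
      unfold Graph.valence at this
      convert this using 1
      refine Finset.card_bij (fun a _ => a.1) ?_ ?_ ?_
      · intro a ha
        simpa [p, Subtype.ext_iff] using ha
      · exact fun a _ b _ e => Subtype.ext e
      · intro a ha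
        have ha : Γ.att a = v := by simpa using ha
        exact ⟨⟨a, Graph.accompanied_iff.2 (ha ▸ hv)⟩, by simp [p, ha], rfl⟩
    · exact fun x => Subtype.ext (hatt x)
    · ext1 x
      exact Subtype.ext (Equiv.congr_fun (rot_of_automorphism hg rfl).eq x)
  have h2 : Perm.sign (g.1.subtypePerm (p := fun x => ¬ Γ.Accompanied x) fun x =>
      not_congr (hacc x)) = Perm.sign (g.2.subtypePerm (p := fun v => ¬ Γ.valence v ≠ 1) fun v =>
      not_congr (hval v)) := by
    let p : {a // ¬ Γ.Accompanied a} → {v // ¬ Γ.valence v ≠ 1} :=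
      fun a => ⟨Γ.att a, mt Graph.accompanied_iff.2 a.2⟩
    have hp : Function.Bijective p := by
      constructor
      · intro a b e
        by_contra hne
        exact b.2 ⟨a, fun e => hne (Subtype.ext e), Subtype.ext_iff.1 e⟩
      · rintro ⟨v, hv⟩
        obtain ⟨a, rfl⟩ := Γ.att_surj v
        exact ⟨⟨a, mt Graph.accompanied_iff.1 hv⟩, rfl⟩
    exact Perm.sign_eq_sign_of_equiv _ _ (Equiv.ofBijective p hp) fun x => Subtype.ext (hatt x)
  rw [h1, h2, Int.units_mul_self]

end Automorphism

end GraphCx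

theorem theorem3p7 (K : Type*) [Field K] [CharZero K] :
    -- ribbon graphs
    ((GraphCx.boundary K true ∘ₗ GraphCx.boundary K true = 0) ∧
      (∀ (k m : ℕ) (Γ : GraphCx.Graph true k m), Γ.IsUnionOfOddStars → GraphCx.cls K Γ ≠ 0) ∧
      ∃ hS : GraphCx.formalSpan K true GraphCx.Graph.IsUnionOfOddStars ≤
          LinearMap.ker (GraphCx.boundary K true),
        Function.Bijective (GraphCx.toHomology K hS)) ∧
    -- graphs
    ((GraphCx.boundary K false ∘ₗ GraphCx.boundary K false = 0) ∧
      (∀ (k m : ℕ) (Γ : GraphCx.Graph false k m), Γ.IsUnionOfSingleEdges → GraphCx.cls K Γ ≠ 0) ∧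
      ∃ hS : GraphCx.formalSpan K false GraphCx.Graph.IsUnionOfSingleEdges ≤
          LinearMap.ker (GraphCx.boundary K false),
        Function.Bijective (GraphCx.toHomology K hS)) := by
  refine ⟨⟨GraphCx.boundary_comp_boundary K, fun k m Γ hΓ => ?_, ?_⟩,
    ⟨GraphCx.boundary_comp_boundary K, fun k m Γ hΓ => ?_, ?_⟩⟩
  · exact GraphCx.cls_ne_zero_of_even_automorphisms K Γ fun g =>
      GraphCx.sgn_of_automorphism_of_odd hΓ.2.2
  · exact GraphCx.bijective_toHomology K _ (fun Γ h => h.innerCount)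
      (fun Γ => GraphCx.isUnionOfOddStars_or_cls_eq_zero K)
      (fun Γ => GraphCx.graphBoundary_of_oddStars K)
  · exact GraphCx.cls_ne_zero_of_even_automorphisms K Γ fun g =>
      GraphCx.sgn_of_automorphism_of_univalent hΓ.not_accompanied
  · exact GraphCx.bijective_toHomology K _
      (fun Γ h => GraphCx.Graph.innerCount_eq_zero.2 fun a ha => h.not_accompanied a ha.1)
      (fun Γ => GraphCx.isUnionOfSingleEdges_or_cls_eq_zero K)
      (fun Γ => GraphCx.graphBoundary_of_singleEdges K)
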